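/- Let $N\ge 2$ and let $M\subset\mathbb{C}^N$ be a connected (embedded, nonempty) real-analytic CR submanifold of positive real codimension, i.e. $\dim_{\mathbb{C}}(T_pM\cap iT_pM)$ is constant for $p\in M$. A germ $(\widetilde M,0)$ of a real-analytic CR submanifold of $\mathbb{C}^r$ is called holomorphically nondegenerate if every germ at $0$ of a holomorphic vector field $X=\sum_j a_j(Z)\,\partial/\partial Z_j$ on $\mathbb{C}^r$ that is tangent to $\widetilde M$ near $0$ (i.e. $(a_j(q))_j\in T_q\widetilde M\cap iT_q\widetilde M$ for all $q\in\widetilde M$ near $0$) vanishes on $\widetilde M$ near $0$. For germs of real submanifolds write $(M_1,p_1)\sim_h(M_2,p_2)$ if a germ of a biholomorphism of the ambient complex spaces sends $p_1$ to $p_2$ and the germ $(M_1,p_1)$ onto the germ $(M_2,p_2)$. Then there exists a unique integer $\lambda_M\in\{0,\dots,N-1\}$ for which there is a closed real-analytic subvariety $\Upsilon_M\subsetneq M$ such that $$M\setminus\Upsilon_M=\{p\in M:\ (M,p)\sim_h(\mathbb{C}^{\lambda_M}\times\widetilde M,0)\ \text{for some holomorphically nondegenerate germ } (\widetilde M,0)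 \text{ of a real-analytic CR submanifold of } \mathbb{C}^{N-\lambda_M}\},$$ and such that $\Upsilon_M$ is locally given by the intersection of complex-analytic subvarieties with $M$: every $p\in M$ has an open neighbourhood $U\subset\mathbb{C}^N$ with a complex-analytic subvariety $A$ of $U$, defined by finitely many holomorphic functions on $U$, such that $\Upsilon_M\cap U=M\cap A$. -/

import Mathlib

open Set Filter Topology

namespace CRGeom

section Definitions

variable {E F : Type*} [NormedAddCommGroup E] [NormedSpace ℂ E]
  [NormedAddCommGroup F] [NormedSpace ℂ F]

/-- `M` is an (embedded) real-analytic submanifold of real codimension `d`: near each of its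
points it is the zero set of a real-analytic submersion onto `ℝ ^ d`. -/
def IsRealAnalyticSubmanifold (d : ℕ) (M : Set E) : Prop :=
  ∀ p ∈ M, ∃ U : Set E, IsOpen U ∧ p ∈ U ∧ ∃ ρ : E → (Fin d → ℝ),
    AnalyticOnNhd ℝ ρ U ∧
    (∀ x ∈ U, Function.Surjective (fderiv ℝ ρ x)) ∧
    M ∩ U = {x | x ∈ U ∧ ρ x = 0}

/-- The real tangent space of `M` at `p`, as the common kernel of the differentials at `p` of the
real-analytic functions that vanish on `M` near `p`. If `M` is given near `p` by a real-analytic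
submersion `ρ`, this is the kernel of the differential of `ρ` at `p`. -/
def realTangentSpace (M : Set E) (p : E) : Submodule ℝ E where
  carrier := {v | ∀ f : E → ℝ, AnalyticAt ℝ f p → (∀ᶠ x in 𝓝[M] p, f x = 0) →
    fderiv ℝ f p v = 0}
  zero_mem' := fun f _ _ => map_zero _
  add_mem' := fun {v w} hv hw f hf h0 => by
    rw [map_add, hv f hf h0, hw f hf h0, add_zero]
  smul_mem' := fun c v hv f hf h0 => by
    rw [map_smul, hv f hf h0, smul_zero]

/-- The complex tangent space `T_p M ∩ i T_p M`. Under the identification of `∑ a_j ∂/∂Z_j` with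
the vector `(a_j)`, it is the space of `(1,0)`-vectors at `p` that are tangent to `M`. -/
def complexTangentSpace (M : Set E) (p : E) : Submodule ℂ E where
  carrier := {v | v ∈ realTangentSpace M p ∧ Complex.I • v ∈ realTangentSpace M p}
  zero_mem' := ⟨zero_mem _, by rw [smul_zero]; exact zero_mem _⟩
  add_mem' := fun {v w} hv hw =>
    ⟨add_mem hv.1 hw.1, by rw [smul_add]; exact add_mem hv.2 hw.2⟩
  smul_mem' := fun c v hv => by
    have h1 : c • v = c.re • v + c.im • (Complex.I • v) := by
      conv_lhs => rw [← Complex.re_add_im c]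
      rw [add_smul, mul_smul, Complex.coe_smul, Complex.coe_smul]
    have h2 : Complex.I • (c • v) = c.re • (Complex.I • v) - c.im • v := by
      rw [h1, smul_add, smul_comm Complex.I c.re v, smul_comm Complex.I c.im (Complex.I • v),
        smul_smul Complex.I Complex.I v, Complex.I_mul_I, neg_one_smul, smul_neg, sub_eq_add_neg]
    refine ⟨?_, ?_⟩
    · rw [h1]
      exact add_mem (Submodule.smul_mem _ _ hv.1) (Submodule.smul_mem _ _ hv.2)
    · rw [h2]
      exact sub_mem (Submodule.smul_mem _ _ hv.2) (Submodule.smul_mem _ _ hv.1)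

/-- `M` is a real-analytic CR submanifold of real codimension `d`: the complex dimension of its
complex tangent spaces (the CR dimension) is constant along `M`. -/
def IsRealAnalyticCRSubmanifold (d : ℕ) (M : Set E) : Prop :=
  IsRealAnalyticSubmanifold d M ∧
    ∃ n : ℕ, ∀ p ∈ M, Module.finrank ℂ (complexTangentSpace M p) = n

/-- The germ `(M, p)` is holomorphically nondegenerate: a holomorphic vector field near `p` that
is tangent to `M` near `p` is trivial. A vector field counts as trivial if it vanishes on `M` near
`p`, equivalently on the intrinsic complexification of `M` at `p`; when `M` is generic this means
that it vanishes in a neighbourhood of `p` in the ambient space. -/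
def IsHolomorphicallyNondegenerateAt (M : Set E) (p : E) : Prop :=
  ∀ X : E → E, AnalyticAt ℂ X p →
    (∀ᶠ q in 𝓝[M] p, X q ∈ complexTangentSpace M q) → ∀ᶠ q in 𝓝[M] p, X q = 0

/-- The germs `(M, p)` and `(M', p')` are biholomorphically equivalent: a biholomorphism between
neighbourhoods of `p` and `p'` sends `p` to `p'` and the germ of `M` onto the germ of `M'`. -/
def BiholomorphicGerms (M : Set E) (p : E) (M' : Set F) (p' : F) : Prop :=
  ∃ H : OpenPartialHomeomorph E F, p ∈ H.source ∧ H p = p' ∧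
    DifferentiableOn ℂ H H.source ∧ DifferentiableOn ℂ H.symm H.target ∧
    H '' (M ∩ H.source) = M' ∩ H.target

/-- `Υ` is a closed real-analytic subvariety of `M`: a subset of `M`, closed in `M`, which near
every point of `M` is the set of points of `M` where finitely many real-analytic functions
vanish. -/
def IsClosedRealAnalyticSubvariety (M Υ : Set E) : Prop :=
  Υ ⊆ M ∧ (∃ C : Set E, IsClosed C ∧ Υ = M ∩ C) ∧
    ∀ p ∈ M, ∃ U : Set E, IsOpen U ∧ p ∈ U ∧ ∃ (k : ℕ) (f : E → (Fin k → ℝ)),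
      AnalyticOnNhd ℝ f U ∧ Υ ∩ U = {x | x ∈ M ∩ U ∧ f x = 0}

/-- Near every point of `M`, the set `Υ` is the intersection of `M` with a complex-analytic
subvariety (the common zero set of finitely many holomorphic functions). -/
def IsLocallyComplexAnalyticIn (M Υ : Set E) : Prop :=
  ∀ p ∈ M, ∃ U : Set E, IsOpen U ∧ p ∈ U ∧ ∃ (k : ℕ) (f : E → (Fin k → ℂ)),
    AnalyticOnNhd ℂ f U ∧ Υ ∩ U = M ∩ {x | x ∈ U ∧ f x = 0}

end Definitions

/-- The points `p` of `M ⊆ ℂ ^ N` at which `(M, p)` is biholomorphically equivalent to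
`(ℂ ^ l × M', 0)` for some holomorphically nondegenerate germ at `0` of a real-analytic CR
submanifold `M'` of `ℂ ^ (N - l)`; used for `l < N`. -/
def straightPoints (N l : ℕ) (M : Set (Fin N → ℂ)) : Set (Fin N → ℂ) :=
  {p | p ∈ M ∧ ∃ (d' : ℕ) (M' : Set (Fin (N - l) → ℂ)),
    IsRealAnalyticCRSubmanifold d' M' ∧ (0 : Fin (N - l) → ℂ) ∈ M' ∧
    IsHolomorphicallyNondegenerateAt M' 0 ∧
    BiholomorphicGerms M p ((Set.univ : Set (Fin l → ℂ)) ×ˢ M') 0}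

end CRGeom

/-! Everything is read off one number: the dimension of `tangentValues M p`, the space of values at
p of the germs at p of holomorphic vector fields tangent to M. It is a biholomorphic invariant of
the germ (M, p). On ℂ^l × M' with M' holomorphically nondegenerate it equals l, since the
M'-component of a tangent field must vanish on the slices
(`finrank_tangentValues_of_mem_straightPoints`). Conversely, if it equals l at p and does not exceed
l nearby, the flows of l independent tangent fields identify (M, p) with ℂ^l times a transversal
slice of M, and a nontrivial tangent field on the slice would push the dimension above l
(`mem_straightPoints_of_finrank`). So Υ is the set where the dimension is below its generic value.

It remains to see that a generic value exists and that the drop locus is complex-analytic. Constancy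
of the CR dimension permits replacing M near p by its image in a complex space L on which no nonzero
holomorphic germ vanishes along that image. The complexified tangency equations become a family of
holomorphic one-forms on L, and tangent fields on M correspond to fields annihilated by these forms
(`exists_kernelValues_chart`). Let r be the generic rank of the family and n the dimension of L. The
values of annihilated fields span at most n - r dimensions, with equality at Z exactly when the r ×
r minors of r generically independent forms, after division by a common factor, have no common zero
at Z (`exists_equations_finrank_kernelValues`). The rank of the forms may drop on a hypersurface
without any drop of this dimension, so the common factor really has to be removed.

The greatest common divisor must serve all nearby points at once (`exists_coprime_factorization`).
Weierstrass preparation turns the minors into monic polynomials over the ring of holomorphic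
functions on a ball. That ring is integrally closed by Riemann's extension theorem, so Gauss's lemma
gives a monic gcd. A Bezout relation for the cofactors, whose right-hand side is a nonzero function
D of the base variable alone, excludes common divisors of the cofactors at every nearby point: the
zeros of such a divisor would project onto an open set where D vanishes.

Finally the locally defined generic dimensions agree because M is connected, l < N because the
codimension is positive, and l is unique because the generic dimension is attained on a dense subset
of M. -/

namespace CRGeom

/-! ### Osgood's lemma: continuity and holomorphy on lines imply joint analyticity. -/

/-- A function is line-holomorphic on `U` if it is continuous on `U` and complex differentiable
along every complex line. -/
def LineHolomorphicOn {E F : Type*} [NormedAddCommGroup E] [NormedSpace ℂ E]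
    [NormedAddCommGroup F] [NormedSpace ℂ F] (f : E → F) (U : Set E) : Prop :=
  ContinuousOn f U ∧ ∀ x ∈ U, ∀ v, DifferentiableAt ℂ (fun ζ : ℂ => f (x + ζ • v)) 0

/-- Differentiability along a line at all parameters for which the line stays in `U`. -/
theorem LineHolomorphicOn.differentiableOn_line {E F : Type*} [NormedAddCommGroup E]
    [NormedSpace ℂ E] [NormedAddCommGroup F] [NormedSpace ℂ F] {f : E → F} {U : Set E}
    (hf : LineHolomorphicOn f U) (x v : E) :
    DifferentiableOn ℂ (fun ζ : ℂ => f (x + ζ • v)) {ζ : ℂ | x + ζ • v ∈ U} := by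
  intro ζ hζ
  have h := hf.2 (x + ζ • v) hζ v
  have h2 : DifferentiableAt ℂ (fun ω : ℂ => ω - ζ) ζ := by fun_prop
  have h3 : DifferentiableAt ℂ
      ((fun ω : ℂ => f (x + ζ • v + ω • v)) ∘ fun ω : ℂ => ω - ζ) ζ :=
    DifferentiableAt.comp ζ (by simpa using h) h2
  have : ((fun ω : ℂ => f (x + ζ • v + ω • v)) ∘ fun ω : ℂ => ω - ζ) =
      fun ω : ℂ => f (x + ω • v) := by
    funext ω
    simp only [Function.comp]
    congr 1
    rw [sub_smul]; abel
  rw [this] at h3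
  exact h3.differentiableWithinAt

/-- Currying a line-holomorphic function of two variables over a compact set of values of
the first variable gives a function that is line-holomorphic with values in a function space. -/
theorem LineHolomorphicOn.curry {E F : Type*} [NormedAddCommGroup E]
    [NormedSpace ℂ E] [NormedAddCommGroup F] [NormedSpace ℂ F] [CompleteSpace F]
    {K : Type*} [TopologicalSpace K] [CompactSpace K] {V : Set E} (hV : IsOpen V)
    (f : K → E → F) (hf : ContinuousOn (Function.uncurry f) (univ ×ˢ V))
    (hd : ∀ k, LineHolomorphicOn (f k) V) (g : E → C(K, F)) (hg : ∀ z ∈ V, ∀ k, g z k = f k z) :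
    LineHolomorphicOn g V := by
  have hc : ContinuousOn g V := by
    rw [continuousOn_iff_continuous_domRestrict]
    let u : C(V × K, F) := ⟨fun x => f x.2 x.1, by
      have : ContinuousOn (Function.uncurry f ∘ fun x : V × K => (x.2, (x.1 : E))) univ :=
        hf.comp (by fun_prop) (fun x _ => ⟨mem_univ _, x.1.2⟩)
      exact continuousOn_univ.1 this⟩
    have : V.domRestrict g = u.curry := by
      funext z
      ext k
      exact hg z z.2 k
    rw [this]
    exact u.curry.continuous
  refine ⟨hc, fun x hx v => ?_⟩
  have hnhds : ∀ᶠ ζ : ℂ in 𝓝 0, x + ζ • v ∈ V := by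
    have : ContinuousAt (fun ζ : ℂ => x + ζ • v) 0 := by fun_prop
    exact this.eventually_mem (hV.mem_nhds (by simpa using hx))
  obtain ⟨ε, hε, hball⟩ := Metric.nhds_basis_closedBall.eventually_iff.1 hnhds
  have hcl : ContinuousOn (fun ζ : ℂ => g (x + ζ • v)) (Metric.closedBall 0 ε) :=
    hc.comp (by fun_prop) (fun ζ hζ => hball hζ)
  have hci : CircleIntegrable (fun ζ : ℂ => g (x + ζ • v)) 0 ε :=
    (hcl.mono Metric.sphere_subset_closedBall).circleIntegrable hε.le
  lift ε to NNReal using hε.le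
  have hε' : 0 < ε := hε
  -- The Cauchy integral of any continuous Banach-valued function is a power series; here its value
  -- at each `k` is given by the scalar Cauchy formula for `f k`, so it reproduces `g` along the
  -- line.
  have key := hasFPowerSeriesOn_cauchy_integral hci hε'
  refine (key.analyticAt.differentiableAt).congr_of_eventuallyEq ?_
  filter_upwards [Metric.ball_mem_nhds (0 : ℂ) hε] with ζ hζ
  ext k
  have hdk : DifferentiableOn ℂ (fun ζ : ℂ => f k (x + ζ • v)) (Metric.closedBall 0 ε) :=
    ((hd k).differentiableOn_line x v).mono (fun ζ hζ => hball hζ)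
  have h1 := hdk.circleIntegral_sub_inv_smul hζ
  have hci2 : CircleIntegrable (fun w : ℂ => (w - ζ)⁻¹ • g (x + w • v)) 0 ε := by
    refine ContinuousOn.circleIntegrable hε.le ?_
    refine ContinuousOn.smul (ContinuousOn.inv₀ (f := fun w : ℂ => w - ζ) (by fun_prop) ?_)
      (hcl.mono Metric.sphere_subset_closedBall)
    intro w hw h0
    rw [sub_eq_zero] at h0
    subst h0
    simp only [Metric.mem_ball, Metric.mem_sphere] at hζ hw
    exact absurd hw hζ.ne
  have h2 : (∮ w in C(0, ε), (w - ζ)⁻¹ • g (x + w • v)) k =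
      ∮ w in C(0, ε), (w - ζ)⁻¹ • f k (x + w • v) := by
    have e : ∀ G : C(K, F), G k = ContinuousMap.evalCLM ℂ k G := fun _ => rfl
    simp only [circleIntegral]
    rw [e, ← ContinuousLinearMap.intervalIntegral_comp_comm _ hci2.out]
    refine intervalIntegral.integral_congr fun θ _ => ?_
    simp only [map_smul]
    congr 2
    refine hg _ (hball ?_) k
    exact Metric.sphere_subset_closedBall (circleMap_mem_sphere _ hε.le _)
  rw [ContinuousMap.smul_apply, h2, h1, smul_smul, inv_mul_cancel₀ Complex.two_pi_I_ne_zero, one_smul]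
  exact hg _ (hball (Metric.ball_subset_closedBall hζ)) k

/-- The Cauchy kernel, as a function with values in the continuous functions on a circle, is
analytic inside the circle. -/
theorem exists_analytic_cauchyKernel (c : ℂ) {R : ℝ} :
    ∃ k : ℂ → C(Metric.sphere c R, ℂ), ∀ ζ ∈ Metric.ball c R, AnalyticAt ℂ k ζ ∧
      ∀ η : Metric.sphere c R, k ζ η = ((η : ℂ) - ζ)⁻¹ := by
  -- The kernel is the inverse of η - ζ in the Banach algebra of continuous functions on the circle,
  -- and inversion is analytic at units.
  let a : ℂ → C(Metric.sphere c R, ℂ) := fun ζ =>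
    ⟨fun η => (η : ℂ), by fun_prop⟩ - algebraMap ℂ C(Metric.sphere c R, ℂ) ζ
  have ha : ∀ ζ η, a ζ η = (η : ℂ) - ζ := fun ζ η => rfl
  refine ⟨fun ζ => Ring.inverse (a ζ), fun ζ hζ => ?_⟩
  have hne : ∀ η : Metric.sphere c R, (η : ℂ) - ζ ≠ 0 := by
    intro η h0
    rw [sub_eq_zero] at h0
    have := η.2
    rw [h0] at this
    simp only [Metric.mem_ball, Metric.mem_sphere] at hζ this
    exact absurd this hζ.ne
  let b : C(Metric.sphere c R, ℂ) := ⟨fun η => ((η : ℂ) - ζ)⁻¹,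
    (by fun_prop : Continuous fun η : Metric.sphere c R => (η : ℂ) - ζ).inv₀ hne⟩
  let u : C(Metric.sphere c R, ℂ)ˣ := ⟨a ζ, b, by
    ext η; exact mul_inv_cancel₀ (hne η), by ext η; exact inv_mul_cancel₀ (hne η)⟩
  constructor
  · have h1 : AnalyticAt ℂ Ring.inverse (a ζ) := analyticAt_inverse u
    have h2 : AnalyticAt ℂ a ζ := by
      refine AnalyticAt.sub analyticAt_const ?_
      exact (Algebra.linearMap ℂ C(Metric.sphere c R, ℂ)).toContinuousLinearMap.analyticAt ζ
    exact h1.comp h2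
  · intro η
    have : Ring.inverse (a ζ) = b := Ring.inverse_unit u
    simp only [this]; rfl

/-- The bilinear pairing given by integration of the product over a circle. -/
theorem exists_circle_pairing (F : Type*) [NormedAddCommGroup F] [NormedSpace ℂ F]
    (c : ℂ) {R : ℝ} (hR : 0 < R) :
    ∃ B : C(Metric.sphere c R, ℂ) →L[ℂ] C(Metric.sphere c R, F) →L[ℂ] F,
      ∀ k g, B k g = ∫ θ in (0 : ℝ)..2 * Real.pi, (circleMap 0 R θ * Complex.I) •
        k ⟨circleMap c R θ, circleMap_mem_sphere c hR.le θ⟩ •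
        g ⟨circleMap c R θ, circleMap_mem_sphere c hR.le θ⟩ := by
  let p : ℝ → Metric.sphere c R := fun θ => ⟨circleMap c R θ, circleMap_mem_sphere c hR.le θ⟩
  have hp : Continuous p := by
    refine Continuous.subtype_mk ?_ _
    exact continuous_circleMap c R
  have hc : ∀ (k : C(Metric.sphere c R, ℂ)) (g : C(Metric.sphere c R, F)),
      Continuous fun θ => (circleMap 0 R θ * Complex.I) • k (p θ) • g (p θ) := by
    intro k g
    have := continuous_circleMap 0 R
    fun_prop
  have hi : ∀ (k : C(Metric.sphere c R, ℂ)) (g : C(Metric.sphere c R, F)),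
      IntervalIntegrable (fun θ => (circleMap 0 R θ * Complex.I) • k (p θ) • g (p θ))
        MeasureTheory.volume 0 (2 * Real.pi) := fun k g => (hc k g).intervalIntegrable _ _
  refine ⟨LinearMap.mkContinuous₂ (LinearMap.mk₂ ℂ
    (fun k g => ∫ θ in (0 : ℝ)..2 * Real.pi, (circleMap 0 R θ * Complex.I) • k (p θ) • g (p θ))
    ?_ ?_ ?_ ?_) (R * |2 * Real.pi - 0|) ?_, fun k g => rfl⟩
  · intro k k' g
    rw [← intervalIntegral.integral_add (hi k g) (hi k' g)]
    simp [add_smul]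
  · intro a k g
    rw [← intervalIntegral.integral_smul]
    refine intervalIntegral.integral_congr fun θ _ => ?_
    simp only [ContinuousMap.smul_apply, smul_eq_mul, smul_smul]
    ring_nf
  · intro k g g'
    rw [← intervalIntegral.integral_add (hi k g) (hi k g')]
    simp [smul_add]
  · intro a k g
    rw [← intervalIntegral.integral_smul]
    refine intervalIntegral.integral_congr fun θ _ => ?_
    simp only [ContinuousMap.smul_apply, smul_smul]
    ring_nf
  · intro k g
    have : ‖∫ θ in (0 : ℝ)..2 * Real.pi, (circleMap 0 R θ * Complex.I) • k (p θ) • g (p θ)‖ ≤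
        (R * ‖k‖ * ‖g‖) * |2 * Real.pi - 0| := by
      refine intervalIntegral.norm_integral_le_of_norm_le_const fun θ _ => ?_
      rw [norm_smul, norm_smul, mul_assoc]
      gcongr
      · simp [abs_of_pos hR]
      · exact k.norm_coe_le_norm _
      · exact g.norm_coe_le_norm _
    refine this.trans (le_of_eq ?_)
    ring

/-- A complex normed space has the Osgood property if line-holomorphic functions on its open
subsets are analytic. -/
def HasOsgoodProperty (E : Type*) [NormedAddCommGroup E] [NormedSpace ℂ E] : Prop :=
  ∀ (F : Type) [NormedAddCommGroup F] [NormedSpace ℂ F] [CompleteSpace F] (f : E → F) (U : Set E),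
    IsOpen U → LineHolomorphicOn f U → AnalyticOnNhd ℂ f U

/-- Cauchy's formula in the first variable writes f(ζ, z) as a bilinear pairing of the kernel,
analytic in ζ, with the boundary slice f(·, z) in C(circle, F). The slice is line-holomorphic in z
with values in a Banach space, hence analytic by hypothesis; this is why the property quantifies
over all Banach targets. -/
theorem HasOsgoodProperty.prod {E : Type*} [NormedAddCommGroup E] [NormedSpace ℂ E]
    (hE : HasOsgoodProperty E) : HasOsgoodProperty (ℂ × E) := by
  rintro F _ _ _ f U hU hf ⟨ζ₀, z₀⟩ hx
  obtain ⟨R, hR, hball⟩ := Metric.nhds_basis_closedBall.mem_iff.1 (hU.mem_nhds hx)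
  have hsub : ∀ ζ ∈ Metric.closedBall ζ₀ R, ∀ z ∈ Metric.closedBall z₀ R, (ζ, z) ∈ U := by
    intro ζ hζ z hz
    apply hball
    rw [← closedBall_prod_same]
    exact ⟨hζ, hz⟩
  let K := Metric.sphere ζ₀ R
  let fK : K → E → F := fun η z => f (η, z)
  have hfK : ContinuousOn (Function.uncurry fK) (univ ×ˢ Metric.ball z₀ R) := by
    have : Function.uncurry fK = f ∘ fun x : K × E => ((x.1 : ℂ), x.2) := rfl
    rw [this]
    refine hf.1.comp (by fun_prop) ?_
    rintro ⟨η, z⟩ ⟨_, hz⟩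
    exact hsub _ (Metric.sphere_subset_closedBall η.2) _ (Metric.ball_subset_closedBall hz)
  classical
  let g : E → C(K, F) := fun z => if hz : z ∈ Metric.ball z₀ R then
    ⟨fun η => f (η, z), by
      have : ContinuousOn (f ∘ fun η : K => ((η : ℂ), z)) univ := hf.1.comp (by fun_prop)
        fun η _ => hsub _ (Metric.sphere_subset_closedBall η.2) _ (Metric.ball_subset_closedBall hz)
      exact continuousOn_univ.1 this⟩ else 0
  have hg : ∀ z ∈ Metric.ball z₀ R, ∀ η, g z η = f (η, z) := by
    intro z hz η
    simp only [g, dif_pos hz]; rfl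
  have hline : ∀ η : K, LineHolomorphicOn (fK η) (Metric.ball z₀ R) := by
    intro η
    constructor
    · refine hf.1.comp (by fun_prop) ?_
      exact fun z hz => hsub _ (Metric.sphere_subset_closedBall η.2) _
        (Metric.ball_subset_closedBall hz)
    · intro z hz v
      have := hf.2 (η, z) (hsub _ (Metric.sphere_subset_closedBall η.2) _
        (Metric.ball_subset_closedBall hz)) (0, v)
      simpa using this
  have hgl : LineHolomorphicOn g (Metric.ball z₀ R) :=
    LineHolomorphicOn.curry Metric.isOpen_ball fK hfK hline g hg
  have hga : AnalyticAt ℂ g z₀ := hE _ g _ Metric.isOpen_ball hgl z₀ (Metric.mem_ball_self hR)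
  obtain ⟨k, hk⟩ := exists_analytic_cauchyKernel ζ₀ (R := R)
  obtain ⟨B, hB⟩ := exists_circle_pairing F ζ₀ hR
  have hrep : (fun x : ℂ × E => (2 * Real.pi * Complex.I : ℂ)⁻¹ • B (k x.1) (g x.2))
      =ᶠ[𝓝 (ζ₀, z₀)] f := by
    have : Metric.ball ζ₀ R ×ˢ Metric.ball z₀ R ∈ 𝓝 (ζ₀, z₀) :=
      prod_mem_nhds (Metric.ball_mem_nhds _ hR) (Metric.ball_mem_nhds _ hR)
    filter_upwards [this]
    rintro ⟨ζ, z⟩ ⟨hζ, hz⟩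
    simp only at hζ hz ⊢
    have hd : DifferentiableOn ℂ (fun η : ℂ => f (η, z)) (Metric.closedBall ζ₀ R) := by
      have := (hf.differentiableOn_line (0, z) (1, 0)).mono
        (s := Metric.closedBall ζ₀ R) (fun η hη => by
          simpa using hsub η hη z (Metric.ball_subset_closedBall hz))
      simpa using this
    have h1 := hd.circleIntegral_sub_inv_smul hζ
    rw [hB]
    simp only [circleIntegral] at h1
    have h2 : ∫ θ in (0 : ℝ)..2 * Real.pi, (circleMap 0 R θ * Complex.I) •
        k ζ ⟨circleMap ζ₀ R θ, circleMap_mem_sphere ζ₀ hR.le θ⟩ •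
        g z ⟨circleMap ζ₀ R θ, circleMap_mem_sphere ζ₀ hR.le θ⟩ =
        (2 * Real.pi * Complex.I : ℂ) • f (ζ, z) := by
      rw [← h1]
      refine intervalIntegral.integral_congr fun θ _ => ?_
      simp only [deriv_circleMap]
      rw [(hk ζ hζ).2, hg z hz]
    rw [h2, smul_smul, inv_mul_cancel₀ Complex.two_pi_I_ne_zero, one_smul]
  refine AnalyticAt.congr ?_ hrep
  refine AnalyticAt.const_smul ?_
  have h1 : AnalyticAt ℂ (fun x : ℂ × E => (k x.1, g x.2)) (ζ₀, z₀) := by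
    refine AnalyticAt.prod ?_ ?_
    · exact AnalyticAt.fun_comp (g := k) (hk ζ₀ (Metric.mem_ball_self hR)).1 analyticAt_fst
    · exact AnalyticAt.fun_comp (g := g) hga analyticAt_snd
  exact AnalyticAt.fun_comp (g := fun y : C(K, ℂ) × C(K, F) => B y.1 y.2)
    (B.analyticAt_bilinear _) h1

theorem HasOsgoodProperty.of_equiv {E E' : Type*} [NormedAddCommGroup E] [NormedSpace ℂ E]
    [NormedAddCommGroup E'] [NormedSpace ℂ E'] (hE : HasOsgoodProperty E) (e : E ≃L[ℂ] E') :
    HasOsgoodProperty E' := by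
  intro F _ _ _ f U hU hf x hx
  have h1 : LineHolomorphicOn (f ∘ e) (e ⁻¹' U) := by
    refine ⟨hf.1.comp e.continuous.continuousOn (fun _ h => h), fun y hy v => ?_⟩
    simpa using hf.2 (e y) hy (e v)
  have h2 := hE F _ _ (hU.preimage e.continuous) h1 (e.symm x) (by simpa using hx)
  have h3 : AnalyticAt ℂ ((f ∘ e) ∘ e.symm) x :=
    h2.comp (e.symm.analyticAt x)
  simpa [Function.comp_def] using h3

theorem hasOsgoodProperty_pi (n : ℕ) : HasOsgoodProperty (Fin n → ℂ) := by
  induction n with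
  | zero =>
    intro F _ _ _ f U _ _ x _
    have : f = fun _ => f x := funext fun y => congrArg f (Subsingleton.elim _ _)
    rw [this]
    exact analyticAt_const
  | succ n ih => exact ih.prod.of_equiv (Fin.consEquivL ℂ (fun _ : Fin (n + 1) => ℂ))

/-- Osgood's lemma. -/
theorem LineHolomorphicOn.analyticOnNhd {E : Type*} [NormedAddCommGroup E] [NormedSpace ℂ E]
    [FiniteDimensional ℂ E] {F : Type} [NormedAddCommGroup F] [NormedSpace ℂ F] [CompleteSpace F]
    {f : E → F} {U : Set E} (hf : LineHolomorphicOn f U) (hU : IsOpen U) :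
    AnalyticOnNhd ℂ f U :=
  (hasOsgoodProperty_pi _).of_equiv (ContinuousLinearEquiv.ofFinrankEq (𝕜 := ℂ)
    (E := Fin (Module.finrank ℂ E) → ℂ) (F := E) (by simp)) F f U hU hf

theorem analyticOnNhd_of_differentiableOn {E : Type*} [NormedAddCommGroup E] [NormedSpace ℂ E]
    [FiniteDimensional ℂ E] {F : Type} [NormedAddCommGroup F] [NormedSpace ℂ F] [CompleteSpace F]
    {f : E → F} {U : Set E} (hf : DifferentiableOn ℂ f U) (hU : IsOpen U) :
    AnalyticOnNhd ℂ f U := by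
  refine LineHolomorphicOn.analyticOnNhd ⟨hf.continuousOn, fun x hx v => ?_⟩ hU
  have h1 : DifferentiableAt ℂ f (x + (0 : ℂ) • v) := by
    simpa using hf.differentiableAt (hU.mem_nhds hx)
  exact DifferentiableAt.comp (f := fun ζ : ℂ => x + ζ • v) (0 : ℂ) h1 (by fun_prop)

end CRGeom

namespace CRGeom

/-! ### Integrals and uniform limits of holomorphic functions with parameters. -/

section ParametricIntegrals

variable {E : Type*} [NormedAddCommGroup E] [NormedSpace ℂ E] [FiniteDimensional ℂ E]
  {F : Type} [NormedAddCommGroup F] [NormedSpace ℂ F] [CompleteSpace F]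

theorem lineHolomorphicOn_of_analyticOnNhd {E : Type*} [NormedAddCommGroup E] [NormedSpace ℂ E]
    {F : Type*} [NormedAddCommGroup F] [NormedSpace ℂ F] {f : E → F} {U : Set E}
    (hf : AnalyticOnNhd ℂ f U) : LineHolomorphicOn f U := by
  refine ⟨hf.continuousOn, fun x hx v => ?_⟩
  have h1 : DifferentiableAt ℂ f (x + (0 : ℂ) • v) := by
    simpa using (hf x hx).differentiableAt
  exact DifferentiableAt.comp (f := fun ζ : ℂ => x + ζ • v) (0 : ℂ) h1 (by fun_prop)

/-- Integration of continuous functions on a compact interval, as a continuous linear map. -/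
theorem exists_intervalIntegralCLM (F : Type*) [NormedAddCommGroup F] [NormedSpace ℂ F] {a b : ℝ}
    (hab : a ≤ b) :
    ∃ J : C(Icc a b, F) →L[ℂ] F, ∀ g, J g = ∫ θ in a..b, g (projIcc a b hab θ) := by
  have hc : ∀ g : C(Icc a b, F), Continuous fun θ => g (projIcc a b hab θ) := fun g =>
    g.continuous.comp continuous_projIcc
  refine ⟨LinearMap.mkContinuous ⟨⟨fun g => ∫ θ in a..b, g (projIcc a b hab θ), ?_⟩, ?_⟩
    |b - a| ?_, fun g => rfl⟩
  · intro g g'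
    rw [← intervalIntegral.integral_add ((hc g).intervalIntegrable _ _)
      ((hc g').intervalIntegrable _ _)]
    rfl
  · intro c g
    rw [RingHom.id_apply, ← intervalIntegral.integral_smul]
    rfl
  · intro g
    rw [mul_comm]
    exact intervalIntegral.norm_integral_le_of_norm_le_const fun θ _ => g.norm_coe_le_norm _

/-- An integral that depends analytically on a parameter. -/
theorem analyticOnNhd_intervalIntegral {U : Set E} (hU : IsOpen U) {a b : ℝ} (hab : a ≤ b)
    (f : E → ℝ → F) (hc : ContinuousOn (Function.uncurry f) (U ×ˢ Icc a b))
    (hf : ∀ θ ∈ Icc a b, AnalyticOnNhd ℂ (fun z => f z θ) U) :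
    AnalyticOnNhd ℂ (fun z => ∫ θ in a..b, f z θ) U := by
  classical
  obtain ⟨J, hJ⟩ := exists_intervalIntegralCLM F hab
  let g : E → C(Icc a b, F) := fun z => if hz : z ∈ U then
    ⟨fun θ => f z θ, by
      have : ContinuousOn (Function.uncurry f ∘ fun θ : Icc a b => (z, (θ : ℝ))) univ :=
        hc.comp (by fun_prop) fun θ _ => ⟨hz, θ.2⟩
      exact continuousOn_univ.1 this⟩ else 0
  have hg : ∀ z ∈ U, ∀ θ : Icc a b, g z θ = f z θ := by
    intro z hz θ
    simp only [g, dif_pos hz]; rfl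
  have h1 : LineHolomorphicOn g U := by
    refine LineHolomorphicOn.curry hU (fun (θ : Icc a b) z => f z θ) ?_
      (fun θ => lineHolomorphicOn_of_analyticOnNhd (hf θ θ.2)) g hg
    have : Function.uncurry (fun (θ : Icc a b) z => f z θ) =
        Function.uncurry f ∘ fun x : Icc a b × E => (x.2, (x.1 : ℝ)) := rfl
    rw [this]
    exact hc.comp (by fun_prop) fun x hx => ⟨hx.2, x.1.2⟩
  have h2 : AnalyticOnNhd ℂ (fun z => J (g z)) U := fun z hz =>
    AnalyticAt.fun_comp (J.analyticAt _) (h1.analyticOnNhd hU z hz)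
  refine h2.congr hU fun z hz => ?_
  rw [hJ]
  refine intervalIntegral.integral_congr fun θ hθ => ?_
  rw [uIcc_of_le hab] at hθ
  rw [hg z hz, projIcc_of_mem hab hθ]

/-- A circle integral that depends analytically on a parameter. -/
theorem analyticOnNhd_circleIntegral {U : Set E} (hU : IsOpen U) (c : ℂ) {R : ℝ} (hR : 0 ≤ R)
    (f : E → ℂ → F) (hc : ContinuousOn (Function.uncurry f) (U ×ˢ Metric.sphere c R))
    (hf : ∀ η ∈ Metric.sphere c R, AnalyticOnNhd ℂ (fun z => f z η) U) :
    AnalyticOnNhd ℂ (fun z => ∮ η in C(c, R), f z η) U := by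
  simp only [circleIntegral]
  refine analyticOnNhd_intervalIntegral hU (by positivity) _ ?_ ?_
  · have h1 : ContinuousOn (fun x : E × ℝ => Function.uncurry f (x.1, circleMap c R x.2))
        (U ×ˢ Icc 0 (2 * Real.pi)) := by
      refine hc.comp (Continuous.continuousOn ?_) fun x hx => ⟨hx.1, circleMap_mem_sphere c hR _⟩
      exact continuous_fst.prodMk ((continuous_circleMap c R).comp continuous_snd)
    have h2 : Continuous (fun x : E × ℝ => deriv (circleMap c R) x.2) := by
      simp only [deriv_circleMap]
      exact ((continuous_circleMap 0 R).comp continuous_snd).mul continuous_const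
    exact h2.continuousOn.smul h1
  · intro θ _ z hz
    exact (hf _ (circleMap_mem_sphere c hR θ) z hz).const_smul

/-- On each line this is the one-variable Weierstrass theorem, and Osgood's lemma assembles the
lines. -/
theorem analyticOnNhd_of_tendstoUniformlyOn {U : Set E} (hU : IsOpen U) {f : ℕ → E → F} {g : E → F}
    (hf : ∀ n, AnalyticOnNhd ℂ (f n) U) (h : TendstoUniformlyOn f g atTop U) :
    AnalyticOnNhd ℂ g U := by
  refine LineHolomorphicOn.analyticOnNhd ⟨?_, fun x hx v => ?_⟩ hU
  · exact h.continuousOn (Frequently.of_forall fun n => (hf n).continuousOn)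
  · have hO : IsOpen ((fun ζ : ℂ => x + ζ • v) ⁻¹' U) := hU.preimage (by fun_prop)
    have h1 : TendstoLocallyUniformlyOn (fun n (ζ : ℂ) => f n (x + ζ • v))
        (fun ζ => g (x + ζ • v)) atTop ((fun ζ : ℂ => x + ζ • v) ⁻¹' U) :=
      (h.comp fun ζ : ℂ => x + ζ • v).tendstoLocallyUniformlyOn
    have h2 := h1.differentiableOn (Eventually.of_forall fun n =>
      (lineHolomorphicOn_of_analyticOnNhd (hf n)).differentiableOn_line x v) hO
    exact h2.differentiableAt (hO.mem_nhds (by simpa using hx))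

end ParametricIntegrals

/-! ### Riemann's extension theorem for locally bounded quotients. -/

section RiemannExtension

theorem convex_line_preimage {E : Type*} [NormedAddCommGroup E] [NormedSpace ℂ E] {S : Set E}
    (hS : Convex ℝ S) (z v : E) : Convex ℝ {ζ : ℂ | z + ζ • v ∈ S} := by
  intro a ha b hb s t hs ht hst
  have : z + (s • a + t • b) • v = s • (z + a • v) + t • (z + b • v) := by
    rw [add_smul, smul_add, smul_add, smul_assoc, smul_assoc]
    nth_rw 1 [← one_smul ℝ z]
    rw [← hst, add_smul]
    abel
  change z + (s • a + t • b) • v ∈ S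
  rw [this]
  exact hS ha hb hs ht hst

/-- Local analytic quotients glue. -/
theorem exists_analytic_quotient_of_local {E : Type*} [NormedAddCommGroup E] [NormedSpace ℂ E]
    {U : Set E} (hU : IsOpen U) {f g : E → ℂ} (hfc : ContinuousOn f U) (hgc : ContinuousOn g U)
    (hg : ∀ x ∈ U, ∃ᶠ y in 𝓝 x, g y ≠ 0)
    (h : ∀ x ∈ U, ∃ q : E → ℂ, AnalyticAt ℂ q x ∧ ∀ᶠ y in 𝓝 x, g y ≠ 0 → f y = q y * g y) :
    ∃ q : E → ℂ, AnalyticOnNhd ℂ q U ∧ ∀ x ∈ U, f x = q x * g x := by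
  -- The limit of f/g through points with g ≠ 0 depends on no choice, so the local quotients glue
  -- automatically.
  let Q : E → ℂ := fun x => limUnder (𝓝[{y | g y ≠ 0}] x) fun y => f y / g y
  have key : ∀ x ∈ U, ∀ q : E → ℂ, AnalyticAt ℂ q x →
      (∀ᶠ y in 𝓝 x, g y ≠ 0 → f y = q y * g y) → Q =ᶠ[𝓝 x] q := by
    intro x hx q hq hfq
    filter_upwards [hfq.eventually_nhds, hq.eventually_analyticAt, hU.mem_nhds hx] with y hy hqy hyU
    have hne : (𝓝[{y | g y ≠ 0}] y).NeBot := by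
      rw [nhdsWithin, ← frequently_mem_iff_neBot]
      exact hg y hyU
    refine Tendsto.limUnder_eq ?_
    refine Tendsto.congr' ?_ (hqy.continuousAt.tendsto.mono_left nhdsWithin_le_nhds)
    filter_upwards [nhdsWithin_le_nhds hy, self_mem_nhdsWithin] with z hz hgz
    rw [hz hgz, mul_div_cancel_right₀ _ hgz]
  refine ⟨Q, fun x hx => ?_, fun x hx => ?_⟩
  · obtain ⟨q, hq, hfq⟩ := h x hx
    exact hq.congr (key x hx q hq hfq).symm
  · obtain ⟨q, hq, hfq⟩ := h x hx
    rw [(key x hx q hq hfq).self_of_nhds]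
    by_contra hne
    have hc : ContinuousAt (fun y => f y - q y * g y) x :=
      (hfc.continuousAt (hU.mem_nhds hx)).sub
        (hq.continuousAt.mul (hgc.continuousAt (hU.mem_nhds hx)))
    have h1 := hc.eventually_ne (sub_ne_zero.2 hne)
    obtain ⟨y, hy, h2, h3⟩ := ((hg x hx).and_eventually (hfq.and h1)).exists
    exact h3 (sub_eq_zero.2 (h2 hy))

/-- Riemann's extension theorem for a quotient of holomorphic functions of one variable. -/
theorem exists_analytic_quotient_one {U : Set ℂ} (hU : IsOpen U) {f g : ℂ → ℂ}
    (hf : AnalyticOnNhd ℂ f U) (hg : AnalyticOnNhd ℂ g U)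
    (hg0 : ∀ x ∈ U, ∃ᶠ y in 𝓝 x, g y ≠ 0) {C : ℝ} (hb : ∀ x ∈ U, ‖f x‖ ≤ C * ‖g x‖) :
    ∃ q : ℂ → ℂ, AnalyticOnNhd ℂ q U ∧ ∀ x ∈ U, f x = q x * g x := by
  refine exists_analytic_quotient_of_local hU hf.continuousOn hg.continuousOn hg0 fun x hx => ?_
  have hne : ∀ᶠ y in 𝓝[≠] x, g y ≠ 0 :=
    (hg x hx).eventually_eq_zero_or_eventually_ne_zero.resolve_left fun h => hg0 x hx
      (h.mono fun y hy => not_not.2 hy)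
  rw [eventually_nhdsWithin_iff] at hne
  obtain ⟨ε, hε, hball⟩ := Metric.nhds_basis_ball.mem_iff.1 (inter_mem hne (hU.mem_nhds hx))
  have hs : Metric.ball x ε ∈ 𝓝 x := Metric.ball_mem_nhds x hε
  have hd : DifferentiableOn ℂ (fun y => f y / g y) (Metric.ball x ε \ {x}) := by
    intro y hy
    exact ((hf y (hball hy.1).2).differentiableAt.div (hg y (hball hy.1).2).differentiableAt
      ((hball hy.1).1 hy.2)).differentiableWithinAt
  have hbd : BddAbove (norm ∘ (fun y => f y / g y) '' (Metric.ball x ε \ {x})) := by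
    refine ⟨C, ?_⟩
    rintro _ ⟨y, hy, rfl⟩
    have hgy : g y ≠ 0 := (hball hy.1).1 hy.2
    simp only [Function.comp, norm_div]
    rw [div_le_iff₀ (norm_pos_iff.2 hgy)]
    exact hb y (hball hy.1).2
  have h1 := Complex.differentiableOn_update_limUnder_of_bddAbove hs hd hbd
  refine ⟨_, h1.analyticAt hs, ?_⟩
  have hxc : ∀ᶠ y in 𝓝[≠] x, g y ≠ 0 → f y =
      Function.update (fun y => f y / g y) x (limUnder (𝓝[≠] x) fun y => f y / g y) y * g y := by
    filter_upwards [self_mem_nhdsWithin] with y hy hgy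
    rw [Function.update_of_ne hy, div_mul_cancel₀ _ hgy]
  rw [eventually_nhdsWithin_iff] at hxc
  by_cases hgx : g x = 0
  · filter_upwards [hxc] with y hy hgy
    exact hy (fun h => hgy (h ▸ hgx)) hgy
  · have hcont : ContinuousAt (fun y => f y / g y) x :=
      (hf x hx).continuousAt.div (hg x hx).continuousAt hgx
    have : limUnder (𝓝[≠] x) (fun y => f y / g y) = f x / g x :=
      (hcont.tendsto.mono_left nhdsWithin_le_nhds).limUnder_eq
    filter_upwards with y hgy
    rw [this, Function.update_eq_self x (fun y => f y / g y), div_mul_cancel₀ _ hgy]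

/-- The zeros of a nontrivial holomorphic function are avoided by a small circle in some
complex line. -/
theorem exists_direction_ne_zero {E : Type*} [NormedAddCommGroup E] [NormedSpace ℂ E] {g : E → ℂ}
    {x : E} (hg : AnalyticAt ℂ g x) (hg0 : ∃ᶠ y in 𝓝 x, g y ≠ 0) :
    ∃ v : E, ∀ᶠ ζ : ℂ in 𝓝[≠] 0, g (x + ζ • v) ≠ 0 := by
  obtain ⟨r, hr, hball⟩ := Metric.nhds_basis_ball.eventually_iff.1 hg.eventually_analyticAt
  obtain ⟨y, hy, hyr⟩ := (hg0.and_eventually (Metric.ball_mem_nhds x hr)).exists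
  -- The line from x through a nearby point y with g y ≠ 0 works: on it g is not identically zero,
  -- since parameter 1 gives g y, so the zero at parameter 0, if any, is isolated.
  refine ⟨y - x, ?_⟩
  let S : Set ℂ := (fun ζ : ℂ => x + ζ • (y - x)) ⁻¹' Metric.ball x r
  have hline : ∀ ζ : ℂ, AnalyticAt ℂ (fun ζ : ℂ => x + ζ • (y - x)) ζ := fun ζ =>
    analyticAt_const.add (analyticAt_id.smul analyticAt_const)
  have han : AnalyticOnNhd ℂ (fun ζ : ℂ => g (x + ζ • (y - x))) S := fun ζ hζ =>
    AnalyticAt.fun_comp (g := g) (hball hζ) (hline ζ)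
  have hS : IsPreconnected S :=
    (convex_line_preimage (convex_ball x r) x (y - x)).isPreconnected
  have h0S : (0 : ℂ) ∈ S := by simpa [S] using hr
  refine (han 0 h0S).eventually_eq_zero_or_eventually_ne_zero.resolve_left fun h => ?_
  have := han.eqOn_zero_of_preconnected_of_eventuallyEq_zero hS h0S h
    (show (1 : ℂ) ∈ S by simpa [S] using hyr)
  simp at this
  exact hy this

/-- Riemann's extension theorem for a quotient of holomorphic functions of several variables. -/
theorem exists_analytic_quotient {E : Type*} [NormedAddCommGroup E] [NormedSpace ℂ E]
    [FiniteDimensional ℂ E] {U : Set E} (hU : IsOpen U) {f g : E → ℂ}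
    (hf : AnalyticOnNhd ℂ f U) (hg : AnalyticOnNhd ℂ g U)
    (hg0 : ∀ x ∈ U, ∃ᶠ y in 𝓝 x, g y ≠ 0)
    (hb : ∀ x ∈ U, ∃ C : ℝ, ∀ᶠ y in 𝓝 x, ‖f y‖ ≤ C * ‖g y‖) :
    ∃ q : E → ℂ, AnalyticOnNhd ℂ q U ∧ ∀ x ∈ U, f x = q x * g x := by
  refine exists_analytic_quotient_of_local hU hf.continuousOn hg.continuousOn hg0 fun x hx => ?_
  obtain ⟨C, hC⟩ := hb x hx
  obtain ⟨v, hv⟩ := exists_direction_ne_zero (hg x hx) (hg0 x hx)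
  have hC' : ∀ᶠ y in 𝓝 x, y ∈ U ∧ ‖f y‖ ≤ C * ‖g y‖ := (hU.eventually_mem hx).and hC
  obtain ⟨r, hr, hball⟩ := Metric.nhds_basis_ball.eventually_iff.1 hC'
  rw [eventually_nhdsWithin_iff] at hv
  have hsm : ∀ᶠ ζ : ℂ in 𝓝 0, x + ζ • v ∈ Metric.ball x r := by
    have : ContinuousAt (fun ζ : ℂ => x + ζ • v) 0 := by fun_prop
    exact this.eventually_mem (by simpa using Metric.ball_mem_nhds x hr)
  obtain ⟨δ, hδ, hδb⟩ := Metric.nhds_basis_closedBall.eventually_iff.1 (hv.and hsm)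
  have ev1 : ∀ᶠ z in 𝓝 x, ∀ ζ ∈ Metric.closedBall (0 : ℂ) δ, z + ζ • v ∈ Metric.ball x r := by
    refine (isCompact_closedBall (0 : ℂ) δ).eventually_forall_of_forall_eventually fun ζ hζ => ?_
    have : ContinuousAt (fun p : E × ℂ => p.1 + p.2 • v) (x, ζ) := by fun_prop
    exact this.eventually_mem (Metric.isOpen_ball.mem_nhds (hδb hζ).2)
  have ev2 : ∀ᶠ z in 𝓝 x, ∀ ζ ∈ Metric.sphere (0 : ℂ) δ, g (z + ζ • v) ≠ 0 := by
    refine (isCompact_sphere (0 : ℂ) δ).eventually_forall_of_forall_eventually fun ζ hζ => ?_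
    have hζ' := hδb (Metric.sphere_subset_closedBall hζ)
    have h1 : ContinuousAt g (x + ζ • v) := (hg _ (hball hζ'.2).1).continuousAt
    have h2 : ContinuousAt (fun p : E × ℂ => p.1 + p.2 • v) (x, ζ) := by fun_prop
    have h3 : ContinuousAt (fun p : E × ℂ => g (p.1 + p.2 • v)) (x, ζ) :=
      ContinuousAt.comp (g := g) (f := fun p : E × ℂ => p.1 + p.2 • v) h1 h2
    refine h3.eventually_ne (hζ'.1 ?_)
    exact ne_of_mem_of_not_mem hζ (by simp [hδ.ne])
  obtain ⟨U₁, hU₁, hU₁o, hxU₁⟩ := eventually_nhds_iff.1 (ev1.and ev2)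
  -- The quotient is defined by Cauchy's integral of f/g over a small circle in the direction v. By
  -- compactness g has no zeros on the translates of that circle through nearby z, so q is analytic
  -- in z.
  let q : E → ℂ := fun z => (2 * Real.pi * Complex.I : ℂ)⁻¹ •
    ∮ ζ in C(0, δ), (ζ - 0)⁻¹ • (f (z + ζ • v) / g (z + ζ • v))
  have hcomp : ∀ (u : E → ℂ), AnalyticOnNhd ℂ u U → ∀ z ∈ U₁, ∀ ζ ∈ Metric.closedBall (0 : ℂ) δ,
      AnalyticAt ℂ u (z + ζ • v) := fun u hu z hz ζ hζ => hu _ (hball ((hU₁ z hz).1 ζ hζ)).1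
  have hq : AnalyticOnNhd ℂ q U₁ := by
    intro z hz
    refine AnalyticAt.fun_const_smul ?_
    refine analyticOnNhd_circleIntegral hU₁o 0 hδ.le
      (fun z ζ => (ζ - 0)⁻¹ • (f (z + ζ • v) / g (z + ζ • v))) ?_ ?_ z hz
    · rintro ⟨z, ζ⟩ ⟨hz, hζ⟩
      have hcl := Metric.sphere_subset_closedBall hζ
      have h2 : ContinuousAt (fun p : E × ℂ => p.1 + p.2 • v) (z, ζ) := by fun_prop
      have hf' : ContinuousAt (fun p : E × ℂ => f (p.1 + p.2 • v)) (z, ζ) :=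
        ContinuousAt.comp (g := f) (f := fun p : E × ℂ => p.1 + p.2 • v)
          (hcomp f hf z hz ζ hcl).continuousAt h2
      have hg' : ContinuousAt (fun p : E × ℂ => g (p.1 + p.2 • v)) (z, ζ) :=
        ContinuousAt.comp (g := g) (f := fun p : E × ℂ => p.1 + p.2 • v)
          (hcomp g hg z hz ζ hcl).continuousAt h2
      have hζ0 : ζ - 0 ≠ 0 := by
        rw [sub_zero]; exact ne_of_mem_of_not_mem hζ (by simp [hδ.ne])
      have h4 : ContinuousAt (fun p : E × ℂ => (p.2 - 0)⁻¹) (z, ζ) :=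
        ContinuousAt.inv₀ (by fun_prop) hζ0
      exact (h4.smul (hf'.div hg' ((hU₁ z hz).2 ζ hζ))).continuousWithinAt
    · intro ζ hζ z hz
      have hcl := Metric.sphere_subset_closedBall hζ
      have hsh : AnalyticAt ℂ (fun z : E => z + ζ • v) z := analyticAt_id.add analyticAt_const
      have hf' : AnalyticAt ℂ (fun z => f (z + ζ • v)) z :=
        AnalyticAt.fun_comp (g := f) (hcomp f hf z hz ζ hcl) hsh
      have hg' : AnalyticAt ℂ (fun z => g (z + ζ • v)) z :=
        AnalyticAt.fun_comp (g := g) (hcomp g hg z hz ζ hcl) hsh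
      exact (hf'.div hg' ((hU₁ z hz).2 ζ hζ)).const_smul (c := (ζ - 0)⁻¹)
  refine ⟨q, hq x hxU₁, ?_⟩
  filter_upwards [hU₁o.mem_nhds hxU₁] with z hz hgz
  let S : Set ℂ := (fun ζ : ℂ => z + ζ • v) ⁻¹' Metric.ball x r
  have hSo : IsOpen S := Metric.isOpen_ball.preimage (by fun_prop)
  have hSc : IsPreconnected S :=
    (convex_line_preimage (convex_ball x r) z v).isPreconnected
  have hline : ∀ ζ : ℂ, AnalyticAt ℂ (fun ζ : ℂ => z + ζ • v) ζ := fun ζ =>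
    analyticAt_const.add (analyticAt_id.smul analyticAt_const)
  have hfS : AnalyticOnNhd ℂ (fun ζ : ℂ => f (z + ζ • v)) S := fun ζ hζ =>
    AnalyticAt.fun_comp (g := f) (hf _ (hball hζ).1) (hline ζ)
  have hgS : AnalyticOnNhd ℂ (fun ζ : ℂ => g (z + ζ • v)) S := fun ζ hζ =>
    AnalyticAt.fun_comp (g := g) (hg _ (hball hζ).1) (hline ζ)
  have h0S : (0 : ℂ) ∈ S := (hU₁ z hz).1 0 (by simpa using hδ.le)
  have hgS0 : ∀ ζ ∈ S, ∃ᶠ ω in 𝓝 ζ, g (z + ω • v) ≠ 0 := by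
    intro ζ hζ h
    have h' : ∀ᶠ ω in 𝓝 ζ, g (z + ω • v) = 0 := h.mono fun y hy => not_not.1 hy
    have := hgS.eqOn_zero_of_preconnected_of_eventuallyEq_zero hSc hζ h' h0S
    simp at this
    exact hgz this
  obtain ⟨Q, hQ, hfQ⟩ := exists_analytic_quotient_one hSo hfS hgS hgS0
    (fun ζ hζ => (hball hζ).2)
  have hcb : Metric.closedBall (0 : ℂ) δ ⊆ S := fun ζ hζ => (hU₁ z hz).1 ζ hζ
  have hQd : DifferentiableOn ℂ Q (Metric.closedBall 0 δ) := fun ζ hζ =>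
    (hQ ζ (hcb hζ)).differentiableAt.differentiableWithinAt
  have hcauchy := hQd.circleIntegral_sub_inv_smul (Metric.mem_ball_self hδ)
  -- On the line through z the one-variable theorem supplies a quotient Q holomorphic on the whole
  -- disc, and Cauchy's formula evaluates the integral as Q 0.
  have hqz : q z = Q 0 := by
    have : ∮ ζ in C(0, δ), (ζ - 0)⁻¹ • (f (z + ζ • v) / g (z + ζ • v)) =
        ∮ ζ in C(0, δ), (ζ - 0)⁻¹ • Q ζ := by
      refine circleIntegral.integral_congr hδ.le fun ζ hζ => ?_
      rw [show f (z + ζ • v) = Q ζ * g (z + ζ • v) from hfQ ζ (hcb (Metric.sphere_subset_closedBall hζ)),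
        mul_div_cancel_right₀ _ ((hU₁ z hz).2 ζ hζ)]
    simp only [q]
    rw [this, hcauchy, smul_smul, inv_mul_cancel₀ Complex.two_pi_I_ne_zero, one_smul]
  rw [hqz]
  simpa using hfQ 0 h0S

end RiemannExtension

end CRGeom

namespace CRGeom

/-! ### Zeros of a holomorphic function in a disc and their power sums. -/

section Factorization

theorem not_eventually_zero_of_sphere_ne_zero {h : ℂ → ℂ} {c : ℂ} {R : ℝ} (hR : 0 < R)
    (hh : AnalyticOnNhd ℂ h (Metric.closedBall c R)) (h0 : ∀ ζ ∈ Metric.sphere c R, h ζ ≠ 0)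
    {ζ : ℂ} (hζ : ζ ∈ Metric.closedBall c R) : ¬ ∀ᶠ ω in 𝓝 ζ, h ω = 0 := by
  intro hz
  obtain ⟨η, hη⟩ := NormedSpace.sphere_nonempty (x := c) (r := R) |>.2 hR.le
  exact h0 η hη (hh.eqOn_zero_of_preconnected_of_eventuallyEq_zero
    (convex_closedBall c R).isPreconnected hζ hz (Metric.sphere_subset_closedBall hη))

theorem finite_zeros_closedBall {h : ℂ → ℂ} {c : ℂ} {R : ℝ} (hR : 0 < R)
    (hh : AnalyticOnNhd ℂ h (Metric.closedBall c R)) (h0 : ∀ ζ ∈ Metric.sphere c R, h ζ ≠ 0) :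
    {ζ | ζ ∈ Metric.closedBall c R ∧ h ζ = 0}.Finite := by
  by_contra hinf
  obtain ⟨x, hx, hacc⟩ := Set.Infinite.exists_accPt_of_subset_isCompact hinf
    (isCompact_closedBall c R) (fun ζ hζ => hζ.1)
  rw [accPt_iff_frequently_nhdsNE] at hacc
  exact not_eventually_zero_of_sphere_ne_zero hR hh h0 hx
    ((hh x hx).frequently_zero_iff_eventually_zero.1 (hacc.mono fun _ h => h.2))

/-- A function that is holomorphic on a closed disc and has no zeros on its boundary is the
product of a monic polynomial with zeros in the open disc and of a zero free function. -/
theorem exists_factorization_closedBall {c : ℂ} {R : ℝ} (hR : 0 < R) (Z : Finset ℂ) :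
    ∀ h : ℂ → ℂ, AnalyticOnNhd ℂ h (Metric.closedBall c R) →
      (∀ ζ ∈ Metric.sphere c R, h ζ ≠ 0) →
      (∀ ζ ∈ Metric.closedBall c R, h ζ = 0 → ζ ∈ Z) →
      ∃ (k : ℕ) (a : Fin k → ℂ) (u : ℂ → ℂ), (∀ i, a i ∈ Metric.ball c R) ∧
        AnalyticOnNhd ℂ u (Metric.closedBall c R) ∧ (∀ ζ ∈ Metric.closedBall c R, u ζ ≠ 0) ∧
        ∀ ζ, h ζ = (∏ i, (ζ - a i)) * u ζ := by
  -- The finite set Z contains the zeros of h in the disc. An element b that is a zero is divided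
  -- out to its full order, so the quotient no longer vanishes at b; an element that is not a zero
  -- in the disc is dropped.
  induction Z using Finset.induction_on with
  | empty =>
    intro h hh _ hZ
    exact ⟨0, Fin.elim0, h, fun i => i.elim0, hh, fun ζ hζ h0 => by simpa using hZ ζ hζ h0,
      fun ζ => by simp⟩
  | insert b Z hb ih =>
    intro h hh h0 hZ
    by_cases hbz : b ∈ Metric.closedBall c R ∧ h b = 0
    · obtain ⟨hbB, hb0⟩ := hbz
      have hbb : b ∈ Metric.ball c R := by
        rw [← Metric.ball_union_sphere] at hbB
        exact hbB.resolve_right fun hs => h0 b hs hb0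
      obtain ⟨n, g, hg, hgb, hhg⟩ := (hh b hbB).exists_eventuallyEq_pow_smul_nonzero_iff.2
        (not_eventually_zero_of_sphere_ne_zero hR hh h0 hbB)
      classical
      let q : ℂ → ℂ := Function.update (fun ζ => h ζ / (ζ - b) ^ n) b (g b)
      have hqb : q =ᶠ[𝓝 b] g := by
        filter_upwards [hhg] with ζ hζ
        by_cases hζb : ζ = b
        · simp [q, hζb]
        · simp only [q, Function.update_of_ne hζb, hζ, smul_eq_mul]
          exact mul_div_cancel_left₀ _ (pow_ne_zero _ (sub_ne_zero.2 hζb))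
      have hqne : ∀ ζ, ζ ≠ b → q =ᶠ[𝓝 ζ] fun ζ => h ζ / (ζ - b) ^ n := by
        intro ζ hζ
        filter_upwards [isOpen_ne.mem_nhds hζ] with ω hω
        simp [q, Function.update_of_ne hω]
      have hqa : AnalyticOnNhd ℂ q (Metric.closedBall c R) := by
        intro ζ hζ
        by_cases hζb : ζ = b
        · rw [hζb]; exact hg.congr hqb.symm
        · refine AnalyticAt.congr ?_ (hqne ζ hζb).symm
          exact (hh ζ hζ).div ((analyticAt_id.sub analyticAt_const).pow n)
            (pow_ne_zero _ (sub_ne_zero.2 hζb))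
      have hhq : ∀ ζ, h ζ = (ζ - b) ^ n * q ζ := by
        intro ζ
        by_cases hζb : ζ = b
        · rw [hζb, hhg.self_of_nhds, hqb.self_of_nhds]; rfl
        · rw [(hqne ζ hζb).self_of_nhds, mul_div_cancel₀ _ (pow_ne_zero _ (sub_ne_zero.2 hζb))]
      obtain ⟨k, a, u, ha, hu, hu0, hfac⟩ := ih q hqa
        (fun ζ hζ hq0 => h0 ζ hζ (by
          rw [hhq ζ, hq0, mul_zero]))
        (fun ζ hζ hq0 => by
          have := hZ ζ hζ (by rw [hhq ζ, hq0, mul_zero])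
          refine (Finset.mem_insert.1 this).resolve_left fun hζb => hgb ?_
          rw [← hqb.self_of_nhds, ← hζb, hq0])
      refine ⟨k + n, Fin.append a fun _ => b, u, fun i => ?_, hu, hu0, fun ζ => ?_⟩
      · refine Fin.addCases (fun i => ?_) (fun i => ?_) i
        · simpa using ha i
        · simpa using hbb
      · rw [hhq ζ, hfac ζ, Fin.prod_univ_add]
        simp
        ring
    · refine ih h hh h0 fun ζ hζ hz => ?_
      refine (Finset.mem_insert.1 (hZ ζ hζ hz)).resolve_left fun hζb => hbz ?_
      rw [← hζb]; exact ⟨hζ, hz⟩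

/-- The power sums of the zeros of a holomorphic function, as contour integrals. -/
theorem circleIntegral_pow_mul_logDeriv {c : ℂ} {R : ℝ} (hR : 0 < R) {h u : ℂ → ℂ} {k : ℕ}
    {a : Fin k → ℂ} (ha : ∀ i, a i ∈ Metric.ball c R)
    (hu : AnalyticOnNhd ℂ u (Metric.closedBall c R)) (hu0 : ∀ ζ ∈ Metric.closedBall c R, u ζ ≠ 0)
    (hfac : ∀ ζ, h ζ = (∏ i, (ζ - a i)) * u ζ) (j : ℕ) :
    (2 * Real.pi * Complex.I : ℂ)⁻¹ • ∮ ζ in C(c, R), ζ ^ j * (deriv h ζ / h ζ) =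
      ∑ i, a i ^ j := by
  have hne : ∀ i, ∀ ζ ∈ Metric.sphere c R, ζ - a i ≠ 0 := by
    intro i ζ hζ h0
    rw [sub_eq_zero] at h0
    have := ha i
    rw [← h0] at this
    simp only [Metric.mem_ball, Metric.mem_sphere] at this hζ
    exact absurd hζ this.ne
  have hmem : ∀ ζ ∈ Metric.sphere c R, ζ ∈ Metric.closedBall c R :=
    fun ζ hζ => Metric.sphere_subset_closedBall hζ
  have hprod : ∀ ζ : ℂ, DifferentiableAt ℂ (fun ζ => ∏ i, (ζ - a i)) ζ := fun ζ => by fun_prop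
  -- The logarithmic derivative splits into simple poles at the zeros and a part holomorphic on the
  -- disc; Cauchy's formula handles the former and the latter integrates to zero.
  have hO : ∀ ζ ∈ Metric.sphere c R, deriv h ζ / h ζ =
      (∑ i, (ζ - a i)⁻¹) + deriv u ζ / u ζ := by
    intro ζ hζ
    have hP : (∏ i, (ζ - a i)) ≠ 0 := Finset.prod_ne_zero_iff.2 fun i _ => hne i ζ hζ
    have e2 := logDeriv_mul ζ hP (hu0 ζ (hmem ζ hζ)) (hprod ζ)
      (hu ζ (hmem ζ hζ)).differentiableAt
    have e3 : logDeriv (fun ζ => ∏ i, (ζ - a i)) ζ = ∑ i, (ζ - a i)⁻¹ := by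
      rw [logDeriv_prod (fun i _ => hne i ζ hζ) (fun i _ => by fun_prop)]
      refine Finset.sum_congr rfl fun i _ => ?_
      simp [logDeriv_apply]
    rw [← e3, ← logDeriv_apply u, ← e2, ← logDeriv_apply]
    congr 1
    exact funext hfac
  have hint : ∀ i, ∮ ζ in C(c, R), (ζ - a i)⁻¹ • ζ ^ j = (2 * Real.pi * Complex.I : ℂ) • a i ^ j :=
    fun i => DifferentiableOn.circleIntegral_sub_inv_smul (by fun_prop) (ha i)
  have hint2 : ∮ ζ in C(c, R), ζ ^ j * (deriv u ζ / u ζ) = 0 := by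
    refine DiffContOnCl.circleIntegral_eq_zero hR.le ?_
    refine DifferentiableOn.diffContOnCl_ball (U := Metric.closedBall c R) (fun ζ hζ => ?_)
      subset_rfl
    have h1 := (hu ζ hζ).deriv.differentiableAt
    have h2 := (hu ζ hζ).differentiableAt
    exact ((differentiableAt_id.pow j).mul (h1.div h2 (hu0 ζ hζ))).differentiableWithinAt
  have hci1 : ∀ i, CircleIntegrable (fun ζ => (ζ - a i)⁻¹ • ζ ^ j) c R := fun i =>
    ContinuousOn.circleIntegrable hR.le (ContinuousOn.smul
      (ContinuousOn.inv₀ (f := fun ζ => ζ - a i) (by fun_prop) (hne i)) (by fun_prop))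
  have hci2 : CircleIntegrable (fun ζ => ζ ^ j * (deriv u ζ / u ζ)) c R := by
    refine ContinuousOn.circleIntegrable hR.le fun ζ hζ => ?_
    have h1 := (hu ζ (hmem ζ hζ)).deriv.continuousAt
    have h2 := (hu ζ (hmem ζ hζ)).continuousAt
    exact ((continuousAt_id.pow j).mul (h1.div h2 (hu0 ζ (hmem ζ hζ)))).continuousWithinAt
  have htot : ∮ ζ in C(c, R), ζ ^ j * (deriv h ζ / h ζ) =
      ∮ ζ in C(c, R), ((∑ i, (ζ - a i)⁻¹ • ζ ^ j) + ζ ^ j * (deriv u ζ / u ζ)) := by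
    refine circleIntegral.integral_congr hR.le fun ζ hζ => ?_
    simp only [hO ζ hζ, mul_add, Finset.mul_sum, smul_eq_mul]
    congr 1
    exact Finset.sum_congr rfl fun i _ => mul_comm _ _
  have hcis : CircleIntegrable (fun ζ => ∑ i, (ζ - a i)⁻¹ • ζ ^ j) c R := by
    have := CircleIntegrable.sum Finset.univ fun i _ => hci1 i
    convert! this using 1
    funext ζ
    simp
  rw [htot, circleIntegral.integral_add hcis hci2, hint2, add_zero,
    circleIntegral.integral_fun_sum fun i _ => hci1 i, Finset.smul_sum]
  refine Finset.sum_congr rfl fun i _ => ?_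
  rw [hint i, smul_smul, inv_mul_cancel₀ Complex.two_pi_I_ne_zero, one_smul]

end Factorization

end CRGeom

namespace CRGeom

/-! ### Weierstrass preparation with parameters. -/

section Weierstrass

variable {E : Type*} [NormedAddCommGroup E] [NormedSpace ℂ E]

theorem analyticAt_comp_prodMk_right {F : Type*} [NormedAddCommGroup F] [NormedSpace ℂ F]
    {f : E × ℂ → F} {z : E} {ζ : ℂ} (hf : AnalyticAt ℂ f (z, ζ)) :
    AnalyticAt ℂ (fun ω => f (z, ω)) ζ :=
  AnalyticAt.fun_comp (g := f) (f := fun ω => (z, ω)) hf (analyticAt_const.prod analyticAt_id)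

theorem analyticAt_comp_prodMk_left {F : Type*} [NormedAddCommGroup F] [NormedSpace ℂ F]
    {f : E × ℂ → F} {z : E} {ζ : ℂ} (hf : AnalyticAt ℂ f (z, ζ)) :
    AnalyticAt ℂ (fun w => f (w, ζ)) z :=
  AnalyticAt.fun_comp (g := f) (f := fun w => (w, ζ)) hf (analyticAt_id.prod analyticAt_const)

theorem deriv_prodMk_right {f : E × ℂ → ℂ} {z : E} {ζ : ℂ} (hf : AnalyticAt ℂ f (z, ζ)) :
    deriv (fun ω => f (z, ω)) ζ = fderiv ℂ f (z, ζ) (0, 1) := by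
  have h1 : HasDerivAt (fun ω : ℂ => (z, ω)) ((0 : E), (1 : ℂ)) ζ :=
    (hasDerivAt_const ζ z).prodMk (hasDerivAt_id ζ)
  exact (HasFDerivAt.comp_hasDerivAt ζ hf.differentiableAt.hasFDerivAt h1).deriv

/-- A continuous function on a preconnected set whose values are natural numbers is constant. -/
theorem eq_of_continuousOn_natCast {X : Type*} [TopologicalSpace X] {V : Set X}
    (hV : IsPreconnected V) {s : X → ℂ} (hs : ContinuousOn s V) {k : X → ℕ}
    (hk : ∀ z ∈ V, s z = k z) {x y : X} (hx : x ∈ V) (hy : y ∈ V) : k x = k y := by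
  have key : ∀ x ∈ V, ∀ y ∈ V, ¬ k x < k y := by
    intro x hx y hy hlt
    have hc : ContinuousOn (fun z => (s z).re) V := Complex.continuous_re.comp_continuousOn hs
    have h1 := hV.intermediate_value hx hy hc
    have hx' : (s x).re = k x := by rw [hk x hx]; simp
    have hy' : (s y).re = k y := by rw [hk y hy]; simp
    have hlt' : ((k x : ℝ) + 1) ≤ k y := by exact_mod_cast hlt
    -- If k jumped upwards, the intermediate value theorem would make the real part of s equal to a
    -- half-integer somewhere on V.
    have hmem : ((k x : ℝ) + 1 / 2) ∈ Icc (s x).re (s y).re := by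
      rw [hx', hy']; constructor <;> linarith
    obtain ⟨z, hz, hzk⟩ := h1 hmem
    have hz' : (s z).re = k z := by rw [hk z hz]; simp
    simp only [hz'] at hzk
    have h2 : (2 * (k z) : ℝ) = 2 * k x + 1 := by linarith
    have h3 : 2 * k z = 2 * k x + 1 := by exact_mod_cast h2
    omega
  exact le_antisymm (not_lt.1 (key y hy x hx)) (not_lt.1 (key x hx y hy))

/-- If the power sums of finitely many functions are analytic, so are their elementary symmetric
functions. -/
theorem analyticOnNhd_esymm {k : ℕ} {V : Set E} {a : E → Fin k → ℂ}
    (hs : ∀ j, AnalyticOnNhd ℂ (fun z => ∑ i, a z i ^ j) V) (j : ℕ) :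
    AnalyticOnNhd ℂ (fun z => MvPolynomial.aeval (a z) (MvPolynomial.esymm (Fin k) ℂ j)) V := by
  induction j using Nat.strong_induction_on with
  | _ j ih =>
    rcases Nat.eq_zero_or_pos j with rfl | hj
    · simp only [MvPolynomial.esymm_zero, map_one]
      exact analyticOnNhd_const
    -- Newton's identities express the j-th elementary symmetric function through lower ones and
    -- power sums, after division by j.
    · have hrec : ∀ z, MvPolynomial.aeval (a z) (MvPolynomial.esymm (Fin k) ℂ j) =
          (j : ℂ)⁻¹ * ((-1) ^ (j + 1) * ∑ b ∈ Finset.HasAntidiagonal.antidiagonal j with b.1 < j,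
            (-1) ^ b.1 * MvPolynomial.aeval (a z) (MvPolynomial.esymm (Fin k) ℂ b.1) *
              ∑ i, a z i ^ b.2) := by
        intro z
        have h := congrArg (MvPolynomial.aeval (a z)) (MvPolynomial.mul_esymm_eq_sum (Fin k) ℂ j)
        simp only [map_mul, map_sum, map_natCast, map_pow, map_neg, map_one, MvPolynomial.psum,
          MvPolynomial.aeval_X] at h
        rw [← h, inv_mul_cancel_left₀ (Nat.cast_ne_zero.2 hj.ne')]
      intro z hz
      simp only [hrec]
      refine analyticAt_const.mul (analyticAt_const.mul ?_)
      refine Finset.analyticAt_fun_sum _ fun b hb => ?_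
      exact (analyticAt_const.mul (ih b.1 (Finset.mem_filter.1 hb).2 z hz)).mul (hs b.2 z hz)

/-- The Weierstrass polynomial of a holomorphic function that has no zeros on the boundary of a
disc, with holomorphic dependence on parameters. -/
theorem exists_weierstrassPolynomial [FiniteDimensional ℂ E] {V : Set E} (hVo : IsOpen V)
    (hVc : IsPreconnected V) {c : ℂ} {R : ℝ} (hR : 0 < R) {f : E × ℂ → ℂ}
    (hf : AnalyticOnNhd ℂ f (V ×ˢ Metric.closedBall c R))
    (h0 : ∀ z ∈ V, ∀ ζ ∈ Metric.sphere c R, f (z, ζ) ≠ 0) :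
    ∃ (k : ℕ) (W : E → Polynomial ℂ), (∀ z, (W z).Monic ∧ (W z).natDegree = k) ∧
      (∀ j, AnalyticOnNhd ℂ (fun z => (W z).coeff j) V) ∧
      (∀ z ∈ V, ∀ ζ ∈ Metric.sphere c R, (W z).eval ζ ≠ 0) ∧
      ∀ z ∈ V, ∃ u : ℂ → ℂ, AnalyticOnNhd ℂ u (Metric.closedBall c R) ∧
        (∀ ζ ∈ Metric.closedBall c R, u ζ ≠ 0) ∧ ∀ ζ, f (z, ζ) = u ζ * (W z).eval ζ := by
  have hfz : ∀ z ∈ V, AnalyticOnNhd ℂ (fun ζ => f (z, ζ)) (Metric.closedBall c R) :=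
    fun z hz ζ hζ => analyticAt_comp_prodMk_right (hf (z, ζ) ⟨hz, hζ⟩)
  have hfact : ∀ z ∈ V, ∃ (k : ℕ) (a : Fin k → ℂ) (u : ℂ → ℂ), (∀ i, a i ∈ Metric.ball c R) ∧
      AnalyticOnNhd ℂ u (Metric.closedBall c R) ∧ (∀ ζ ∈ Metric.closedBall c R, u ζ ≠ 0) ∧
      ∀ ζ, f (z, ζ) = (∏ i, (ζ - a i)) * u ζ := fun z hz =>
    exists_factorization_closedBall hR (finite_zeros_closedBall hR (hfz z hz) (h0 z hz)).toFinset
      (fun ζ => f (z, ζ)) (hfz z hz) (h0 z hz) (fun ζ hζ h => by simpa using ⟨by simpa using hζ, h⟩)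
  choose! k₀ a₀ u₀ ha₀ hu₀ hu₀0 hfac₀ using hfact
  -- The power sums of the zeros in the disc are contour integrals over a circle free of zeros,
  -- hence analytic in z, although the individual zeros need not be.
  let s : ℕ → E → ℂ := fun j z => (2 * Real.pi * Complex.I : ℂ)⁻¹ •
    ∮ ζ in C(c, R), ζ ^ j * (fderiv ℂ f (z, ζ) (0, 1) / f (z, ζ))
  have hmem : ∀ ζ ∈ Metric.sphere c R, ζ ∈ Metric.closedBall c R :=
    fun ζ hζ => Metric.sphere_subset_closedBall hζ
  have hsan : ∀ j, AnalyticOnNhd ℂ (s j) V := by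
    intro j z hz
    refine AnalyticAt.fun_const_smul ?_
    have han : ∀ z ∈ V, ∀ ζ ∈ Metric.sphere c R, AnalyticAt ℂ
        (fun x : E × ℂ => x.2 ^ j * (fderiv ℂ f x (0, 1) / f x)) (z, ζ) := by
      intro z hz ζ hζ
      have hfa := hf (z, ζ) ⟨hz, hmem ζ hζ⟩
      refine (analyticAt_snd.pow j).mul (AnalyticAt.div ?_ hfa (h0 z hz ζ hζ))
      exact ((ContinuousLinearMap.apply ℂ ℂ ((0 : E), (1 : ℂ))).analyticAt _).comp hfa.fderiv
    refine analyticOnNhd_circleIntegral hVo c hR.le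
      (fun z ζ => ζ ^ j * (fderiv ℂ f (z, ζ) (0, 1) / f (z, ζ))) ?_ ?_ z hz
    · rintro ⟨z, ζ⟩ ⟨hz, hζ⟩
      exact (han z hz ζ hζ).continuousAt.continuousWithinAt
    · intro ζ hζ z hz
      exact analyticAt_comp_prodMk_left (han z hz ζ hζ)
  have hsum : ∀ j, ∀ z ∈ V, s j z = ∑ i, a₀ z i ^ j := by
    intro j z hz
    rw [← circleIntegral_pow_mul_logDeriv hR (ha₀ z hz) (hu₀ z hz) (hu₀0 z hz) (hfac₀ z hz) j]
    simp only [s]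
    congr 1
    refine circleIntegral.integral_congr hR.le fun ζ hζ => ?_
    rw [deriv_prodMk_right (hf (z, ζ) ⟨hz, hmem ζ hζ⟩)]
  obtain rfl | ⟨z₀, hz₀⟩ := V.eq_empty_or_nonempty
  · exact ⟨0, fun _ => 1, fun _ => ⟨Polynomial.monic_one, Polynomial.natDegree_one⟩,
      fun j z hz => hz.elim, fun z hz => hz.elim, fun z hz => hz.elim⟩
  -- The zeroth power sum counts the zeros, so their number is constant on the connected set V.
  have hk : ∀ z ∈ V, k₀ z = k₀ z₀ := fun z hz =>
    eq_of_continuousOn_natCast hVc (hsan 0).continuousOn (k := k₀)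
      (fun z hz => by simp [hsum 0 z hz]) hz hz₀
  have hfact' : ∀ z, ∃ a : Fin (k₀ z₀) → ℂ, z ∈ V → (∀ i, a i ∈ Metric.ball c R) ∧
      (∀ j, s j z = ∑ i, a i ^ j) ∧ ∃ (u : ℂ → ℂ),
      AnalyticOnNhd ℂ u (Metric.closedBall c R) ∧ (∀ ζ ∈ Metric.closedBall c R, u ζ ≠ 0) ∧
      ∀ ζ, f (z, ζ) = (∏ i, (ζ - a i)) * u ζ := by
    intro z
    by_cases hz : z ∈ V
    · rw [← hk z hz]
      exact ⟨a₀ z, fun _ => ⟨ha₀ z hz, fun j => hsum j z hz, u₀ z, hu₀ z hz, hu₀0 z hz, hfac₀ z hz⟩⟩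
    -- Off V all roots are set to 0, so that `W z` is monic of the same degree for every z.
    · exact ⟨0, fun h => (hz h).elim⟩
  choose a ha using hfact'
  let W : E → Polynomial ℂ := fun z => ∏ i, (Polynomial.X - Polynomial.C (a z i))
  have heval : ∀ z ζ, (W z).eval ζ = ∏ i, (ζ - a z i) := by
    intro z ζ
    simp [W, Polynomial.eval_prod]
  have hdeg : ∀ z, (W z).natDegree = k₀ z₀ := by
    intro z
    simp [W]
  refine ⟨k₀ z₀, W, fun z => ⟨Polynomial.monic_prod_of_monic _ _ fun i _ =>
    Polynomial.monic_X_sub_C _, hdeg z⟩, fun j => ?_, fun z hz ζ hζ => ?_, fun z hz => ?_⟩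
  · rcases le_or_gt j (k₀ z₀) with hj | hj
    · have hco : ∀ z, (W z).coeff j = (-1) ^ (k₀ z₀ - j) *
          MvPolynomial.aeval (a z) (MvPolynomial.esymm (Fin (k₀ z₀)) ℂ (k₀ z₀ - j)) := by
        intro z
        have := Multiset.prod_X_sub_C_coeff (Finset.univ.val.map (a z)) (k := j) (by simpa using hj)
        rw [MvPolynomial.aeval_esymm_eq_multiset_esymm]
        simpa [W, Finset.prod, Multiset.map_map, Function.comp_def] using this
      intro z hz
      simp only [hco]
      refine analyticAt_const.mul ?_
      refine analyticOnNhd_esymm (V := V) (fun j => ?_) _ z hz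
      exact (hsan j).congr hVo fun z hz => (ha z hz).2.1 j
    · have hco : ∀ z, (W z).coeff j = 0 := fun z =>
        Polynomial.coeff_eq_zero_of_natDegree_lt (by rw [hdeg z]; exact hj)
      simp only [hco]
      exact analyticOnNhd_const
  · obtain ⟨u, hu, hu0, hfac⟩ := (ha z hz).2.2
    intro hW
    refine h0 z hz ζ hζ ?_
    rw [hfac ζ, ← heval, hW, zero_mul]
  · obtain ⟨u, hu, hu0, hfac⟩ := (ha z hz).2.2
    exact ⟨u, hu, hu0, fun ζ => by rw [hfac ζ, heval, mul_comm]⟩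

theorem analyticAt_eval_of_coeff {V : Set E} {k : ℕ} {W : E → Polynomial ℂ}
    (hdeg : ∀ z, (W z).natDegree ≤ k)
    (hW : ∀ j, AnalyticOnNhd ℂ (fun z => (W z).coeff j) V) {z : E} (hz : z ∈ V) (ζ : ℂ) :
    AnalyticAt ℂ (fun x : E × ℂ => (W x.1).eval x.2) (z, ζ) := by
  have : ∀ x : E × ℂ, (W x.1).eval x.2 = ∑ j ∈ Finset.range (k + 1), (W x.1).coeff j * x.2 ^ j :=
    fun x => Polynomial.eval_eq_sum_range' (Nat.lt_succ_of_le (hdeg x.1)) x.2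
  simp only [this]
  refine Finset.analyticAt_fun_sum _ fun j _ => ?_
  exact (AnalyticAt.fun_comp (g := fun z => (W z).coeff j) (hW j z hz) analyticAt_fst).mul
    (analyticAt_snd.pow j)

theorem frequently_eval_ne_zero {E : Type*} [TopologicalSpace E] {W : E → Polynomial ℂ} (hW : ∀ z, (W z).Monic) (x : E × ℂ) :
    ∃ᶠ y in 𝓝 x, (W y.1).eval y.2 ≠ 0 := by
  obtain ⟨z, ζ⟩ := x
  have h1 : ∃ᶠ ω in 𝓝 ζ, (W z).eval ω ≠ 0 := by
    intro h
    have h2 : ∀ᶠ ω in 𝓝 ζ, (W z).eval ω = 0 := h.mono fun _ h => not_not.1 h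
    have h3 : {ω | (W z).IsRoot ω}.Infinite := infinite_of_mem_nhds ζ h2
    exact (hW z).ne_zero (Polynomial.eq_zero_of_infinite_isRoot _ h3)
  have h2 : Tendsto (fun ω : ℂ => (z, ω)) (𝓝 ζ) (𝓝 (z, ζ)) :=
    (by fun_prop : Continuous fun ω : ℂ => (z, ω)).tendsto ζ
  exact h2.frequently h1

/-- The quotient of two functions that differ fibrewise by a zero free factor is bounded. -/
theorem exists_bound_of_sphere {E : Type*} [TopologicalSpace E] {V : Set E} (hVo : IsOpen V) {c : ℂ} {R : ℝ} (hR : 0 < R)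
    {f g : E × ℂ → ℂ} (hf : ContinuousOn f (V ×ˢ Metric.sphere c R))
    (hg : ContinuousOn g (V ×ˢ Metric.sphere c R))
    (hg0 : ∀ z ∈ V, ∀ ζ ∈ Metric.sphere c R, g (z, ζ) ≠ 0)
    (hu : ∀ z ∈ V, ∃ u : ℂ → ℂ, AnalyticOnNhd ℂ u (Metric.closedBall c R) ∧
      ∀ ζ ∈ Metric.closedBall c R, f (z, ζ) = u ζ * g (z, ζ)) {x : E × ℂ}
    (hx : x ∈ V ×ˢ Metric.ball c R) : ∃ C : ℝ, 0 < C ∧ ∀ᶠ y in 𝓝 x, ‖f y‖ ≤ C * ‖g y‖ := by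
  obtain ⟨z, ζ⟩ := x
  obtain ⟨hz, hζ⟩ := hx
  simp only at hz hζ
  have hq : ContinuousOn (fun x => f x / g x) (V ×ˢ Metric.sphere c R) :=
    hf.div hg fun x hx => hg0 x.1 hx.1 x.2 hx.2
  obtain ⟨C, hC⟩ := (isCompact_sphere c R).exists_bound_of_continuousOn
    (f := fun ζ => f (z, ζ) / g (z, ζ))
    (hq.comp (f := fun ζ => (z, ζ)) (by fun_prop) fun ζ hζ => ⟨hz, hζ⟩)
  have hev : ∀ᶠ w in 𝓝[V] z, ∀ ζ ∈ Metric.sphere c R, ‖f (w, ζ) / g (w, ζ)‖ < |C| + 1 := by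
    have key : ∀ ζ ∈ Metric.sphere c R, ∃ t ∈ 𝓝[Metric.sphere c R] ζ, ∀ᶠ w in 𝓝[V] z,
        ∀ η ∈ t, ‖f (w, η) / g (w, η)‖ < |C| + 1 := by
      intro ζ hζ
      have h1 : ∀ᶠ x in 𝓝[V ×ˢ Metric.sphere c R] (z, ζ), ‖f x / g x‖ < |C| + 1 :=
        (hq (z, ζ) ⟨hz, hζ⟩).norm.eventually_lt_const
          ((hC ζ hζ).trans_lt ((le_abs_self C).trans_lt (lt_add_one _)))
      rw [nhdsWithin_prod_eq, Filter.eventually_prod_iff] at h1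
      obtain ⟨p, hp, q, hq, hpq⟩ := h1
      exact ⟨{η | q η}, hq, hp.mono fun w hw η hη => hpq hw hη⟩
    refine (isCompact_sphere c R).induction_on
      (p := fun t => ∀ᶠ w in 𝓝[V] z, ∀ η ∈ t, ‖f (w, η) / g (w, η)‖ < |C| + 1) ?_ ?_ ?_ key
    · simp
    · intro s t hst ht
      exact ht.mono fun w hw η hη => hw η (hst hη)
    · intro s t hs ht
      filter_upwards [hs, ht] with w h1 h2 η hη
      exact hη.elim (h1 η) (h2 η)
  rw [hVo.nhdsWithin_eq hz] at hev
  refine ⟨|C| + 1, by positivity, ?_⟩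
  filter_upwards [prod_mem_nhds (hev.and (hVo.eventually_mem hz)) (Metric.isOpen_ball.mem_nhds hζ)]
  rintro ⟨w, η⟩ ⟨⟨hw, hwV⟩, hη⟩
  simp only at hw hwV hη
  -- On the circle the fibrewise quotient u is bounded uniformly in w by compactness, and the
  -- maximum principle carries this bound inside the disc. No joint regularity of u is needed.
  obtain ⟨u, hua, hfu⟩ := hu w hwV
  have hud : DiffContOnCl ℂ u (Metric.ball c R) :=
    DifferentiableOn.diffContOnCl_ball (U := Metric.closedBall c R)
      (fun ζ hζ => (hua ζ hζ).differentiableAt.differentiableWithinAt) subset_rfl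
  have hbd : ‖u η‖ ≤ |C| + 1 := by
    refine Complex.norm_le_of_forall_mem_frontier_norm_le Metric.isBounded_ball hud
      (fun ζ hζ => ?_) (subset_closure hη)
    rw [frontier_ball c hR.ne'] at hζ
    have := (hw ζ hζ).le
    rwa [hfu ζ (Metric.sphere_subset_closedBall hζ),
      mul_div_cancel_right₀ _ (hg0 w hwV ζ hζ)] at this
  rw [hfu η (Metric.ball_subset_closedBall hη), norm_mul]
  gcongr

/-- **Weierstrass preparation theorem**. -/
theorem weierstrass_preparation [FiniteDimensional ℂ E] {V : Set E} (hVo : IsOpen V)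
    (hVc : IsPreconnected V) {c : ℂ} {R : ℝ} (hR : 0 < R) {f : E × ℂ → ℂ}
    (hf : AnalyticOnNhd ℂ f (V ×ˢ Metric.closedBall c R))
    (h0 : ∀ z ∈ V, ∀ ζ ∈ Metric.sphere c R, f (z, ζ) ≠ 0) :
    ∃ (k : ℕ) (W : E → Polynomial ℂ), (∀ z, (W z).Monic ∧ (W z).natDegree = k) ∧
      (∀ j, AnalyticOnNhd ℂ (fun z => (W z).coeff j) V) ∧
      ∃ u : E × ℂ → ℂ, AnalyticOnNhd ℂ u (V ×ˢ Metric.ball c R) ∧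
        (∀ x ∈ V ×ˢ Metric.ball c R, u x ≠ 0) ∧
        ∀ x ∈ V ×ˢ Metric.ball c R, f x = u x * (W x.1).eval x.2 := by
  obtain ⟨k, W, hW, hWa, hWs, hfac⟩ := exists_weierstrassPolynomial hVo hVc hR hf h0
  let g : E × ℂ → ℂ := fun x => (W x.1).eval x.2
  have hga : ∀ z ∈ V, ∀ ζ, AnalyticAt ℂ g (z, ζ) := fun z hz ζ =>
    analyticAt_eval_of_coeff (fun z => (hW z).2.le) hWa hz ζ
  have hUo : IsOpen (V ×ˢ Metric.ball c R) := hVo.prod Metric.isOpen_ball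
  have hfU : AnalyticOnNhd ℂ f (V ×ˢ Metric.ball c R) := fun x hx =>
    hf x ⟨hx.1, Metric.ball_subset_closedBall hx.2⟩
  have hgU : AnalyticOnNhd ℂ g (V ×ˢ Metric.ball c R) := fun x hx => hga x.1 hx.1 x.2
  have hg0 : ∀ x, ∃ᶠ y in 𝓝 x, g y ≠ 0 := frequently_eval_ne_zero fun z => (hW z).1
  have hfc : ContinuousOn f (V ×ˢ Metric.sphere c R) := fun x hx =>
    (hf x ⟨hx.1, Metric.sphere_subset_closedBall hx.2⟩).continuousAt.continuousWithinAt
  have hgc : ContinuousOn g (V ×ˢ Metric.sphere c R) := fun x hx =>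
    (hga x.1 hx.1 x.2).continuousAt.continuousWithinAt
  obtain ⟨q, hq, hfq⟩ := exists_analytic_quotient hUo hfU hgU (fun x _ => hg0 x) fun x hx => by
    obtain ⟨C, _, hC⟩ := exists_bound_of_sphere hVo hR hfc hgc hWs (fun z hz => by
      obtain ⟨u, hu, _, hfu⟩ := hfac z hz
      exact ⟨u, hu, fun ζ _ => hfu ζ⟩) hx
    exact ⟨C, hC⟩
  refine ⟨k, W, hW, hWa, q, hq, fun x hx hqx => ?_, hfq⟩
  -- With f and g exchanged the bound reads ‖g‖ ≤ C ‖f‖ = C ‖q‖ ‖g‖, so ‖q‖ ≥ 1/C at points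
  -- arbitrarily near x with g ≠ 0, which forbids q x = 0.
  obtain ⟨C, hCpos, hC⟩ := exists_bound_of_sphere hVo hR hgc hfc h0 (fun z hz => by
    obtain ⟨u, hu, hu0, hfu⟩ := hfac z hz
    refine ⟨fun ζ => (u ζ)⁻¹, fun ζ hζ => (hu ζ hζ).inv (hu0 ζ hζ), fun ζ hζ => ?_⟩
    rw [hfu ζ, inv_mul_cancel_left₀ (hu0 ζ hζ)]) hx
  have hsmall : ∀ᶠ y in 𝓝 x, ‖q y‖ < C⁻¹ := by
    refine (hq x hx).continuousAt.norm.eventually_lt_const ?_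
    simpa [hqx] using hCpos
  obtain ⟨y, hy0, hyC, hyq, hyU⟩ := ((hg0 x).and_eventually
    (hC.and (hsmall.and (hUo.eventually_mem hx)))).exists
  rw [hfq y hyU, norm_mul, ← mul_assoc] at hyC
  have hgy : 0 < ‖g y‖ := norm_pos_iff.2 hy0
  have h1 : C * ‖q y‖ < 1 := by
    calc C * ‖q y‖ < C * C⁻¹ := by gcongr
      _ = 1 := mul_inv_cancel₀ hCpos.ne'
  nlinarith

end Weierstrass

end CRGeom

namespace CRGeom

/-! ### Gauss's lemma and Bezout relations over an integrally closed domain. -/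

section Algebra

open Polynomial in
/-- Finitely many monic polynomials over an integrally closed domain have a monic greatest common
divisor; the cofactors generate an ideal that contains a nonzero constant. -/
theorem exists_gcd_bezout {A : Type*} [CommRing A] [IsDomain A] [IsIntegrallyClosed A]
    {ι : Type*} [Fintype ι] [Nonempty ι] (W : ι → A[X]) (hW : ∀ i, (W i).Monic) :
    ∃ (G : A[X]) (V : ι → A[X]), (∀ i, W i = G * V i) ∧ (∀ i, (V i).Monic) ∧
      ∃ (c : ι → A[X]) (D : A), D ≠ 0 ∧ ∑ i, c i * V i = C D := by
  classical
  let K := FractionRing A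
  let φ : A →+* K := algebraMap A K
  have hφ : Function.Injective φ := IsFractionRing.injective A K
  let I : Ideal K[X] := Ideal.span (range fun i => (W i).map φ)
  obtain ⟨g, hg⟩ := (inferInstance : I.IsPrincipal).principal
  have hdvd : ∀ i, g ∣ (W i).map φ := fun i => by
    have h1 : (W i).map φ ∈ I := Ideal.subset_span ⟨i, rfl⟩
    rw [hg] at h1
    exact Ideal.mem_span_singleton.1 h1
  obtain ⟨i₀⟩ := ‹Nonempty ι›
  have hg0 : g ≠ 0 := fun h => by
    have := hdvd i₀
    rw [h, zero_dvd_iff] at this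
    exact ((hW i₀).map φ).ne_zero this
  -- The generator g of the ideal over the fraction field divides a monic polynomial, so up to its
  -- leading coefficient it already has coefficients in A. This is Gauss's lemma for integrally
  -- closed rings.
  obtain ⟨G, hG⟩ := IsIntegrallyClosed.eq_map_mul_C_of_dvd K (hW i₀) (hdvd i₀)
  have hlc : g.leadingCoeff ≠ 0 := leadingCoeff_ne_zero.2 hg0
  have hGm : G.Monic := by
    refine monic_of_injective hφ ?_
    rw [Monic.def]
    have h1 := congrArg leadingCoeff hG
    rw [leadingCoeff_mul, leadingCoeff_C] at h1
    exact mul_right_cancel₀ hlc (h1.trans (one_mul _).symm)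
  have hGd : ∀ i, G ∣ W i := by
    intro i
    rw [← map_dvd_map φ hφ hGm]
    have : G.map φ ∣ g := ⟨_, hG.symm⟩
    exact this.trans (hdvd i)
  choose V hV using hGd
  refine ⟨G, V, hV, fun i => hGm.of_mul_monic_left (hV i ▸ hW i), ?_⟩
  have hgI : g ∈ I := by rw [hg]; exact Submodule.mem_span_singleton_self g
  obtain ⟨c, hc⟩ := (Ideal.mem_span_range_iff_exists_fun).1 hgI
  have hone : ∑ i, c i * (V i).map φ = C g.leadingCoeff := by
    have h1 : G.map φ * ∑ i, c i * (V i).map φ = G.map φ * C g.leadingCoeff := by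
      rw [hG, ← hc, Finset.mul_sum]
      refine Finset.sum_congr rfl fun i _ => ?_
      rw [hV i, Polynomial.map_mul]; ring
    exact mul_left_cancel₀ (hGm.map φ).ne_zero h1
  have hint : ∀ i, ∃ (b : A) (q : A[X]), b ≠ 0 ∧ q.map φ = C (φ b) * c i := by
    intro i
    obtain ⟨b, hb0, hb⟩ := IsLocalization.integerNormalization_spec (nonZeroDivisors A) (c i)
    refine ⟨b, IsLocalization.integerNormalization (nonZeroDivisors A) (c i),
      nonZeroDivisors.ne_zero hb0, ?_⟩
    rw [hb, Algebra.smul_def]; rfl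
  choose b q hb0 hq using hint
  obtain ⟨n, d, hd, hnd⟩ := IsFractionRing.div_surjective (A := A) g.leadingCoeff
  have hd0 : φ d ≠ 0 := fun h => nonZeroDivisors.ne_zero hd (hφ (by rw [h, map_zero]))
  have hn0 : n ≠ 0 := fun h => hlc (by rw [← hnd, h, map_zero, zero_div])
  -- Here b i clears the denominators of c i and n/d is the leading coefficient of g. Multiplying
  -- the Bezout relation over the fraction field by d ∏ b j leaves the constant D = n ∏ b j.
  refine ⟨fun i => C (d * ∏ j ∈ Finset.univ.erase i, b j) * q i, n * ∏ j, b j,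
    mul_ne_zero hn0 (Finset.prod_ne_zero_iff.2 fun j _ => hb0 j), ?_⟩
  apply map_injective φ hφ
  rw [Polynomial.map_sum, map_C]
  have h2 : ∀ i, ((C (d * ∏ j ∈ Finset.univ.erase i, b j) * q i) * V i).map φ =
      C (φ (d * ∏ j, b j)) * (c i * (V i).map φ) := by
    intro i
    rw [← Finset.mul_prod_erase Finset.univ b (Finset.mem_univ i)]
    simp only [Polynomial.map_mul, map_C, hq, map_mul]
    ring
  rw [Finset.sum_congr rfl fun i _ => h2 i, ← Finset.mul_sum, hone, ← C_mul]
  congr 1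
  rw [← hnd, map_mul, map_mul]
  change φ d * _ * (φ n / φ d) = _
  rw [mul_div_assoc', div_eq_iff hd0]
  ring

/-- The roots of a homogenized monic polynomial are bounded in terms of its coefficients. -/
theorem norm_le_of_homogeneous_monic {n : ℕ} (hn : n ≠ 0) {c : ℕ → ℂ} {a b : ℂ}
    (h : a ^ n + ∑ i ∈ Finset.range n, c i * b ^ (n - i) * a ^ i = 0) :
    ‖a‖ ≤ (1 + ∑ i ∈ Finset.range n, ‖c i‖) * ‖b‖ := by
  by_contra hlt
  push Not at hlt
  set S := ∑ i ∈ Finset.range n, ‖c i‖ with hS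
  have hS0 : 0 ≤ S := Finset.sum_nonneg fun i _ => norm_nonneg _
  -- If the claim failed, a would dominate b, so every lower term would be at most ‖c i‖ ‖b‖
  -- ‖a‖^(n-1); dividing by ‖a‖^(n-1) then gives ‖a‖ ≤ S ‖b‖, a contradiction.
  have hba : ‖b‖ ≤ ‖a‖ := by nlinarith [norm_nonneg b, mul_nonneg hS0 (norm_nonneg b)]
  have ha : 0 < ‖a‖ := lt_of_le_of_lt (by positivity) hlt
  obtain ⟨m, rfl⟩ := Nat.exists_eq_succ_of_ne_zero hn
  have h1 : a ^ (m + 1) = -∑ i ∈ Finset.range (m + 1), c i * b ^ (m + 1 - i) * a ^ i :=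
    eq_neg_of_add_eq_zero_left h
  have h2 : ‖a‖ ^ (m + 1) ≤ S * ‖b‖ * ‖a‖ ^ m := by
    rw [← norm_pow, h1, norm_neg, hS, mul_assoc, Finset.sum_mul]
    refine (norm_sum_le _ _).trans (Finset.sum_le_sum fun i hi => ?_)
    have him : i ≤ m := Nat.lt_succ_iff.1 (Finset.mem_range.1 hi)
    rw [norm_mul, norm_mul, norm_pow, norm_pow, mul_assoc]
    refine mul_le_mul_of_nonneg_left ?_ (norm_nonneg _)
    obtain ⟨j, rfl⟩ := Nat.exists_eq_add_of_le him
    have : i + j + 1 - i = j + 1 := by omega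
    rw [this, pow_succ, pow_add]
    calc ‖b‖ ^ j * ‖b‖ * ‖a‖ ^ i ≤ ‖a‖ ^ j * ‖b‖ * ‖a‖ ^ i := by gcongr
      _ = ‖b‖ * (‖a‖ ^ i * ‖a‖ ^ j) := by ring
  have h3 : ‖a‖ ≤ S * ‖b‖ := by
    rw [pow_succ, mul_comm] at h2
    exact le_of_mul_le_mul_right h2 (pow_pos ha m)
  nlinarith [norm_nonneg b]

end Algebra

/-! ### The ring of holomorphic functions on a connected open set is an integrally closed domain. -/

section AnalyticRing

variable {E : Type*} [NormedAddCommGroup E] [NormedSpace ℂ E]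

/-- The ring of holomorphic functions on `V`. -/
def analyticRing (V : Set E) : Subring (V → ℂ) where
  carrier := {g | ∃ f : E → ℂ, AnalyticOnNhd ℂ f V ∧ ∀ z : V, g z = f z}
  mul_mem' := fun {g g'} ⟨f, hf, h⟩ ⟨f', hf', h'⟩ =>
    ⟨f * f', hf.mul hf', fun z => by simp [h z, h' z]⟩
  one_mem' := ⟨1, analyticOnNhd_const, fun z => rfl⟩
  add_mem' := fun {g g'} ⟨f, hf, h⟩ ⟨f', hf', h'⟩ =>
    ⟨f + f', hf.add hf', fun z => by simp [h z, h' z]⟩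
  zero_mem' := ⟨0, analyticOnNhd_const, fun z => rfl⟩
  neg_mem' := fun {g} ⟨f, hf, h⟩ => ⟨-f, hf.neg, fun z => by simp [h z]⟩

/-- An element of the ring of holomorphic functions, extended by zero to the whole space. -/
noncomputable def analyticRing.extend {V : Set E} (g : analyticRing V) : E → ℂ :=
  Function.extend Subtype.val g.1 0

theorem analyticRing.extend_apply {V : Set E} (g : analyticRing V) (z : V) :
    analyticRing.extend g z = g.1 z := Subtype.val_injective.extend_apply _ _ _

theorem analyticRing.analyticOnNhd_extend {V : Set E} (hV : IsOpen V) (g : analyticRing V) :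
    AnalyticOnNhd ℂ (analyticRing.extend g) V := by
  obtain ⟨f, hf, h⟩ := g.2
  exact hf.congr hV fun z hz => by rw [analyticRing.extend_apply g ⟨z, hz⟩, h]

theorem analyticRing.ext_extend {V : Set E} {g g' : analyticRing V}
    (h : EqOn (analyticRing.extend g) (analyticRing.extend g') V) : g = g' := by
  apply Subtype.ext
  funext z
  rw [← analyticRing.extend_apply, ← analyticRing.extend_apply]
  exact h z.2

/-- Evaluation at a point, as a ring homomorphism. -/
def analyticRing.evalHom {V : Set E} (z : V) : analyticRing V →+* ℂ :=
  (Pi.evalRingHom (fun _ : V => ℂ) z).comp (analyticRing V).subtype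

theorem analyticRing.evalHom_apply {V : Set E} (z : V) (g : analyticRing V) :
    analyticRing.evalHom z g = analyticRing.extend g z := (analyticRing.extend_apply g z).symm

/-- The condition `∃ᶠ y in 𝓝 x, f y ≠ 0` is used throughout to say that the germ of f at x is not
zero. The identity theorem spreads it over a connected set. -/
theorem frequently_ne_zero_of_ne {V : Set E} (hVc : IsPreconnected V)
    {f : E → ℂ} (hf : AnalyticOnNhd ℂ f V) {z : E} (hz : z ∈ V) (h0 : f z ≠ 0) {x : E}
    (hx : x ∈ V) : ∃ᶠ y in 𝓝 x, f y ≠ 0 := fun h =>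
  h0 (hf.eqOn_zero_of_preconnected_of_eventuallyEq_zero hVc hx (h.mono fun _ h => not_not.1 h) hz)

theorem analyticRing.exists_ne_zero {V : Set E} {g : analyticRing V} (hg : g ≠ 0) :
    ∃ z ∈ V, analyticRing.extend g z ≠ 0 := by
  by_contra! h
  refine hg (analyticRing.ext_extend fun z hz => ?_)
  rw [h z hz, analyticRing.extend_apply 0 ⟨z, hz⟩]; rfl

theorem analyticRing.isDomain {V : Set E} (hVo : IsOpen V) (hVc : IsPreconnected V)
    (hVn : V.Nonempty) : IsDomain (analyticRing V) := by
  obtain ⟨z₀, hz₀⟩ := hVn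
  have hnt : Nontrivial (analyticRing V) := ⟨⟨0, 1, fun h => by
    have := congrArg (analyticRing.evalHom ⟨z₀, hz₀⟩) h
    simp at this⟩⟩
  have hnz : NoZeroDivisors (analyticRing V) := ⟨fun {a b} hab => by
    by_contra! hne
    obtain ⟨z, hz, hza⟩ := analyticRing.exists_ne_zero hne.1
    obtain ⟨w, hw, hwb⟩ := analyticRing.exists_ne_zero hne.2
    have h1 := frequently_ne_zero_of_ne hVc (analyticRing.analyticOnNhd_extend hVo b) hw hwb hz
    have h2 := (analyticRing.analyticOnNhd_extend hVo a z hz).continuousAt.eventually_ne hza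
    obtain ⟨y, hyb, hya, hyV⟩ := (h1.and_eventually (h2.and (hVo.eventually_mem hz))).exists
    have := congrArg (analyticRing.evalHom ⟨y, hyV⟩) hab
    rw [map_mul, map_zero, analyticRing.evalHom_apply, analyticRing.evalHom_apply] at this
    exact (mul_ne_zero hya hyb) this⟩
  exact NoZeroDivisors.to_isDomain _

/-- An integral fraction a/b is locally bounded, because its monic equation bounds ‖a‖ by a local
constant times ‖b‖; Riemann's extension theorem then makes it holomorphic. This is the only
arithmetic property of the ring that the gcd construction needs besides its being a domain. -/
theorem analyticRing.isIntegrallyClosed [FiniteDimensional ℂ E] {V : Set E} (hVo : IsOpen V)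
    (hVc : IsPreconnected V) [IsDomain (analyticRing V)] :
    IsIntegrallyClosed (analyticRing V) := by
  rw [isIntegrallyClosed_iff (FractionRing (analyticRing V))]
  rintro x ⟨p, hp, hpx⟩
  obtain ⟨a, b, hb, rfl⟩ := IsFractionRing.div_surjective (A := analyticRing V) x
  have hb0 : b ≠ 0 := nonZeroDivisors.ne_zero hb
  have hinj := IsFractionRing.injective (analyticRing V) (FractionRing (analyticRing V))
  have hroot := Polynomial.scaleRoots_eval₂_eq_zero_of_eval₂_div_eq_zero hinj hpx hb
  have hroot' : (p.scaleRoots b).eval a = 0 := by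
    apply hinj
    rw [map_zero, ← hroot, Polynomial.eval₂_at_apply]
  have hn : p.natDegree ≠ 0 := by
    intro hn
    rw [hp.natDegree_eq_zero.1 hn] at hpx
    simp at hpx
  have hrel : ∀ z : V, analyticRing.extend a z ^ p.natDegree +
      ∑ i ∈ Finset.range p.natDegree, analyticRing.extend (p.coeff i) z *
        analyticRing.extend b z ^ (p.natDegree - i) * analyticRing.extend a z ^ i = 0 := by
    intro z
    have h1 := congrArg (analyticRing.evalHom z) hroot'
    rw [Polynomial.eval_eq_sum_range, Polynomial.natDegree_scaleRoots, Finset.sum_range_succ] at h1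
    simp only [map_add, map_sum, map_mul, map_pow, Polynomial.coeff_scaleRoots, hp.coeff_natDegree,
      map_zero, analyticRing.evalHom_apply, Nat.sub_self, pow_zero, mul_one, one_mul] at h1
    rw [add_comm]
    exact h1
  obtain ⟨w, hw, hwb⟩ := analyticRing.exists_ne_zero hb0
  obtain ⟨q, hq, hfq⟩ := exists_analytic_quotient hVo (analyticRing.analyticOnNhd_extend hVo a)
    (analyticRing.analyticOnNhd_extend hVo b)
    (fun x hx => frequently_ne_zero_of_ne hVc (analyticRing.analyticOnNhd_extend hVo b) hw hwb hx)
    (fun x hx => by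
      have hcont : ContinuousAt (fun z => 1 + ∑ i ∈ Finset.range p.natDegree,
          ‖analyticRing.extend (p.coeff i) z‖) x := by
        refine continuousAt_const.add (tendsto_finsetSum _ fun i _ => ?_)
        exact (analyticRing.analyticOnNhd_extend hVo (p.coeff i) x hx).continuousAt.norm
      refine ⟨1 + ∑ i ∈ Finset.range p.natDegree, ‖analyticRing.extend (p.coeff i) x‖ + 1, ?_⟩
      filter_upwards [hcont.eventually_lt_const (lt_add_one _), hVo.mem_nhds hx] with y hy hyV
      refine (norm_le_of_homogeneous_monic hn (hrel ⟨y, hyV⟩)).trans ?_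
      exact mul_le_mul_of_nonneg_right hy.le (norm_nonneg _))
  let Q : analyticRing V := ⟨fun z => q z, q, hq, fun _ => rfl⟩
  refine ⟨Q, ?_⟩
  have hab : a = Q * b := by
    apply Subtype.ext
    funext z
    have := hfq z z.2
    rw [analyticRing.extend_apply, analyticRing.extend_apply] at this
    exact this
  rw [hab, map_mul, mul_div_cancel_right₀]
  exact fun h => hb0 (hinj (by rw [h, map_zero]))

end AnalyticRing

end CRGeom

namespace CRGeom

/-! ### Greatest common divisors that stay valid at all nearby points. -/

section Coprime

variable {E : Type*} [NormedAddCommGroup E] [NormedSpace ℂ E]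

/-- The function on `V × ℂ` given by a polynomial with coefficients holomorphic on `V`. -/
noncomputable def analyticRing.polyFun {V : Set E} (w : Polynomial (analyticRing V)) (x : E × ℂ) :
    ℂ := ∑ j ∈ Finset.range (w.natDegree + 1), analyticRing.extend (w.coeff j) x.1 * x.2 ^ j

theorem analyticRing.polyFun_eq {V : Set E} (w : Polynomial (analyticRing V)) {z : E} (hz : z ∈ V)
    (ζ : ℂ) : analyticRing.polyFun w (z, ζ) =
      (w.map (analyticRing.evalHom ⟨z, hz⟩)).eval ζ := by
  rw [Polynomial.eval_map, Polynomial.eval₂_eq_sum_range]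
  exact Finset.sum_congr rfl fun j _ => by rw [analyticRing.evalHom_apply]

theorem analyticRing.analyticAt_polyFun {V : Set E} (hV : IsOpen V)
    (w : Polynomial (analyticRing V)) {z : E} (hz : z ∈ V) (ζ : ℂ) :
    AnalyticAt ℂ (analyticRing.polyFun w) (z, ζ) := by
  refine Finset.analyticAt_fun_sum _ fun j _ => ?_
  exact (AnalyticAt.fun_comp (g := analyticRing.extend (w.coeff j))
    (analyticRing.analyticOnNhd_extend hV _ z hz) analyticAt_fst).mul (analyticAt_snd.pow j)

/-- A family of polynomials with holomorphic coefficients, as a polynomial over the ring of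
holomorphic functions. -/
theorem analyticRing.exists_polynomial {V : Set E} {k : ℕ} {W : E → Polynomial ℂ}
    (hW : ∀ z, (W z).Monic ∧ (W z).natDegree = k)
    (hWa : ∀ j, AnalyticOnNhd ℂ (fun z => (W z).coeff j) V) :
    ∃ w : Polynomial (analyticRing V), w.Monic ∧
      ∀ z ∈ V, ∀ ζ, analyticRing.polyFun w (z, ζ) = (W z).eval ζ := by
  let cf : ℕ → analyticRing V := fun j => ⟨fun z => (W z).coeff j, _, hWa j, fun _ => rfl⟩
  let w : Polynomial (analyticRing V) := ∑ j ∈ Finset.range (k + 1), Polynomial.monomial j (cf j)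
  have hcoeff : ∀ j, w.coeff j = if j ≤ k then cf j else 0 := by
    intro j
    simp [w, Polynomial.coeff_monomial]
  have hcfk : cf k = 1 := by
    apply Subtype.ext
    funext z
    change (W z).coeff k = 1
    rw [← (hW z).2]
    exact (hW z).1
  have hev : ∀ (z : E) (hz : z ∈ V), w.map (analyticRing.evalHom ⟨z, hz⟩) = W z := by
    intro z hz
    ext j
    rw [Polynomial.coeff_map, hcoeff]
    split_ifs with hj
    · rfl
    · rw [map_zero, Polynomial.coeff_eq_zero_of_natDegree_lt]
      rw [(hW z).2]; omega
  refine ⟨w, ?_, fun z hz ζ => by rw [analyticRing.polyFun_eq w hz, hev z hz]⟩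
  refine Polynomial.monic_of_natDegree_le_of_coeff_eq_one k ?_ ?_
  · exact Polynomial.natDegree_le_iff_coeff_eq_zero.2 fun j hj => by
      rw [hcoeff, if_neg (by omega)]
  · rw [hcoeff, if_pos le_rfl, hcfk]

/-- Zeros of a holomorphic function that are isolated on a line persist on nearby lines. -/
theorem eventually_exists_zero {h : E × ℂ → ℂ} {q : E} {c : ℂ} (hh : AnalyticAt ℂ h (q, c))
    (h0 : h (q, c) = 0) (hne : ∀ᶠ ω in 𝓝[≠] c, h (q, ω) ≠ 0) {N : Set (E × ℂ)}
    (hN : N ∈ 𝓝 (q, c)) : ∀ᶠ z in 𝓝 q, ∃ ω, (z, ω) ∈ N ∧ h (z, ω) = 0 := by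
  have h1 : ∀ᶠ x in 𝓝 (q, c), AnalyticAt ℂ h x ∧ x ∈ N :=
    hh.eventually_analyticAt.and hN
  obtain ⟨r, hr, hball⟩ := Metric.nhds_basis_closedBall.eventually_iff.1 h1
  rw [eventually_nhdsWithin_iff] at hne
  obtain ⟨s, hs, hsb⟩ := Metric.nhds_basis_closedBall.eventually_iff.1 hne
  set δ := min r s with hδ
  have hδ0 : 0 < δ := lt_min hr hs
  have hin : ∀ z ∈ Metric.closedBall q r, ∀ ω ∈ Metric.closedBall c δ,
      AnalyticAt ℂ h (z, ω) ∧ (z, ω) ∈ N := by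
    intro z hz ω hω
    apply hball
    rw [← closedBall_prod_same]
    exact ⟨hz, Metric.closedBall_subset_closedBall (min_le_left _ _) hω⟩
  have hsph : ∀ ω ∈ Metric.sphere c δ, h (q, ω) ≠ 0 := fun ω hω =>
    hsb (Metric.closedBall_subset_closedBall (min_le_right _ _)
      (Metric.sphere_subset_closedBall hω)) (ne_of_mem_of_not_mem hω (by simp [hδ0.ne]))
  have hcont : ContinuousOn (fun ω => ‖h (q, ω)‖) (Metric.sphere c δ) := fun ω hω =>
    ((analyticAt_comp_prodMk_right (hin q (Metric.mem_closedBall_self hr.le) ω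
      (Metric.sphere_subset_closedBall hω)).1).continuousAt.norm).continuousWithinAt
  obtain ⟨ω₀, hω₀, hmin⟩ := (isCompact_sphere c δ).exists_isMinOn
    (NormedSpace.sphere_nonempty.2 hδ0.le) hcont
  set m := ‖h (q, ω₀)‖ with hm
  have hm0 : 0 < m := norm_pos_iff.2 (hsph ω₀ hω₀)
  have ev1 : ∀ᶠ z in 𝓝 q, ∀ ω ∈ Metric.sphere c δ, m / 2 < ‖h (z, ω)‖ := by
    refine (isCompact_sphere c δ).eventually_forall_of_forall_eventually fun ω hω => ?_
    have hc := (hin q (Metric.mem_closedBall_self hr.le) ω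
      (Metric.sphere_subset_closedBall hω)).1.continuousAt.norm
    exact hc.eventually_const_lt ((half_lt_self hm0).trans_le (hmin hω))
  have ev2 : ∀ᶠ z in 𝓝 q, ‖h (z, c)‖ < m / 2 := by
    have hc := (analyticAt_comp_prodMk_left hh).continuousAt.norm
    refine hc.eventually_lt_const ?_
    simpa [h0] using hm0
  filter_upwards [ev1, ev2, Metric.closedBall_mem_nhds q hr] with z hz1 hz2 hzr
  -- If h(z, ·) had no zero in the small disc, the maximum principle for 1/h would give ‖h(z, c)‖ ≥
  -- m/2, while h(z, c) is close to h(q, c) = 0.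
  by_contra! hno
  have hnz : ∀ ω ∈ Metric.closedBall c δ, h (z, ω) ≠ 0 := fun ω hω => hno ω (hin z hzr ω hω).2
  have hd : DiffContOnCl ℂ (fun ω => (h (z, ω))⁻¹) (Metric.ball c δ) :=
    DifferentiableOn.diffContOnCl_ball (U := Metric.closedBall c δ) (fun ω hω =>
      ((analyticAt_comp_prodMk_right (hin z hzr ω hω).1).differentiableAt.inv
        (hnz ω hω)).differentiableWithinAt) subset_rfl
  have hle := Complex.norm_le_of_forall_mem_frontier_norm_le Metric.isBounded_ball hd
    (C := (m / 2)⁻¹) (fun ω hω => by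
      rw [frontier_ball c hδ0.ne'] at hω
      rw [norm_inv]
      exact inv_anti₀ (by positivity) (hz1 ω hω).le)
    (subset_closure (Metric.mem_ball_self hδ0))
  rw [norm_inv] at hle
  have hpos : 0 < ‖h (z, c)‖ := norm_pos_iff.2 (hnz c (Metric.mem_closedBall_self hδ0.le))
  have := (inv_le_inv₀ hpos (by positivity)).1 hle
  linarith

/-- The greatest common divisor of finitely many functions that are regular in the last variable:
the cofactors have no common divisor at any nearby point. -/
theorem exists_coprime_factorization_prod [FiniteDimensional ℂ E] {ι : Type*} [Fintype ι]
    [Nonempty ι] {P : ι → E × ℂ → ℂ} {z₀ : E} {c : ℂ} (hP : ∀ i, AnalyticAt ℂ (P i) (z₀, c))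
    (hP0 : ∀ i, ∀ᶠ ζ in 𝓝[≠] c, P i (z₀, ζ) ≠ 0) :
    ∃ U : Set (E × ℂ), IsOpen U ∧ (z₀, c) ∈ U ∧ ∃ (g : E × ℂ → ℂ) (Q : ι → E × ℂ → ℂ),
      AnalyticOnNhd ℂ g U ∧ (∀ i, AnalyticOnNhd ℂ (Q i) U) ∧
      (∀ i, ∀ x ∈ U, P i x = g x * Q i x) ∧
      ∀ q ∈ U, ∀ h : E × ℂ → ℂ, AnalyticAt ℂ h q →
        (∀ i, ∃ Q' : E × ℂ → ℂ, ∀ᶠ y in 𝓝 q, Q i y = h y * Q' y) → h q ≠ 0 := by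
  have hev : ∀ᶠ x in 𝓝 (z₀, c), ∀ i, AnalyticAt ℂ (P i) x :=
    eventually_all.2 fun i => (hP i).eventually_analyticAt
  obtain ⟨r, hr, hball⟩ := Metric.nhds_basis_closedBall.eventually_iff.1 hev
  have hne : ∀ᶠ ζ in 𝓝[≠] c, ∀ i, P i (z₀, ζ) ≠ 0 := eventually_all.2 hP0
  rw [eventually_nhdsWithin_iff] at hne
  obtain ⟨s, hs, hsb⟩ := Metric.nhds_basis_closedBall.eventually_iff.1 hne
  set R := min r s with hRdef
  have hR : 0 < R := lt_min hr hs
  have hin : ∀ z ∈ Metric.closedBall z₀ r, ∀ ω ∈ Metric.closedBall c R,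
      ∀ i, AnalyticAt ℂ (P i) (z, ω) := by
    intro z hz ω hω
    apply hball
    rw [← closedBall_prod_same]
    exact ⟨hz, Metric.closedBall_subset_closedBall (min_le_left _ _) hω⟩
  have ev1 : ∀ᶠ z in 𝓝 z₀, ∀ ω ∈ Metric.sphere c R, ∀ i, P i (z, ω) ≠ 0 := by
    refine (isCompact_sphere c R).eventually_forall_of_forall_eventually fun ω hω => ?_
    refine eventually_all.2 fun i => ?_
    refine (hin z₀ (Metric.mem_closedBall_self hr.le) ω (Metric.sphere_subset_closedBall hω)
      i).continuousAt.eventually_ne ?_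
    exact hsb (Metric.closedBall_subset_closedBall (min_le_right _ _)
      (Metric.sphere_subset_closedBall hω)) (ne_of_mem_of_not_mem hω (by simp [hR.ne])) i
  obtain ⟨ε, hε, hεb⟩ := Metric.nhds_basis_ball.eventually_iff.1
    (ev1.and (Metric.closedBall_mem_nhds z₀ hr))
  set V := Metric.ball z₀ ε with hV
  have hVo : IsOpen V := Metric.isOpen_ball
  have hVc : IsPreconnected V := by
    let := NormedSpace.restrictScalars ℝ ℂ E
    exact (convex_ball z₀ ε).isPreconnected
  have hz₀V : z₀ ∈ V := Metric.mem_ball_self hε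
  have hWP : ∀ i, ∃ w : Polynomial (analyticRing V), w.Monic ∧ ∃ u : E × ℂ → ℂ,
      AnalyticOnNhd ℂ u (V ×ˢ Metric.ball c R) ∧ (∀ x ∈ V ×ˢ Metric.ball c R, u x ≠ 0) ∧
      ∀ x ∈ V ×ˢ Metric.ball c R, P i x = u x * analyticRing.polyFun w x := by
    intro i
    obtain ⟨k, W, hW, hWa, u, hu, hu0, hPu⟩ := weierstrass_preparation hVo hVc hR (f := P i)
      (fun x hx => hin x.1 (hεb hx.1).2 x.2 hx.2 i) (fun z hz ζ hζ => (hεb hz).1 ζ hζ i)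
    obtain ⟨w, hw, hwW⟩ := analyticRing.exists_polynomial hW hWa
    exact ⟨w, hw, u, hu, hu0, fun x hx => by rw [hPu x hx, ← hwW x.1 hx.1 x.2]⟩
  choose w hw u hu hu0 hPu using hWP
  have hdom : IsDomain (analyticRing V) := analyticRing.isDomain hVo hVc ⟨z₀, hz₀V⟩
  have hic : IsIntegrallyClosed (analyticRing V) := analyticRing.isIntegrallyClosed hVo hVc
  -- G is the gcd of the Weierstrass polynomials and the v i are the cofactors. The right-hand side
  -- D of the Bezout relation depends on the base point z only; the units u i are absorbed into the
  -- quotients Q i.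
  obtain ⟨G, v, hGv, hvm, a, D, hD0, hbez⟩ := exists_gcd_bezout w hw
  have hUo : IsOpen (V ×ˢ Metric.ball c R) := hVo.prod Metric.isOpen_ball
  have han : ∀ p : Polynomial (analyticRing V),
      AnalyticOnNhd ℂ (analyticRing.polyFun p) (V ×ˢ Metric.ball c R) := fun p x hx =>
    analyticRing.analyticAt_polyFun hVo p hx.1 x.2
  refine ⟨V ×ˢ Metric.ball c R, hUo, ⟨hz₀V, Metric.mem_ball_self hR⟩,
    analyticRing.polyFun G, fun i x => u i x * analyticRing.polyFun (v i) x, han G,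
    fun i => (hu i).mul (han (v i)), fun i x hx => ?_, ?_⟩
  · rw [hPu i x hx, hGv i]
    obtain ⟨z, ζ⟩ := x
    have hz : z ∈ V := hx.1
    simp only [analyticRing.polyFun_eq _ hz, Polynomial.map_mul, Polynomial.eval_mul]
    ring
  · rintro ⟨q, b⟩ hq h hh hdiv h0
    choose Q' hQ' using hdiv
    have hvdiv : ∀ i, ∀ᶠ y in 𝓝 (q, b), analyticRing.polyFun (v i) y =
        h y * ((u i y)⁻¹ * Q' i y) := by
      intro i
      filter_upwards [hQ' i, hUo.mem_nhds hq] with y hy hyU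
      have hu0' := hu0 i y hyU
      rw [← inv_mul_cancel_left₀ hu0' (analyticRing.polyFun (v i) y), hy]
      ring
    -- A zero of h is a common zero of all cofactors v i, and there the Bezout relation forces D =
    -- 0.
    have hDdiv : ∀ᶠ y in 𝓝 (q, b), h y = 0 → analyticRing.extend D y.1 = 0 := by
      filter_upwards [eventually_all.2 hvdiv, hUo.mem_nhds hq] with y hy hyU hy0
      obtain ⟨z, ζ⟩ := y
      have hzV : z ∈ V := hyU.1
      have h1 := congrArg (fun p => (Polynomial.map (analyticRing.evalHom ⟨z, hzV⟩) p).eval ζ) hbez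
      simp only [Polynomial.map_sum, Polynomial.map_mul, Polynomial.map_C, Polynomial.eval_C,
        Polynomial.eval_finsetSum, Polynomial.eval_mul] at h1
      rw [analyticRing.evalHom_apply] at h1
      change analyticRing.extend D z = 0
      rw [← h1]
      refine Finset.sum_eq_zero fun i _ => ?_
      rw [← analyticRing.polyFun_eq (v i) hzV, hy i, hy0, zero_mul, mul_zero]
    -- On the vertical line h cannot vanish identically, since it divides the monic polynomial v i
    -- there.
    have hhne : ∀ᶠ ω in 𝓝[≠] b, h (q, ω) ≠ 0 := by
      refine (analyticAt_comp_prodMk_right hh).eventually_eq_zero_or_eventually_ne_zero.resolve_left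
        fun hz => ?_
      obtain ⟨i⟩ := ‹Nonempty ι›
      have hline : Tendsto (fun ω : ℂ => (q, ω)) (𝓝 b) (𝓝 (q, b)) :=
        (by fun_prop : Continuous fun ω : ℂ => (q, ω)).tendsto b
      have h1 : ∀ᶠ ω in 𝓝 b,
          ((v i).map (analyticRing.evalHom ⟨q, hq.1⟩)).IsRoot ω := by
        filter_upwards [hz, hline.eventually (hvdiv i)] with ω h2 h3
        rw [Polynomial.IsRoot, ← analyticRing.polyFun_eq (v i) hq.1, h3, h2, zero_mul]
      exact ((hvm i).map _).ne_zero (Polynomial.eq_zero_of_infinite_isRoot _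
        (infinite_of_mem_nhds b h1))
    -- The zero of h at (q, b) persists over every z near q, so D vanishes on an open set and hence
    -- identically.
    have hzero : ∀ᶠ z in 𝓝 q, analyticRing.extend D z = 0 := by
      filter_upwards [eventually_exists_zero hh h0 hhne hDdiv] with z hz
      obtain ⟨ω, h1, h2⟩ := hz
      exact h1 h2
    obtain ⟨z, hz, hzD⟩ := analyticRing.exists_ne_zero hD0
    exact hzD ((analyticRing.analyticOnNhd_extend hVo D).eqOn_zero_of_preconnected_of_eventuallyEq_zero
      hVc hq.1 hzero hz)

end Coprime

end CRGeom

namespace CRGeom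

/-! ### Common factors in arbitrary coordinates and the locus where they leave no common zero. -/

section Indeterminacy

variable {E : Type*} [NormedAddCommGroup E] [NormedSpace ℂ E]

theorem isPreconnected_complex_ball (x : E) (r : ℝ) : IsPreconnected (Metric.ball x r) := by
  let := NormedSpace.restrictScalars ℝ ℂ E
  exact (convex_ball x r).isPreconnected

theorem frequently_mul_ne_zero {E : Type*} [TopologicalSpace E] {f g : E → ℂ} {x : E} (hf : ∃ᶠ y in 𝓝 x, f y ≠ 0)
    (hfc : ∀ᶠ y in 𝓝 x, ContinuousAt f y) (hg : ∀ᶠ y in 𝓝 x, ∃ᶠ z in 𝓝 y, g z ≠ 0) :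
    ∃ᶠ y in 𝓝 x, f y * g y ≠ 0 := by
  rw [← frequently_frequently_nhds]
  refine (hf.and_eventually (hfc.and hg)).mono fun y hy => ?_
  refine (hy.2.2.and_eventually (hy.2.1.eventually_ne hy.1)).mono fun z hz => ?_
  exact mul_ne_zero hz.2 hz.1

theorem eventually_frequently_ne_zero {f : E → ℂ} {x : E} (hf : AnalyticAt ℂ f x)
    (h0 : ∃ᶠ y in 𝓝 x, f y ≠ 0) : ∀ᶠ y in 𝓝 x, ∃ᶠ z in 𝓝 y, f z ≠ 0 := by
  obtain ⟨r, hr, hball⟩ := Metric.nhds_basis_ball.eventually_iff.1 hf.eventually_analyticAt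
  obtain ⟨w, hw, hwr⟩ := (h0.and_eventually (Metric.ball_mem_nhds x hr)).exists
  filter_upwards [Metric.ball_mem_nhds x hr] with y hy
  exact frequently_ne_zero_of_ne (isPreconnected_complex_ball x r) (fun z hz => hball hz) hwr hw hy

theorem frequently_prod_ne_zero {ι : Type*} (s : Finset ι) {f : ι → E → ℂ} {x : E}
    (hf : ∀ i ∈ s, AnalyticAt ℂ (f i) x) (h0 : ∀ i ∈ s, ∃ᶠ y in 𝓝 x, f i y ≠ 0) :
    ∃ᶠ y in 𝓝 x, ∏ i ∈ s, f i y ≠ 0 := by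
  classical
  induction s using Finset.induction_on with
  | empty => simp
  | insert i s hi ih =>
    have hih := ih (fun j hj => hf j (Finset.mem_insert_of_mem hj))
      (fun j hj => h0 j (Finset.mem_insert_of_mem hj))
    have han : AnalyticAt ℂ (fun y => ∏ j ∈ s, f j y) x :=
      Finset.analyticAt_fun_prod _ fun j hj => hf j (Finset.mem_insert_of_mem hj)
    simp only [Finset.prod_insert hi]
    exact frequently_mul_ne_zero (h0 i (Finset.mem_insert_self _ _))
      ((hf i (Finset.mem_insert_self _ _)).eventually_analyticAt.mono fun y hy => hy.continuousAt)
      (eventually_frequently_ne_zero han hih)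

/-- Finitely many holomorphic functions near a point, after division by their greatest common
divisor, have no common divisor at any nearby point. -/
theorem exists_coprime_factorization [FiniteDimensional ℂ E] {ι : Type*} [Fintype ι]
    {P : ι → E → ℂ} {p : E} (hP : ∀ i, AnalyticAt ℂ (P i) p)
    (hP0 : ∃ i, ∃ᶠ y in 𝓝 p, P i y ≠ 0) :
    ∃ U : Set E, IsOpen U ∧ p ∈ U ∧ ∃ (g : E → ℂ) (Q : ι → E → ℂ),
      AnalyticOnNhd ℂ g U ∧ (∀ i, AnalyticOnNhd ℂ (Q i) U) ∧
      (∀ i, ∀ x ∈ U, P i x = g x * Q i x) ∧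
      ∀ q ∈ U, ∀ h : E → ℂ, AnalyticAt ℂ h q →
        (∀ i, ∃ Q' : E → ℂ, ∀ᶠ y in 𝓝 q, Q i y = h y * Q' y) → h q ≠ 0 := by
  classical
  have hall : ∀ᶠ x in 𝓝 p, ∀ i, AnalyticAt ℂ (P i) x :=
    eventually_all.2 fun i => (hP i).eventually_analyticAt
  by_cases hpp : ∃ i, P i p ≠ 0
  · obtain ⟨i, hi⟩ := hpp
    obtain ⟨U, hU, hUo, hpU⟩ := eventually_nhds_iff.1
      (hall.and ((hP i).continuousAt.eventually_ne hi))
    refine ⟨U, hUo, hpU, fun _ => 1, P, analyticOnNhd_const, fun i x hx => (hU x hx).1 i,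
      fun i x _ => (one_mul _).symm, fun q hq h _ hdiv h0 => ?_⟩
    obtain ⟨Q', hQ'⟩ := hdiv i
    have := hQ'.self_of_nhds
    rw [h0, zero_mul] at this
    exact (hU q hq).2 this
  push Not at hpp
  -- The functions with zero germ at p are set aside and later receive the quotient 0; only the
  -- others can be made regular in a common direction.
  let S : Finset ι := Finset.univ.filter fun i => ∃ᶠ y in 𝓝 p, P i y ≠ 0
  have hS : ∀ i, i ∈ S ↔ ∃ᶠ y in 𝓝 p, P i y ≠ 0 := fun i => by simp [S]
  obtain ⟨i₀, hi₀⟩ := hP0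
  have hi₀S : i₀ ∈ S := (hS i₀).2 hi₀
  have hprod : AnalyticAt ℂ (fun y => ∏ i ∈ S, P i y) p :=
    Finset.analyticAt_fun_prod _ fun i _ => hP i
  -- A line on which the product is not identically zero is good for all factors at once. It becomes
  -- the last coordinate axis; the functional φ with φ v = 1 gives the splitting of the space.
  obtain ⟨v, hv⟩ := exists_direction_ne_zero hprod
    (frequently_prod_ne_zero S (fun i _ => hP i) fun i hi => (hS i).1 hi)
  have hv0 : v ≠ 0 := by
    rintro rfl
    obtain ⟨ζ, hζ⟩ := hv.exists
    rw [smul_zero, add_zero] at hζ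
    exact hζ (Finset.prod_eq_zero hi₀S (hpp i₀))
  obtain ⟨φ, hφ⟩ := SeparatingDual.exists_eq_one (R := ℂ) hv0
  let e₀ := ContinuousLinearEquiv.equivOfRightInverse φ
    (ContinuousLinearMap.toSpanSingleton ℂ v) (fun ζ => by simp [hφ])
  let e : E ≃L[ℂ] φ.ker × ℂ := e₀.trans (ContinuousLinearEquiv.prodComm ℂ ℂ φ.ker)
  have he : ∀ x, e.symm x = x.2 • v + (x.1 : E) := fun x => by
    simp [e, e₀]
  have hp : ((e p).1 : E) = p - (e p).2 • v := by
    rw [eq_sub_iff_add_eq, add_comm, ← he, e.symm_apply_apply]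
  have hSne : Nonempty S := ⟨⟨i₀, hi₀S⟩⟩
  obtain ⟨U, hUo, hpU, g, Q, hg, hQ, hfac, hcop⟩ :=
    exists_coprime_factorization_prod (ι := S) (P := fun i x => P i (e.symm x)) (z₀ := (e p).1)
      (c := (e p).2)
      (fun i => AnalyticAt.fun_comp (g := P i) (by
        rw [Prod.mk.eta, e.symm_apply_apply]; exact hP i) (e.symm.analyticAt _))
      (fun i => by
        have htend : Tendsto (fun ζ : ℂ => ζ - (e p).2) (𝓝[≠] (e p).2) (𝓝[≠] 0) := by
          refine tendsto_nhdsWithin_iff.2 ⟨?_, ?_⟩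
          · have : ContinuousAt (fun ζ : ℂ => ζ - (e p).2) (e p).2 := by fun_prop
            simpa [ContinuousAt] using this.tendsto.mono_left nhdsWithin_le_nhds
          · filter_upwards [self_mem_nhdsWithin] with ζ hζ
            exact sub_ne_zero.2 hζ
        filter_upwards [htend.eventually hv] with ζ hζ
        have h1 := Finset.prod_ne_zero_iff.1 hζ i i.2
        have h2 : e.symm ((e p).1, ζ) = p + (ζ - (e p).2) • v := by
          rw [he]
          simp only [hp, sub_smul]
          abel
        rw [h2]
        exact h1)
  have hzero : ∀ᶠ x in 𝓝 p, ∀ i, i ∉ S → P i x = 0 := by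
    refine eventually_all.2 fun i => ?_
    by_cases hi : i ∈ S
    · exact Eventually.of_forall fun x h => (h hi).elim
    · rw [hS, not_frequently] at hi
      exact hi.mono fun x hx _ => not_not.1 hx
  obtain ⟨U', hU', hU'o, hpU'⟩ := eventually_nhds_iff.1 hzero
  refine ⟨e ⁻¹' U ∩ U', (hUo.preimage e.continuous).inter hU'o, ⟨hpU, hpU'⟩, fun x => g (e x),
    fun i x => if hi : i ∈ S then Q ⟨i, hi⟩ (e x) else 0, fun x hx => ?_, fun i x hx => ?_,
    fun i x hx => ?_, fun q hq h hh hdiv => ?_⟩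
  · exact AnalyticAt.fun_comp (g := g) (hg _ hx.1) (e.analyticAt x)
  · by_cases hi : i ∈ S
    · simp only [dif_pos hi]
      exact AnalyticAt.fun_comp (g := Q ⟨i, hi⟩) (hQ _ _ hx.1) (e.analyticAt x)
    · simp only [dif_neg hi]
      exact analyticAt_const
  · by_cases hi : i ∈ S
    · simp only [dif_pos hi]
      simpa using hfac ⟨i, hi⟩ (e x) hx.1
    · simp only [dif_neg hi, mul_zero]
      exact hU' x hx.2 i hi
  · have := hcop (e q) hq.1 (fun x => h (e.symm x)) (AnalyticAt.fun_comp (g := h)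
      (by rwa [e.symm_apply_apply]) (e.symm.analyticAt _)) (fun i => by
        obtain ⟨Q', hQ'⟩ := hdiv i
        refine ⟨fun x => Q' (e.symm x), ?_⟩
        have htend : Tendsto e.symm (𝓝 (e q)) (𝓝 q) := by
          simpa using e.symm.continuous.tendsto (e q)
        filter_upwards [htend.eventually hQ'] with y hy
        simpa using hy)
    simpa using this

/-- The points near `p` at which a common factor can be divided out so that the quotients do not
vanish simultaneously form the complement of a complex-analytic set. -/
theorem exists_indeterminacy_equations [FiniteDimensional ℂ E] {ι : Type*} [Fintype ι]
    {P : ι → E → ℂ} {p : E} (hP : ∀ i, AnalyticAt ℂ (P i) p)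
    (hP0 : ∃ i, ∃ᶠ y in 𝓝 p, P i y ≠ 0) :
    ∃ (U : Set E) (Q : ι → E → ℂ), IsOpen U ∧ p ∈ U ∧ (∀ i, AnalyticOnNhd ℂ (Q i) U) ∧
      (∀ x ∈ U, ∃ᶠ y in 𝓝 x, ∃ i, Q i y ≠ 0) ∧
      ∀ q ∈ U, (∃ i, Q i q ≠ 0) ↔ ∃ (h : E → ℂ) (R : ι → E → ℂ), AnalyticAt ℂ h q ∧
        (∀ i, AnalyticAt ℂ (R i) q) ∧ (∀ᶠ y in 𝓝 q, ∀ i, P i y = h y * R i y) ∧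
        ∃ i, R i q ≠ 0 := by
  obtain ⟨i₀, hi₀⟩ := hP0
  obtain ⟨U, hUo, hpU, g, Q, hg, hQ, hfac, hcop⟩ := exists_coprime_factorization hP ⟨i₀, hi₀⟩
  have hfr := eventually_frequently_ne_zero (hP i₀) hi₀
  obtain ⟨U', hU', hU'o, hpU'⟩ := eventually_nhds_iff.1 hfr
  have hPfr : ∀ x ∈ U ∩ U', ∃ᶠ y in 𝓝 x, g y ≠ 0 ∧ Q i₀ y ≠ 0 := by
    intro x hx
    refine ((hU' x hx.2).and_eventually (hUo.eventually_mem hx.1)).mono fun y hy => ?_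
    have := hy.1
    rw [hfac i₀ y hy.2] at this
    exact ⟨left_ne_zero_of_mul this, right_ne_zero_of_mul this⟩
  refine ⟨U ∩ U', Q, hUo.inter hU'o, ⟨hpU, hpU'⟩, fun i x hx => hQ i x hx.1, fun x hx =>
    (hPfr x hx).mono fun y hy => ⟨i₀, hy.2⟩, fun q hq => ⟨fun hQq => ?_, ?_⟩⟩
  · refine ⟨g, Q, hg q hq.1, fun i => hQ i q hq.1, ?_, hQq⟩
    filter_upwards [hUo.mem_nhds hq.1] with y hy i
    exact hfac i y hy
  · rintro ⟨h, R, hh, hR, hPR, i, hRi⟩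
    by_contra! hQ0
    -- From P = gQ = hR one gets Q j R i = Q i R j away from the zeros of g, hence everywhere
    -- nearby. As R i q ≠ 0, the function Q i / R i divides every Q j; but it vanishes at q, against
    -- coprimality.
    let h' : E → ℂ := fun y => Q i y / R i y
    have hh' : AnalyticAt ℂ h' q := (hQ i q hq.1).div (hR i) hRi
    refine hcop q hq.1 h' hh' (fun j => ⟨R j, ?_⟩) (by simp [h', hQ0 i])
    -- near `q`, `Q j * R i = Q i * R j` holds where `g ≠ 0`, hence everywhere
    have hrel : ∀ᶠ y in 𝓝 q, g y * (Q j y * R i y - Q i y * R j y) = 0 := by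
      filter_upwards [hPR, hUo.mem_nhds hq.1] with y hy hyU
      have h1 := hfac j y hyU
      have h2 := hfac i y hyU
      rw [hy j] at h1
      rw [hy i] at h2
      linear_combination (-R i y) * h1 + R j y * h2
    have hd : AnalyticAt ℂ (fun y => Q j y * R i y - Q i y * R j y) q :=
      ((hQ j q hq.1).mul (hR i)).sub ((hQ i q hq.1).mul (hR j))
    have hd0 : ∀ᶠ y in 𝓝 q, Q j y * R i y - Q i y * R j y = 0 := by
      by_contra hne
      have hne' : ∃ᶠ y in 𝓝 q, Q j y * R i y - Q i y * R j y ≠ 0 := not_eventually.1 hne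
      have := frequently_mul_ne_zero (f := g) ((hPfr q hq).mono fun y hy => hy.1)
        ((hg q hq.1).eventually_analyticAt.mono fun y hy => hy.continuousAt)
        (eventually_frequently_ne_zero hd hne')
      exact this (hrel.mono fun y hy => not_not.2 hy)
    filter_upwards [hd0, (hR i).continuousAt.eventually_ne hRi] with y hy hyR
    simp only [h']
    rw [div_mul_eq_mul_div, eq_div_iff hyR]
    linear_combination hy

end Indeterminacy

end CRGeom

namespace CRGeom

/-! ### Kernels of families of holomorphic one-forms. -/

section ContinuousLinearMap

variable {𝕜 : Type*} [NontriviallyNormedField 𝕜] {V F G H : Type*} [NormedAddCommGroup V]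
  [NormedSpace 𝕜 V] [NormedAddCommGroup F] [NormedSpace 𝕜 F] [NormedAddCommGroup G]
  [NormedSpace 𝕜 G] [NormedAddCommGroup H] [NormedSpace 𝕜 H] {x : V}

theorem analyticAt_clm_apply {f : V → F →L[𝕜] G} {g : V → F} (hf : AnalyticAt 𝕜 f x)
    (hg : AnalyticAt 𝕜 g x) : AnalyticAt 𝕜 (fun x => f x (g x)) x :=
  AnalyticAt.fun_comp (g := fun y : (F →L[𝕜] G) × F => y.1 y.2)
    ((ContinuousLinearMap.id 𝕜 (F →L[𝕜] G)).analyticAt_bilinear _) (hf.prod hg)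

theorem analyticAt_clm_comp {f : V → G →L[𝕜] H} {g : V → F →L[𝕜] G} (hf : AnalyticAt 𝕜 f x)
    (hg : AnalyticAt 𝕜 g x) : AnalyticAt 𝕜 (fun x => (f x).comp (g x)) x :=
  AnalyticAt.fun_comp (g := fun y : (G →L[𝕜] H) × (F →L[𝕜] G) => y.1.comp y.2)
    ((ContinuousLinearMap.compL 𝕜 F G H).analyticAt_bilinear _) (hf.prod hg)

end ContinuousLinearMap

section KernelValues

variable {L : Type} [NormedAddCommGroup L] [NormedSpace ℂ L] {ι : Type*}

/-- The values at `Z` of the germs at `Z` of holomorphic vector fields annihilated by a family of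
holomorphic one-forms. -/
def kernelValues (θ : ι → L → (L →L[ℂ] ℂ)) (Z : L) : Submodule ℂ L where
  carrier := {v | ∃ Y : L → L, AnalyticAt ℂ Y Z ∧ (∀ᶠ Z' in 𝓝 Z, ∀ a, θ a Z' (Y Z') = 0) ∧ Y Z = v}
  zero_mem' := ⟨0, analyticAt_const, by simp, rfl⟩
  add_mem' := by
    rintro v w ⟨Y, hY, hY0, rfl⟩ ⟨X, hX, hX0, rfl⟩
    refine ⟨Y + X, hY.add hX, ?_, rfl⟩
    filter_upwards [hY0, hX0] with Z' h1 h2 a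
    simp [h1 a, h2 a]
  smul_mem' := by
    rintro c v ⟨Y, hY, hY0, rfl⟩
    refine ⟨c • Y, hY.const_smul, ?_, rfl⟩
    filter_upwards [hY0] with Z' h1 a
    simp [h1 a]

/-- The matrix of functionals evaluated at chosen basis vectors. -/
noncomputable def minorMatrix {n r : ℕ} (b : Module.Basis (Fin n) ℂ L) (f : Fin r → (L →L[ℂ] ℂ))
    (I : Fin r → Fin n) : Matrix (Fin r) (Fin r) ℂ := Matrix.of fun i j => f i (b (I j))

/-- Row rank equals column rank, so r independent columns can be selected. -/
theorem exists_minor_ne_zero {n r : ℕ} (b : Module.Basis (Fin n) ℂ L) {f : Fin r → (L →L[ℂ] ℂ)}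
    (hf : LinearIndependent ℂ f) : ∃ I, (minorMatrix b f I).det ≠ 0 := by
  classical
  let M : Matrix (Fin r) (Fin n) ℂ := Matrix.of fun i j => f i (b j)
  have hrow : LinearIndependent ℂ M.row := by
    rw [Fintype.linearIndependent_iff] at hf ⊢
    intro c hc i
    refine hf c ?_ i
    refine ContinuousLinearMap.coe_injective (b.ext fun j => ?_)
    have := congrFun hc j
    simpa [M, Matrix.row] using this
  have hrank : M.rank = r := by simpa using hrow.rank_matrix
  rw [Matrix.rank_eq_finrank_span_cols] at hrank
  have htop : Submodule.span ℂ (range M.col) = ⊤ :=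
    Submodule.eq_top_of_finrank_eq (by simpa using hrank)
  obtain ⟨κ, a, ha, hsp, hli⟩ := exists_linearIndependent' ℂ M.col
  have : Finite κ := Finite.of_injective a ha
  have := Fintype.ofFinite κ
  have hcard : Fintype.card κ = r := by
    have h1 := finrank_span_eq_card hli
    rw [hsp, htop, finrank_top, Module.finrank_fin_fun] at h1
    exact h1.symm
  let e : Fin r ≃ κ := (Fintype.equivFinOfCardEq hcard).symm
  refine ⟨a ∘ e, ?_⟩
  have hcols : LinearIndependent ℂ (minorMatrix b f (a ∘ e)).col := hli.comp e e.injective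
  rw [Matrix.linearIndependent_cols_iff_isUnit, Matrix.isUnit_iff_isUnit_det] at hcols
  exact hcols.ne_zero

theorem linearIndependent_of_minor_ne_zero {n r : ℕ} (b : Module.Basis (Fin n) ℂ L)
    {f : Fin r → (L →L[ℂ] ℂ)} {I : Fin r → Fin n} (hI : (minorMatrix b f I).det ≠ 0) :
    LinearIndependent ℂ f := by
  have hu : IsUnit (minorMatrix b f I) := by
    rw [Matrix.isUnit_iff_isUnit_det]; exact hI.isUnit
  have hrow := Matrix.linearIndependent_rows_iff_isUnit.2 hu
  rw [Fintype.linearIndependent_iff] at hrow ⊢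
  intro c hc i
  refine hrow c ?_ i
  funext j
  have := congrArg (fun g : L →L[ℂ] ℂ => g (b (I j))) hc
  simpa [minorMatrix, Matrix.row] using this

theorem minorMatrix_update_eq {n r : ℕ} (b : Module.Basis (Fin n) ℂ L) (f : Fin r → (L →L[ℂ] ℂ))
    (I : Fin r → Fin n) (s : Fin r) (j : Fin n) :
    minorMatrix b f (Function.update I s j) =
      (minorMatrix b f I).updateCol s (fun i => f i (b j)) := by
  ext i t
  by_cases hts : t = s
  · subst hts; simp [minorMatrix]
  · simp [minorMatrix, hts]

/-- Cramer's rule, in the form of a vector annihilated by given functionals. -/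
theorem cramer_annihilates {n r : ℕ} (b : Module.Basis (Fin n) ℂ L) (f : Fin r → (L →L[ℂ] ℂ))
    (I : Fin r → Fin n) (j : Fin n) (i : Fin r) :
    f i ((minorMatrix b f I).det • b j -
      ∑ s, (minorMatrix b f (Function.update I s j)).det • b (I s)) = 0 := by
  have h := congrFun (Matrix.mulVec_cramer (minorMatrix b f I) fun i => f i (b j)) i
  simp only [Matrix.mulVec, dotProduct, Matrix.cramer_apply, Pi.smul_apply, smul_eq_mul,
    ← minorMatrix_update_eq] at h
  rw [map_sub, map_smul, map_sum, smul_eq_mul, sub_eq_zero, ← h]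
  refine Finset.sum_congr rfl fun s _ => ?_
  rw [map_smul, smul_eq_mul, mul_comm]
  rfl

theorem analyticAt_minor {n r : ℕ} (b : Module.Basis (Fin n) ℂ L) {f : Fin r → L → (L →L[ℂ] ℂ)}
    {Z : L} (hf : ∀ i, AnalyticAt ℂ (f i) Z) (I : Fin r → Fin n) :
    AnalyticAt ℂ (fun Z => (minorMatrix b (fun i => f i Z) I).det) Z := by
  simp only [Matrix.det_apply', minorMatrix, Matrix.of_apply]
  refine Finset.analyticAt_fun_sum _ fun σ _ => analyticAt_const.mul ?_
  refine Finset.analyticAt_fun_prod _ fun i _ => ?_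
  exact ((ContinuousLinearMap.apply ℂ ℂ (b (I i))).analyticAt _).comp (hf (σ i))

/-- A product of analytic functions vanishes near a point only if one of the factors does. -/
theorem eventually_eq_zero_of_mul {g f : L → ℂ} {x : L} (hg : AnalyticAt ℂ g x)
    (hf : AnalyticAt ℂ f x) (hg0 : ∃ᶠ y in 𝓝 x, g y ≠ 0) (h : ∀ᶠ y in 𝓝 x, g y * f y = 0) :
    ∀ᶠ y in 𝓝 x, f y = 0 := by
  by_contra hne
  exact frequently_mul_ne_zero hg0 (hg.eventually_analyticAt.mono fun y hy => hy.continuousAt)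
    (eventually_frequently_ne_zero hf (not_eventually.1 hne)) (h.mono fun y hy => not_not.2 hy)

section FiniteFamily

variable [FiniteDimensional ℂ L] {n r : ℕ} (b : Module.Basis (Fin n) ℂ L) {f : Fin r → L → (L →L[ℂ] ℂ)} {Z : L}

/-- Where the minors are not identically zero, the kernel has at most the expected dimension. -/
theorem finrank_kernelValues_le (hmin : ∃ᶠ Z' in 𝓝 Z, ∃ I,
    (minorMatrix b (fun i => f i Z') I).det ≠ 0) :
    Module.finrank ℂ (kernelValues f Z) + r ≤ n := by
  let B := Module.finBasis ℂ (kernelValues f Z)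
  have hB : ∀ j, ∃ Y : L → L, AnalyticAt ℂ Y Z ∧ (∀ᶠ Z' in 𝓝 Z, ∀ a, f a Z' (Y Z') = 0) ∧
      Y Z = B j := fun j => (B j).2
  choose Y hY hY0 hYB using hB
  have hli : LinearIndependent ℂ (fun j => Y j Z) := by
    simp only [hYB]
    exact B.linearIndependent.map' (kernelValues f Z).subtype (Submodule.ker_subtype _)
  have hcont : ContinuousAt (fun Z' => fun j => Y j Z') Z :=
    continuousAt_pi.2 fun j => (hY j).continuousAt
  have hev : ∀ᶠ Z' in 𝓝 Z, LinearIndependent ℂ (fun j => Y j Z') :=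
    hcont.eventually hli.eventually
  -- At a nearby point with a nonzero minor the fields representing a basis of values are still
  -- independent, and they lie in a common kernel of dimension exactly n - r.
  obtain ⟨Z', ⟨I, hI⟩, hli', hzero⟩ := (hmin.and_eventually
    (hev.and (eventually_all.2 hY0))).exists
  have hfi := linearIndependent_of_minor_ne_zero b hI
  -- the common kernel of `r` independent functionals has dimension `n - r`
  let T : L →ₗ[ℂ] (Fin r → ℂ) := LinearMap.pi fun i => (f i Z' : L →ₗ[ℂ] ℂ)
  have hker : ∀ j, Y j Z' ∈ LinearMap.ker T := fun j => by
    rw [LinearMap.mem_ker]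
    funext i
    exact hzero j i
  have hsurj : LinearMap.range T = ⊤ := by
    rw [LinearMap.range_eq_top]
    intro y
    have hu : IsUnit (minorMatrix b (fun i => f i Z') I).det := hI.isUnit
    let x := (minorMatrix b (fun i => f i Z') I)⁻¹.mulVec y
    refine ⟨∑ j, x j • b (I j), ?_⟩
    have h1 : (minorMatrix b (fun i => f i Z') I).mulVec x = y := by
      rw [Matrix.mulVec_mulVec, Matrix.mul_nonsing_inv _ hu, Matrix.one_mulVec]
    rw [← h1]
    funext i
    simp [T, Matrix.mulVec, dotProduct, minorMatrix, mul_comm]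
  have hrn := T.finrank_range_add_finrank_ker
  rw [hsurj, finrank_top, Module.finrank_fin_fun, Module.finrank_eq_card_basis b,
    Fintype.card_fin] at hrn
  have hle : Module.finrank ℂ (kernelValues f Z) ≤ Module.finrank ℂ (LinearMap.ker T) := by
    have hli2 : LinearIndependent ℂ (fun j => (⟨Y j Z', hker j⟩ : LinearMap.ker T)) :=
      LinearIndependent.of_comp (LinearMap.ker T).subtype hli'
    simpa using hli2.fintype_card_le_finrank
  omega

/-- If the minors are, up to a common factor, without common zeros, the kernel has the expected
dimension. -/
theorem le_finrank_kernelValues_of_factor (hf : ∀ i, AnalyticAt ℂ (f i) Z) {h : L → ℂ}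
    {R : (Fin r → Fin n) → L → ℂ} (hh : AnalyticAt ℂ h Z) (hR : ∀ I, AnalyticAt ℂ (R I) Z)
    (hfac : ∀ᶠ Z' in 𝓝 Z, ∀ I, (minorMatrix b (fun i => f i Z') I).det = h Z' * R I Z')
    (hmin : ∃ᶠ Z' in 𝓝 Z, ∃ I, (minorMatrix b (fun i => f i Z') I).det ≠ 0)
    {I : Fin r → Fin n} (hI : R I Z ≠ 0) : n ≤ Module.finrank ℂ (kernelValues f Z) + r := by
  have hh0 : ∃ᶠ Z' in 𝓝 Z, h Z' ≠ 0 := by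
    refine (hmin.and_eventually hfac).mono fun Z' hZ' => ?_
    obtain ⟨⟨J, hJ⟩, hfacJ⟩ := hZ'
    rw [hfacJ J] at hJ
    exact left_ne_zero_of_mul hJ
  -- These are the Cramer fields with the common factor h divided out. The forms still annihilate
  -- them because the germ of h is not zero, and together with the r vectors b (I s) their values at
  -- Z span L, since R I Z ≠ 0.
  let Y : Fin n → L → L := fun j Z' =>
    R I Z' • b j - ∑ s, R (Function.update I s j) Z' • b (I s)
  have hYa : ∀ j, AnalyticAt ℂ (Y j) Z := fun j =>
    ((hR I).smul analyticAt_const).sub (Finset.analyticAt_fun_sum _ fun s _ =>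
      (hR _).smul analyticAt_const)
  have hYker : ∀ j, ∀ᶠ Z' in 𝓝 Z, ∀ i, f i Z' (Y j Z') = 0 := by
    intro j
    refine eventually_all.2 fun i => ?_
    refine eventually_eq_zero_of_mul hh (analyticAt_clm_apply (hf i) (hYa j)) hh0 ?_
    filter_upwards [hfac] with Z' hZ'
    have := cramer_annihilates b (fun i => f i Z') I j i
    simp only [hZ'] at this
    rw [← smul_eq_mul, ← map_smul, ← this]
    congr 1
    simp only [Y, smul_sub, smul_smul, Finset.smul_sum]
  have hmem : ∀ j, Y j Z ∈ kernelValues f Z := fun j => ⟨Y j, hYa j, hYker j, rfl⟩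
  let S : Submodule ℂ L := Submodule.span ℂ (range fun s => b (I s))
  have htop : kernelValues f Z ⊔ S = ⊤ := by
    rw [eq_top_iff, ← b.span_eq, Submodule.span_le]
    rintro _ ⟨j, rfl⟩
    have h1 : R I Z • b j = Y j Z + ∑ s, R (Function.update I s j) Z • b (I s) := by
      simp [Y]
    have h2 : R I Z • b j ∈ kernelValues f Z ⊔ S := by
      rw [h1]
      refine add_mem (Submodule.mem_sup_left (hmem j)) (Submodule.mem_sup_right ?_)
      exact Submodule.sum_mem _ fun s _ => Submodule.smul_mem _ _
        (Submodule.subset_span ⟨s, rfl⟩)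
    have h3 := Submodule.smul_mem _ (R I Z)⁻¹ h2
    rwa [smul_smul, inv_mul_cancel₀ hI, one_smul] at h3
  have hS : Module.finrank ℂ S ≤ r := by
    have := finrank_range_le_card (R := ℂ) (fun s => b (I s))
    rwa [Fintype.card_fin] at this
  have h4 := Submodule.finrank_add_le_finrank_add_finrank (kernelValues f Z) S
  rw [htop, finrank_top, Module.finrank_eq_card_basis b, Fintype.card_fin] at h4
  omega

/-- If the kernel has the expected dimension, the minors are, up to a common factor, without common
zeros. -/
theorem exists_factor_of_finrank_kernelValues (hf : ∀ i, AnalyticAt ℂ (f i) Z)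
    (hdim : Module.finrank ℂ (kernelValues f Z) + r = n) :
    ∃ (h : L → ℂ) (R : (Fin r → Fin n) → L → ℂ), AnalyticAt ℂ h Z ∧
      (∀ I, AnalyticAt ℂ (R I) Z) ∧
      (∀ᶠ Z' in 𝓝 Z, ∀ I, (minorMatrix b (fun i => f i Z') I).det = h Z' * R I Z') ∧
      ∃ I, R I Z ≠ 0 := by
  let K := kernelValues f Z
  have hdim' : Module.finrank ℂ K + r = n := hdim
  let B := Module.finBasis ℂ K
  have hB : ∀ j, ∃ Y : L → L, AnalyticAt ℂ Y Z ∧ (∀ᶠ Z' in 𝓝 Z, ∀ a, f a Z' (Y Z') = 0) ∧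
      Y Z = B j := fun j => (B j).2
  choose Y hY hY0 hYB using hB
  obtain ⟨C, hKC⟩ := K.exists_isCompl
  have hC : Module.finrank ℂ C = r := by
    have := Submodule.finrank_add_eq_of_isCompl hKC
    rw [Module.finrank_eq_card_basis b, Fintype.card_fin] at this
    omega
  let c := Module.finBasisOfFinrankEq ℂ C hC
  let prK : L →ₗ[ℂ] K := K.projectionOnto C hKC
  let prC : L →ₗ[ℂ] C := C.projectionOnto K hKC.symm
  have hpr : ∀ v, (prK v : L) + prC v = v := fun v => by
    exact Submodule.projection_add_projection_eq_self hKC v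
  let β : Fin (Module.finrank ℂ K) → (L →L[ℂ] ℂ) := fun j =>
    LinearMap.toContinuousLinearMap ((B.coord j).comp prK)
  let γ : Fin r → (L →L[ℂ] ℂ) := fun s => LinearMap.toContinuousLinearMap ((c.coord s).comp prC)
  have hβ : ∀ v, ∑ j, β j v • Y j Z = prK v := fun v => by
    simp only [hYB]
    conv_rhs => rw [← B.sum_repr (prK v)]
    rw [Submodule.coe_sum]
    rfl
  have hγ : ∀ v, ∑ s, γ s v • (c s : L) = prC v := fun v => by
    conv_rhs => rw [← c.sum_repr (prC v)]
    rw [Submodule.coe_sum]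
    rfl
  -- Φ Z' is the identity at Z' = Z; in general it fixes the complement C and moves the basis Y j Z
  -- of the kernel values to Y j Z'. It is therefore an analytic frame adapted to the annihilated
  -- fields.
  let Φ : L → (L →L[ℂ] L) := fun Z' =>
    1 + ∑ j, (β j).smulRight (Y j Z' - Y j Z)
  have hΦa : AnalyticAt ℂ Φ Z := by
    refine analyticAt_const.add (Finset.analyticAt_fun_sum _ fun j _ => ?_)
    exact AnalyticAt.fun_comp (g := fun y => (β j).smulRight y)
      ((ContinuousLinearMap.smulRightL ℂ L L (β j)).analyticAt _) ((hY j).sub analyticAt_const)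
  have hΦZ : Φ Z = 1 := by simp [Φ]
  have hΦ : ∀ Z' v, Φ Z' v = prC v + ∑ j, β j v • Y j Z' := by
    intro Z' v
    have h1 := hpr v
    have h2 := hβ v
    simp only [Φ, add_apply, one_apply_eq_self,
      sum_apply, ContinuousLinearMap.smulRight_apply, smul_sub,
      Finset.sum_sub_distrib, h2]
    nth_rw 1 [← h1]
    abel
  have hinv : AnalyticAt ℂ (fun Z' => Ring.inverse (Φ Z')) Z := by
    refine AnalyticAt.fun_comp (g := Ring.inverse) ?_ hΦa
    rw [hΦZ]
    exact analyticAt_inverse (1 : (L →L[ℂ] L)ˣ)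
  have hunit : ∀ᶠ Z' in 𝓝 Z, IsUnit (Φ Z') :=
    hΦa.continuousAt.eventually (Units.isOpen.mem_nhds (by rw [hΦZ]; exact isUnit_one))
  -- In the moving frame the forms vanish on the Y j, so each is a combination of the r functionals
  -- g s with coefficient matrix A. All minors acquire the common factor det A, and the remaining
  -- minors are those of g, which is independent at Z.
  let A : L → Matrix (Fin r) (Fin r) ℂ := fun Z' => Matrix.of fun i s => f i Z' (c s)
  let g : Fin r → L → (L →L[ℂ] ℂ) := fun s Z' => (γ s).comp (Ring.inverse (Φ Z'))
  have hga : ∀ s, AnalyticAt ℂ (g s) Z := fun s =>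
    AnalyticAt.fun_comp (g := fun y => (γ s).comp y)
      ((ContinuousLinearMap.compL ℂ L L ℂ (γ s)).analyticAt _) hinv
  refine ⟨fun Z' => (A Z').det, fun I Z' => (minorMatrix b (fun s => g s Z') I).det, ?_,
    fun I => analyticAt_minor b hga I, ?_, ?_⟩
  · simp only [Matrix.det_apply', A, Matrix.of_apply]
    refine Finset.analyticAt_fun_sum _ fun σ _ => analyticAt_const.mul ?_
    refine Finset.analyticAt_fun_prod _ fun i _ => ?_
    exact ((ContinuousLinearMap.apply ℂ ℂ (c i : L)).analyticAt _).comp (hf (σ i))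
  · filter_upwards [hunit, eventually_all.2 hY0] with Z' hu hker I
    rw [← Matrix.det_mul]
    congr 1
    ext i j
    simp only [minorMatrix, Matrix.of_apply, Matrix.mul_apply, A, g]
    have h1 : Φ Z' (Ring.inverse (Φ Z') (b (I j))) = b (I j) := by
      have := congrArg (fun T : L →L[ℂ] L => T (b (I j))) (Ring.mul_inverse_cancel (Φ Z') hu)
      simpa using this
    set w := Ring.inverse (Φ Z') (b (I j)) with hw
    have h2 : f i Z' (b (I j)) = f i Z' (prC w) := by
      rw [← h1, hΦ, map_add, map_sum]
      simp [hker]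
    rw [h2, ← hγ w, map_sum]
    refine Finset.sum_congr rfl fun s _ => ?_
    rw [map_smul, smul_eq_mul, mul_comm]
    rfl
  · have hgZ : (fun s => g s Z) = γ := by
      funext s
      simp only [g, hΦZ, Ring.inverse_one]
      rfl
    change ∃ I, (minorMatrix b (fun s => g s Z) I).det ≠ 0
    rw [hgZ]
    refine exists_minor_ne_zero b ?_
    rw [Fintype.linearIndependent_iff]
    intro a ha t
    have := congrArg (fun T : L →L[ℂ] ℂ => T (c t)) ha
    have hpc : prC (c t) = c t := Submodule.projectionOnto_apply_left hKC.symm (c t)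
    simpa [γ, hpc, Finsupp.single_apply] using this

end FiniteFamily

/-- The dimension of the space of values of the vector fields annihilated by a family of
holomorphic one-forms is constant outside of a nowhere dense complex-analytic set, where it drops. -/
theorem exists_equations_finrank_kernelValues [FiniteDimensional ℂ L] {θ : ι → L → (L →L[ℂ] ℂ)} {W : Set L}
    (hWo : IsOpen W) (hWc : IsPreconnected W) (hθ : ∀ a, AnalyticOnNhd ℂ (θ a) W) {p : L}
    (hp : p ∈ W) :
    ∃ (l k : ℕ) (U : Set L) (Q : Fin k → L → ℂ), IsOpen U ∧ p ∈ U ∧ U ⊆ W ∧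
      (∀ i, AnalyticOnNhd ℂ (Q i) U) ∧ (∀ x ∈ U, ∃ᶠ y in 𝓝 x, ∃ i, Q i y ≠ 0) ∧
      ∀ q ∈ U, Module.finrank ℂ (kernelValues θ q) ≤ l ∧
        (Module.finrank ℂ (kernelValues θ q) = l ↔ ∃ i, Q i q ≠ 0) := by
  classical
  let n := Module.finrank ℂ L
  let b : Module.Basis (Fin n) ℂ L := Module.finBasis ℂ L
  -- The maximum r of this set is the generic rank: the largest number of forms independent at some
  -- point of W.
  let S : Set ℕ := {r | ∃ (a : Fin r → ι) (Z : L), Z ∈ W ∧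
    LinearIndependent ℂ (fun i => θ (a i) Z)}
  have hS0 : 0 ∈ S := ⟨Fin.elim0, p, hp, linearIndependent_empty_type⟩
  have hSb : BddAbove S := by
    refine ⟨Module.finrank ℂ (L →L[ℂ] ℂ), ?_⟩
    rintro r ⟨a, Z, _, hli⟩
    simpa using hli.fintype_card_le_finrank
  obtain ⟨r, hrS, hrmax⟩ : ∃ r ∈ S, ∀ s ∈ S, s ≤ r :=
    ⟨sSup S, Nat.sSup_mem ⟨0, hS0⟩ hSb, fun s hs => le_csSup hSb hs⟩
  obtain ⟨a, Z₁, hZ₁, hli⟩ := hrS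
  let f : Fin r → L → (L →L[ℂ] ℂ) := fun i => θ (a i)
  have hf : ∀ i, AnalyticOnNhd ℂ (f i) W := fun i => hθ (a i)
  let P : (Fin r → Fin n) → L → ℂ := fun I Z => (minorMatrix b (fun i => f i Z) I).det
  have hP : ∀ I, AnalyticOnNhd ℂ (P I) W := fun I Z hZ => analyticAt_minor b (fun i => hf i Z hZ) I
  obtain ⟨I₀, hI₀⟩ := exists_minor_ne_zero b hli
  have hfreq : ∀ Z ∈ W, ∃ᶠ Z' in 𝓝 Z, P I₀ Z' ≠ 0 := fun Z hZ =>
    frequently_ne_zero_of_ne hWc (hP I₀) hZ₁ hI₀ hZ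
  have hdep : ∀ Z ∈ W, P I₀ Z ≠ 0 → ∀ c, θ c Z ∈ Submodule.span ℂ (range fun i => f i Z) := by
    intro Z hZ hPZ c
    by_contra hc
    have hli' : LinearIndependent ℂ (Fin.cons (θ c Z) (fun i => f i Z) : Fin (r + 1) → _) :=
      linearIndependent_finCons.2 ⟨linearIndependent_of_minor_ne_zero b hPZ, hc⟩
    have : r + 1 ∈ S := by
      refine ⟨Fin.cons c a, Z, hZ, ?_⟩
      convert! hli' using 1
      funext i
      refine Fin.cases ?_ (fun i => ?_) i <;> simp [f]
    exact absurd (hrmax _ this) (by omega)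
  -- Where the minor P I₀ is nonzero the r chosen forms span all others. Such points are dense, so
  -- by continuity annihilation by these r forms implies annihilation by the whole family.
  have hkv : ∀ Z ∈ W, kernelValues θ Z = kernelValues f Z := by
    intro Z hZ
    ext v
    constructor
    · rintro ⟨Y, hY, hY0, hv⟩
      exact ⟨Y, hY, hY0.mono fun Z' h i => h (a i), hv⟩
    · rintro ⟨Y, hY, hY0, hv⟩
      refine ⟨Y, hY, ?_, hv⟩
      filter_upwards [hY.eventually_analyticAt, hY0.eventually_nhds, hWo.mem_nhds hZ]
        with Z' hYZ' hY0' hZ'W c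
      by_contra hne
      have hc := (analyticAt_clm_apply (hθ c Z' hZ'W) hYZ').continuousAt.eventually_ne hne
      obtain ⟨Z'', hP'', hc'', hY'', hW''⟩ := ((hfreq Z' hZ'W).and_eventually
        (hc.and (hY0'.and (hWo.eventually_mem hZ'W)))).exists
      refine hc'' ?_
      have hspan := hdep Z'' hW'' hP'' c
      refine Submodule.span_induction (p := fun g _ => g (Y Z'') = 0) ?_ (by simp)
        (fun x y _ _ hx hy => by simp [hx, hy]) (fun c x _ hx => by simp [hx]) hspan
      rintro _ ⟨i, rfl⟩
      exact hY'' i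
  have hrn : r ≤ n := by
    have := finrank_kernelValues_le b (f := f) ((hfreq p hp).mono fun Z' h => ⟨I₀, h⟩)
    omega
  obtain ⟨U, Q, hUo, hpU, hQ, hQfr, hiff⟩ := exists_indeterminacy_equations
    (P := P) (fun I => hP I p hp) ⟨I₀, hfreq p hp⟩
  let e := Fintype.equivFin (Fin r → Fin n)
  refine ⟨n - r, _, U ∩ W, fun i => Q (e.symm i), hUo.inter hWo, ⟨hpU, hp⟩, inter_subset_right,
    fun i x hx => hQ _ x hx.1, fun x hx => ?_, fun q hq => ?_⟩
  · refine (hQfr x hx.1).mono fun y hy => ?_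
    obtain ⟨I, hI⟩ := hy
    exact ⟨e I, by simpa using hI⟩
  · have hmin : ∃ᶠ Z' in 𝓝 q, ∃ I, (minorMatrix b (fun i => f i Z') I).det ≠ 0 :=
      (hfreq q hq.2).mono fun Z' h => ⟨I₀, h⟩
    have hle := finrank_kernelValues_le b hmin
    rw [hkv q hq.2]
    refine ⟨by omega, ?_⟩
    have hex : (∃ i, Q (e.symm i) q ≠ 0) ↔ ∃ I, Q I q ≠ 0 :=
      e.symm.surjective.exists (p := fun I => Q I q ≠ 0) |>.symm
    rw [hex, hiff q hq.1]
    constructor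
    · intro hdim
      exact exists_factor_of_finrank_kernelValues b (fun i => hf i q hq.2) (by omega)
    · rintro ⟨h, R, hh, hR, hfac, I, hI⟩
      have := le_finrank_kernelValues_of_factor b (fun i => hf i q hq.2) hh hR hfac hmin hI
      omega

end KernelValues

end CRGeom

namespace CRGeom

/-! ### Complexification of real-analytic maps and uniqueness at real points. -/

section Complexification

variable {F : Type*} [NormedAddCommGroup F] [NormedSpace ℂ F]

/-- The inclusion of `ℝ ^ m` into `ℂ ^ m`. -/
noncomputable def toComplex (m : ℕ) : (Fin m → ℝ) →L[ℝ] (Fin m → ℂ) :=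
  ContinuousLinearMap.pi fun i => Complex.ofRealCLM.comp (ContinuousLinearMap.proj i)

@[simp] theorem toComplex_apply {m : ℕ} (x : Fin m → ℝ) (i : Fin m) :
    toComplex m x i = (x i : ℂ) := rfl

/-- The complex-multilinear extension of a real-multilinear map on `ℝ ^ m`. -/
noncomputable def complexifyMultilinear {m n : ℕ}
    (p : ContinuousMultilinearMap ℝ (fun _ : Fin n => (Fin m → ℝ)) F) :
    ContinuousMultilinearMap ℂ (fun _ : Fin n => (Fin m → ℂ)) F :=
  ∑ s : Fin n → Fin m, ((ContinuousMultilinearMap.mkPiAlgebra ℂ (Fin n) ℂ).compContinuousLinearMap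
    fun j => ContinuousLinearMap.proj (R := ℂ) (φ := fun _ : Fin m => ℂ) (s j)).smulRight
      (p fun j => Pi.single (s j) 1)

theorem complexifyMultilinear_apply {m n : ℕ}
    (p : ContinuousMultilinearMap ℝ (fun _ : Fin n => (Fin m → ℝ)) F) (v : Fin n → Fin m → ℂ) :
    complexifyMultilinear p v =
      ∑ s : Fin n → Fin m, (∏ j, v j (s j)) • p fun j => Pi.single (s j) 1 := by
  simp [complexifyMultilinear]

theorem complexifyMultilinear_toComplex {m n : ℕ}
    (p : ContinuousMultilinearMap ℝ (fun _ : Fin n => (Fin m → ℝ)) F) (x : Fin m → ℝ) :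
    complexifyMultilinear p (fun _ => toComplex m x) = p fun _ => x := by
  classical
  rw [complexifyMultilinear_apply]
  have hx : x = ∑ i, x i • (Pi.single i 1 : Fin m → ℝ) := by
    funext j
    simp [Pi.single_apply]
  conv_rhs => rw [hx]
  rw [ContinuousMultilinearMap.map_sum]
  refine Finset.sum_congr rfl fun s _ => ?_
  rw [ContinuousMultilinearMap.map_smul_univ, ← Complex.coe_smul]
  simp

theorem norm_complexifyMultilinear_le {m n : ℕ}
    (p : ContinuousMultilinearMap ℝ (fun _ : Fin n => (Fin m → ℝ)) F) :
    ‖complexifyMultilinear p‖ ≤ (m : ℝ) ^ n * ‖p‖ := by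
  refine ContinuousMultilinearMap.opNorm_le_bound (by positivity) fun v => ?_
  rw [complexifyMultilinear_apply]
  refine (norm_sum_le _ _).trans ?_
  have : ∀ s ∈ (Finset.univ : Finset (Fin n → Fin m)),
      ‖(∏ j, v j (s j)) • p fun j => (Pi.single (s j) 1 : Fin m → ℝ)‖ ≤ (∏ j, ‖v j‖) * ‖p‖ := by
    intro s _
    rw [norm_smul, norm_prod]
    gcongr with j _
    · exact norm_le_pi_norm (v j) (s j)
    · refine (p.le_opNorm _).trans (le_of_eq ?_)
      rw [Finset.prod_eq_one fun j _ => ?_, mul_one]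
      rw [Pi.norm_single, norm_one]
  refine (Finset.sum_le_sum this).trans ?_
  simp only [Finset.sum_const, Finset.card_univ, Fintype.card_fun, Fintype.card_fin, nsmul_eq_mul,
    Nat.cast_pow]
  exact le_of_eq (by ring)

variable [CompleteSpace F]

/-- A real-analytic function extends to a holomorphic function. -/
theorem exists_complexification {m : ℕ} {f : (Fin m → ℝ) → F} (hf : AnalyticAt ℝ f 0) :
    ∃ g : (Fin m → ℂ) → F, AnalyticAt ℂ g 0 ∧ ∀ᶠ x in 𝓝 0, g (toComplex m x) = f x := by
  obtain ⟨p, r, hp⟩ := hf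
  let q : FormalMultilinearSeries ℂ (Fin m → ℂ) F := fun n => complexifyMultilinear (p n)
  obtain ⟨s, hs0, hs⟩ := ENNReal.lt_iff_exists_nnreal_btwn.1 (hp.r_pos.trans_le hp.r_le)
  have hs0' : 0 < s := by exact_mod_cast hs0
  obtain ⟨C, hC0, hC⟩ := p.norm_mul_pow_le_of_lt_radius hs
  have hq : 0 < q.radius := by
    -- Passing to the complexification costs a factor m^n in degree n, hence a factor m in the
    -- radius; m + 1 also covers m = 0.
    refine lt_of_lt_of_le ?_ (q.le_radius_of_bound (r := s / (m + 1)) C fun n => ?_)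
    · simp only [ENNReal.coe_pos]; positivity
    · refine le_trans ?_ (hC n)
      push_cast
      calc ‖q n‖ * (s / (m + 1) : ℝ) ^ n ≤ ((m + 1 : ℝ) ^ n * ‖p n‖) * (s / (m + 1) : ℝ) ^ n := by
            gcongr
            refine (norm_complexifyMultilinear_le (p n)).trans ?_
            gcongr
            linarith
        _ = ‖p n‖ * (s : ℝ) ^ n := by
            rw [div_pow]; field_simp
  refine ⟨q.sum, (q.hasFPowerSeriesOnBall hq).analyticAt, ?_⟩
  have h1 : ∀ᶠ x in 𝓝 (0 : Fin m → ℝ), x ∈ Metric.eball (0 : Fin m → ℝ) r :=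
    Metric.eball_mem_nhds _ hp.r_pos
  have h2 : ∀ᶠ x in 𝓝 (0 : Fin m → ℝ), toComplex m x ∈ Metric.eball (0 : Fin m → ℂ) q.radius := by
    refine (toComplex m).continuous.continuousAt.eventually ?_
    rw [map_zero]
    exact Metric.eball_mem_nhds _ hq
  filter_upwards [h1, h2] with x hx1 hx2
  have e1 := hp.hasSum hx1
  have e2 := (q.hasFPowerSeriesOnBall hq).hasSum hx2
  rw [zero_add] at e1 e2
  refine e2.unique ?_
  convert! e1 using 2 with n
  exact complexifyMultilinear_toComplex (p n) x

/-- A holomorphic function that vanishes at the real points vanishes. -/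
theorem eventually_eq_zero_of_toComplex {m : ℕ} {g : (Fin m → ℂ) → F} {a : Fin m → ℝ}
    (hg : AnalyticAt ℂ g (toComplex m a)) (h0 : ∀ᶠ x in 𝓝 a, g (toComplex m x) = 0) :
    ∀ᶠ z in 𝓝 (toComplex m a), g z = 0 := by
  obtain ⟨δ, hδ, hgδ⟩ := Metric.eventually_nhds_iff_ball.1 hg.eventually_analyticAt
  obtain ⟨ε, hε, h0ε⟩ := Metric.eventually_nhds_iff_ball.1 h0
  filter_upwards [Metric.ball_mem_nhds _ (lt_min hδ hε)] with z hz
  let x : Fin m → ℝ := fun i => (z i).re - a i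
  let y : Fin m → ℝ := fun i => (z i).im
  -- With a + x and y the real and imaginary parts of z, this complex line is real at real
  -- parameters and passes through z at the parameter i. The one-variable identity theorem along it
  -- gives g z = 0.
  let ℓ : ℂ → (Fin m → ℂ) := fun ζ => toComplex m (a + x) + ζ • toComplex m y
  have hℓI : ℓ Complex.I = z := by
    funext i
    simp only [ℓ, x, y, Pi.add_apply, toComplex_apply, Pi.smul_apply, smul_eq_mul,
      add_sub_cancel]
    rw [mul_comm]
    exact Complex.re_add_im (z i)
  have hx : ‖x‖ < min δ ε := by
    refine lt_of_le_of_lt ?_ (mem_ball_iff_norm.1 hz)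
    refine (pi_norm_le_iff_of_nonneg (norm_nonneg _)).2 fun i => ?_
    refine le_trans ?_ (norm_le_pi_norm _ i)
    have := Complex.abs_re_le_norm ((z - toComplex m a) i)
    simpa [x] using this
  have hnorm : ∀ v : Fin m → ℝ, ‖toComplex m v‖ = ‖v‖ := fun v => by
    simp [Pi.norm_def]
  have hℓ0 : ℓ 0 ∈ Metric.ball (toComplex m a) δ := by
    rw [mem_ball_iff_norm]
    simp only [ℓ, zero_smul, add_zero, map_add, add_sub_cancel_left, hnorm]
    exact hx.trans_le (min_le_left _ _)
  have hℓI' : ℓ Complex.I ∈ Metric.ball (toComplex m a) δ := by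
    rw [hℓI]; exact Metric.ball_subset_ball (min_le_left _ _) hz
  have hℓa : ∀ ζ, AnalyticAt ℂ ℓ ζ := fun ζ =>
    analyticAt_const.add (analyticAt_id.smul analyticAt_const)
  let D : Set ℂ := ℓ ⁻¹' Metric.ball (toComplex m a) δ
  have hDc : Convex ℝ D := convex_line_preimage (convex_ball _ _) _ _
  have hDa : AnalyticOnNhd ℂ (fun ζ => g (ℓ ζ)) D := fun ζ hζ =>
    (hgδ _ hζ).fun_comp (hℓa ζ)
  have hfreq : ∃ᶠ ζ in 𝓝[≠] (0 : ℂ), g (ℓ ζ) = 0 := by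
    have hev : ∀ᶠ t : ℝ in 𝓝 0, g (ℓ t) = 0 := by
      have hc : Continuous fun t : ℝ => a + x + t • y := by fun_prop
      have : ∀ᶠ t : ℝ in 𝓝 0, a + x + t • y ∈ Metric.ball a ε := by
        refine hc.continuousAt.eventually (Metric.isOpen_ball.mem_nhds ?_)
        rw [mem_ball_iff_norm]
        simpa using hx.trans_le (min_le_right _ _)
      filter_upwards [this] with t ht
      have e := h0ε _ ht
      have : toComplex m (a + x + t • y) = ℓ t := by
        simp only [ℓ, map_add, map_smul, Complex.coe_smul]
      rwa [this] at e
    have h1 : ∃ᶠ t : ℝ in 𝓝[≠] 0, g (ℓ t) = 0 := (hev.filter_mono nhdsWithin_le_nhds).frequently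
    have h2 : Tendsto (fun t : ℝ => (t : ℂ)) (𝓝[≠] 0) (𝓝[≠] 0) := by
      refine tendsto_nhdsWithin_iff.2 ⟨?_, ?_⟩
      · exact (Complex.continuous_ofReal.tendsto' 0 0 Complex.ofReal_zero).mono_left
          nhdsWithin_le_nhds
      · filter_upwards [self_mem_nhdsWithin] with t ht
        simpa using ht
    exact h2.frequently h1
  have := hDa.eqOn_zero_of_preconnected_of_frequently_eq_zero hDc.isPreconnected hℓ0 hfreq hℓI'
  simpa [hℓI] using this

end Complexification

end CRGeom

namespace CRGeom

/-! ### The analytic inverse function theorem. -/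

section InverseFunction

variable {𝕜 : Type*} [RCLike 𝕜] {V F : Type*} [NormedAddCommGroup V] [NormedSpace 𝕜 V]
  [NormedAddCommGroup F] [NormedSpace 𝕜 F]

/-- The analytic inverse function theorem. -/
theorem exists_openPartialHomeomorph_of_bijective [CompleteSpace V] [CompleteSpace F] {f : V → F}
    {a : V} (hf : AnalyticAt 𝕜 f a) (hb : Function.Bijective (fderiv 𝕜 f a)) :
    ∃ H : OpenPartialHomeomorph V F, a ∈ H.source ∧ ⇑H = f ∧ AnalyticAt 𝕜 H.symm (f a) := by
  let e : V ≃L[𝕜] F := ContinuousLinearEquiv.ofBijective (fderiv 𝕜 f a)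
    (LinearMap.ker_eq_bot.2 hb.1) (LinearMap.range_eq_top.2 hb.2)
  have he : (e : V →L[𝕜] F) = fderiv 𝕜 f a := by ext; rfl
  have hs : HasStrictFDerivAt f (e : V →L[𝕜] F) a := by rw [he]; exact hf.hasStrictFDerivAt
  have hcoe : ⇑(hs.toOpenPartialHomeomorph f) = f := hs.toOpenPartialHomeomorph_coe
  refine ⟨hs.toOpenPartialHomeomorph f, hs.mem_toOpenPartialHomeomorph_source, hcoe, ?_⟩
  have := (hs.toOpenPartialHomeomorph f).analyticAt_symm' (i := e)
    hs.mem_toOpenPartialHomeomorph_source (by rw [hcoe]; exact hf) (by rw [hcoe, he])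
  rwa [hcoe] at this

/-- A surjective linear map is completed to an isomorphism by finitely many coordinates. -/
theorem exists_bijective_prod [FiniteDimensional 𝕜 V] (A : V →L[𝕜] F)
    (hA : Function.Surjective A) :
    ∃ (m : ℕ) (κ : V →L[𝕜] (Fin m → 𝕜)), Function.Bijective (A.prod κ) := by
  let K : Submodule 𝕜 V := LinearMap.ker A.toLinearMap
  obtain ⟨C, hKC⟩ := K.exists_isCompl
  let e : K ≃ₗ[𝕜] (Fin (Module.finrank 𝕜 K) → 𝕜) := (Module.finBasis 𝕜 K).equivFun
  let κ : V →L[𝕜] (Fin (Module.finrank 𝕜 K) → 𝕜) :=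
    LinearMap.toContinuousLinearMap (e.toLinearMap.comp (K.projectionOnto C hKC))
  have hκ : ∀ x, κ x = e (K.projectionOnto C hKC x) := fun x => rfl
  have hκK : ∀ x : K, κ x = e x := fun x => by rw [hκ, Submodule.projectionOnto_apply_left]
  refine ⟨_, κ, ?_, ?_⟩
  · refine (injective_iff_map_eq_zero _).2 fun x hx => ?_
    obtain ⟨h1, h2⟩ := Prod.ext_iff.1 hx
    have hxK : x ∈ K := h1
    have h3 : e ⟨x, hxK⟩ = 0 := by rw [← hκK]; exact h2
    simpa using h3
  · rintro ⟨a, b⟩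
    obtain ⟨x, rfl⟩ := hA a
    refine ⟨x + (e.symm (b - κ x) : K), Prod.ext ?_ ?_⟩
    · simp
    · simp [hκK]

end InverseFunction

/-! ### Analytic parametrizations of M and its tangent spaces. -/

section Parametrization

variable {E : Type*} [NormedAddCommGroup E] [NormedSpace ℂ E]

/-- `φ` is a real-analytic parametrization of `M` near `p`, with inverse the restriction of an
affine map with linear part `κ`. -/
structure IsLocalParametrization (M : Set E) (p : E) {m : ℕ} (φ : (Fin m → ℝ) → E)
    (κ : E →L[ℝ] (Fin m → ℝ)) : Prop where
  analyticAt : AnalyticAt ℝ φ 0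
  map_zero : φ 0 = p
  mem : ∀ᶠ t in 𝓝 0, φ t ∈ M
  left_inv : ∀ᶠ t in 𝓝 0, κ (φ t - p) = t
  right_inv : ∀ᶠ q in 𝓝[M] p, φ (κ (q - p)) = q

theorem exists_isLocalParametrization [FiniteDimensional ℂ E] {d : ℕ} {M : Set E}
    (hM : IsRealAnalyticSubmanifold d M) {p : E} (hp : p ∈ M) :
    ∃ (m : ℕ) (φ : (Fin m → ℝ) → E) (κ : E →L[ℝ] (Fin m → ℝ)), IsLocalParametrization M p φ κ := by
  obtain ⟨U, hUo, hpU, ρ, hρ, hsurj, hMU⟩ := hM p hp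
  obtain ⟨m, κ, hκ⟩ := exists_bijective_prod (fderiv ℝ ρ p) (hsurj p hpU)
  have : CompleteSpace E := FiniteDimensional.complete ℂ E
  -- The defining function is completed by linear coordinates to a chart; φ is the restriction of
  -- the inverse chart to ρ = 0, which makes its left inverse affine.
  let Ψ : E → (Fin d → ℝ) × (Fin m → ℝ) := fun x => (ρ x, κ (x - p))
  have hΨ : AnalyticAt ℝ Ψ p := (hρ p hpU).prod
    ((κ.analyticAt _).fun_comp (analyticAt_id.sub analyticAt_const))
  have hd : fderiv ℝ Ψ p = (fderiv ℝ ρ p).prod κ := by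
    refine HasFDerivAt.fderiv ?_
    refine (hρ p hpU).differentiableAt.hasFDerivAt.prodMk ?_
    exact κ.hasFDerivAt.comp p ((hasFDerivAt_id p).sub_const p)
  obtain ⟨H, hpH, hHΨ, hHa⟩ := exists_openPartialHomeomorph_of_bijective hΨ (by rw [hd]; exact hκ)
  have hρp : ρ p = 0 := by
    have : p ∈ M ∩ U := ⟨hp, hpU⟩
    rw [hMU] at this
    exact this.2
  have hΨp : Ψ p = (0, 0) := by simp [Ψ, hρp]
  have hs0 : H.symm (0, 0) = p := by
    rw [← hΨp, ← hHΨ]; exact H.left_inv hpH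
  rw [hΨp] at hHa
  have hin : AnalyticAt ℝ (fun t : Fin m → ℝ => ((0 : Fin d → ℝ), t)) 0 :=
    analyticAt_const.prod analyticAt_id
  have hφ : AnalyticAt ℝ (fun t : Fin m → ℝ => H.symm (0, t)) 0 :=
    AnalyticAt.fun_comp (g := H.symm) hHa hin
  have htgt : ∀ᶠ t : Fin m → ℝ in 𝓝 0, ((0 : Fin d → ℝ), t) ∈ H.target := by
    refine hin.continuousAt.eventually (H.open_target.mem_nhds ?_)
    change ((0 : Fin d → ℝ), (0 : Fin m → ℝ)) ∈ H.target
    rw [← hΨp, ← hHΨ]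
    exact H.map_source hpH
  have hU : ∀ᶠ t : Fin m → ℝ in 𝓝 0, H.symm ((0 : Fin d → ℝ), t) ∈ U :=
    hφ.continuousAt.eventually (hUo.mem_nhds (show H.symm (0, 0) ∈ U by rwa [hs0]))
  refine ⟨m, fun t => H.symm (0, t), κ, hφ, hs0, ?_, ?_, ?_⟩
  · filter_upwards [htgt, hU] with t ht htU
    have h1 := H.right_inv ht
    rw [hHΨ] at h1
    have h2 : H.symm (0, t) ∈ M ∩ U := by rw [hMU]; exact ⟨htU, (Prod.ext_iff.1 h1).1⟩
    exact h2.1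
  · filter_upwards [htgt] with t ht
    have h1 := H.right_inv ht
    rw [hHΨ] at h1
    exact (Prod.ext_iff.1 h1).2
  · filter_upwards [self_mem_nhdsWithin, mem_nhdsWithin_of_mem_nhds (hUo.mem_nhds hpU),
      mem_nhdsWithin_of_mem_nhds (H.open_source.mem_nhds hpH)] with q hqM hqU hqH
    have h0 : ρ q = 0 := by
      have : q ∈ M ∩ U := ⟨hqM, hqU⟩
      rw [hMU] at this
      exact this.2
    have h1 := H.left_inv hqH
    rw [hHΨ] at h1
    simpa [Ψ, h0] using h1

namespace IsLocalParametrization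

variable {M : Set E} {p : E} {m : ℕ} {φ : (Fin m → ℝ) → E} {κ : E →L[ℝ] (Fin m → ℝ)}

theorem tendsto (h : IsLocalParametrization M p φ κ) : Tendsto φ (𝓝 0) (𝓝[M] p) := by
  refine tendsto_nhdsWithin_iff.2 ⟨?_, h.mem⟩
  have := h.analyticAt.continuousAt.tendsto
  rwa [h.map_zero] at this

theorem eventually_right_inv (h : IsLocalParametrization M p φ κ) :
    ∀ᶠ t in 𝓝 0, ∀ᶠ q in 𝓝[M] (φ t), φ (κ (q - p)) = q :=
  h.tendsto.eventually (eventually_eventually_nhdsWithin.2 h.right_inv)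

variable [CompleteSpace E]

/-- This turns statements about germs of M at points near p into statements about germs in the
parameter space; the continuous inverse q ↦ κ (q - p) gives the nontrivial inclusion. -/
theorem eventually_nhdsWithin_eq_map (h : IsLocalParametrization M p φ κ) :
    ∀ᶠ t in 𝓝 0, 𝓝[M] (φ t) = map φ (𝓝 t) := by
  filter_upwards [h.analyticAt.eventually_analyticAt, h.mem.eventually_nhds, h.left_inv,
    h.eventually_right_inv] with t hta htM htl htr
  refine le_antisymm (fun S hS => ?_)
    (tendsto_nhdsWithin_iff.2 ⟨hta.continuousAt.tendsto, htM⟩)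
  have hc : ContinuousAt (fun q => κ (q - p)) (φ t) := by fun_prop
  have hc' : Tendsto (fun q => κ (q - p)) (𝓝[M] (φ t)) (𝓝 t) := by
    have := hc.tendsto.mono_left (nhdsWithin_le_nhds (s := M))
    rwa [htl] at this
  filter_upwards [htr, hc'.eventually hS] with q h1 h2
  rwa [h1] at h2

theorem nhdsWithin_eq_map (h : IsLocalParametrization M p φ κ) : 𝓝[M] p = map φ (𝓝 0) := by
  have := h.eventually_nhdsWithin_eq_map.self_of_nhds
  rwa [h.map_zero] at this

theorem eventually_comp_fderiv (h : IsLocalParametrization M p φ κ) :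
    ∀ᶠ t in 𝓝 0, ∀ w, κ (fderiv ℝ φ t w) = w := by
  filter_upwards [h.analyticAt.eventually_analyticAt, h.left_inv.eventually_nhds] with t hta htl w
  have h1 : HasFDerivAt (fun t => κ (φ t - p)) (κ.comp (fderiv ℝ φ t)) t :=
    κ.hasFDerivAt.comp t (hta.differentiableAt.hasFDerivAt.sub_const p)
  have h2 : HasFDerivAt (fun t => κ (φ t - p)) (ContinuousLinearMap.id ℝ _) t :=
    (hasFDerivAt_id t).congr_of_eventuallyEq htl
  exact congrArg (fun T : (Fin m → ℝ) →L[ℝ] (Fin m → ℝ) => T w) (h1.unique h2)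

/-- Tangent vectors at φ t are the fixed vectors of Dφ(t) ∘ κ, a condition analytic in t. Necessity
comes from testing with the functionals of φ (κ (q - p)) - q, which vanish on M. -/
theorem eventually_mem_realTangentSpace_iff (h : IsLocalParametrization M p φ κ) :
    ∀ᶠ t in 𝓝 0, ∀ v, v ∈ realTangentSpace M (φ t) ↔ fderiv ℝ φ t (κ v) = v := by
  filter_upwards [h.analyticAt.eventually_analyticAt, h.left_inv, h.eventually_right_inv,
    h.eventually_nhdsWithin_eq_map] with t hta htl htr htn v
  constructor
  · intro hv
    rw [← sub_eq_zero]
    refine SeparatingDual.eq_zero_of_forall_dual_eq_zero (R := ℝ) fun ℓ => ?_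
    have hg : HasFDerivAt (fun q => κ (q - p)) κ (φ t) :=
      κ.hasFDerivAt.comp (φ t) ((hasFDerivAt_id (φ t)).sub_const p)
    have hga : AnalyticAt ℝ (fun q => κ (q - p)) (φ t) :=
      (κ.analyticAt _).fun_comp (analyticAt_id.sub analyticAt_const)
    have hφa : AnalyticAt ℝ (fun q => φ (κ (q - p))) (φ t) :=
      AnalyticAt.fun_comp (g := φ) (by rw [htl]; exact hta) hga
    have hφd : HasFDerivAt (fun q => φ (κ (q - p))) ((fderiv ℝ φ t).comp κ) (φ t) :=
      HasFDerivAt.comp (φ t) (g := φ) (by rw [htl]; exact hta.differentiableAt.hasFDerivAt) hg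
    have hfa : AnalyticAt ℝ (fun q => ℓ (φ (κ (q - p)) - q)) (φ t) :=
      (ℓ.analyticAt _).fun_comp (hφa.sub analyticAt_id)
    have hfd : HasFDerivAt (fun q => ℓ (φ (κ (q - p)) - q))
        (ℓ.comp ((fderiv ℝ φ t).comp κ - ContinuousLinearMap.id ℝ E)) (φ t) :=
      ℓ.hasFDerivAt.comp (φ t) (hφd.sub (hasFDerivAt_id _))
    have := hv _ hfa (htr.mono fun q hq => by rw [hq, sub_self, _root_.map_zero])
    rw [hfd.fderiv] at this
    simpa using this
  · intro hv f hf hf0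
    rw [← hv]
    have h1 : HasFDerivAt (fun t => f (φ t)) ((fderiv ℝ f (φ t)).comp (fderiv ℝ φ t)) t :=
      hf.differentiableAt.hasFDerivAt.comp t hta.differentiableAt.hasFDerivAt
    rw [htn] at hf0
    have h2 : HasFDerivAt (fun t => f (φ t)) (0 : (Fin m → ℝ) →L[ℝ] ℝ) t :=
      (hasFDerivAt_const (0 : ℝ) t).congr_of_eventuallyEq hf0
    exact congrArg (fun T : (Fin m → ℝ) →L[ℝ] ℝ => T (κ v)) (h1.unique h2)

end IsLocalParametrization

end Parametrization

end CRGeom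

namespace CRGeom

/-! ### Constant rank at real points and factorization through a submersion. -/

section Factorization

variable {E : Type*} [NormedAddCommGroup E] [NormedSpace ℂ E]

theorem eq_toComplex_add_I_smul {m : ℕ} (z : Fin m → ℂ) :
    z = toComplex m (fun i => (z i).re) + Complex.I • toComplex m (fun i => (z i).im) := by
  funext i
  simp only [Pi.add_apply, toComplex_apply, Pi.smul_apply, smul_eq_mul]
  rw [mul_comm]
  exact (Complex.re_add_im (z i)).symm

theorem fderiv_toComplex {m : ℕ} {Φ : (Fin m → ℂ) → E} {φ : (Fin m → ℝ) → E} {t : Fin m → ℝ}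
    (hΦ : AnalyticAt ℂ Φ (toComplex m t)) (h : ∀ᶠ s in 𝓝 t, Φ (toComplex m s) = φ s)
    (w : Fin m → ℝ) : fderiv ℂ Φ (toComplex m t) (toComplex m w) = fderiv ℝ φ t w := by
  have h1 : HasFDerivAt (fun s => Φ (toComplex m s))
      (((fderiv ℂ Φ (toComplex m t)).restrictScalars ℝ).comp (toComplex m)) t :=
    (hΦ.differentiableAt.hasFDerivAt.restrictScalars ℝ).comp t (toComplex m).hasFDerivAt
  have h2 := (h1.congr_of_eventuallyEq (h.mono fun s hs => hs.symm)).fderiv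
  rw [h2]
  rfl

/-- The kernel of the complexification of an injective real-linear map has the dimension of the
largest complex subspace of the image. -/
theorem finrank_ker_complexification [FiniteDimensional ℂ E] {m : ℕ} {A : (Fin m → ℂ) →L[ℂ] E}
    {B : (Fin m → ℝ) →L[ℝ] E} {κ : E →L[ℝ] (Fin m → ℝ)} (hA : ∀ w, A (toComplex m w) = B w)
    (hκ : ∀ w, κ (B w) = w) {T : Submodule ℂ E}
    (hT : ∀ v, v ∈ T ↔ B (κ v) = v ∧ B (κ (Complex.I • v)) = Complex.I • v) :
    Module.finrank ℂ (LinearMap.ker A.toLinearMap) = Module.finrank ℂ T := by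
  have hB : Function.Injective B := Function.LeftInverse.injective hκ
  let im : (Fin m → ℂ) →ₗ[ℝ] (Fin m → ℝ) :=
    { toFun := fun z i => (z i).im
      map_add' := fun z w => by funext i; simp
      map_smul' := fun c z => by funext i; simp }
  have hker : ∀ z, A z = 0 → Complex.I • B (im z) = -B fun i => (z i).re := by
    intro z hz
    rw [eq_toComplex_add_I_smul z, map_add, map_smul, hA, hA] at hz
    exact (eq_neg_of_add_eq_zero_right hz)
  -- For z = x + iy in the kernel, B x + i B y = 0, so B y and i B y both lie in the image of B. The
  -- maps z ↦ B y and v ↦ -κ(iv) + iκ(v) are injective in opposite directions, and real dimensions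
  -- are twice the complex ones.
  let f : LinearMap.ker A.toLinearMap →ₗ[ℝ] T :=
    { toFun := fun z => ⟨B (im z), (hT _).2 ⟨by rw [hκ], by
        rw [hker z z.2, map_neg, hκ, map_neg]⟩⟩
      map_add' := fun z w => by ext; simp
      map_smul' := fun c z => by ext; simp }
  let g : T →ₗ[ℝ] LinearMap.ker A.toLinearMap :=
    { toFun := fun v => ⟨-toComplex m (κ (Complex.I • (v : E))) + Complex.I • toComplex m (κ v), by
        have := (hT v).1 v.2
        rw [LinearMap.mem_ker]
        change A _ = 0
        rw [map_add, map_neg, A.map_smul, hA, hA, this.1, this.2, neg_add_cancel]⟩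
      map_add' := fun v w => by
        ext1
        simp only [Submodule.coe_add, smul_add, map_add]
        abel
      map_smul' := fun c v => by
        ext1
        change -toComplex m (κ (Complex.I • (c • (v : E)))) +
          Complex.I • toComplex m (κ (c • (v : E))) = c • (-toComplex m (κ (Complex.I • (v : E))) +
            Complex.I • toComplex m (κ (v : E)))
        rw [smul_comm Complex.I c, κ.map_smul, κ.map_smul, (toComplex m).map_smul,
          (toComplex m).map_smul, smul_comm Complex.I c, smul_add, smul_neg] }
  have hf : Function.Injective f := by
    refine (injective_iff_map_eq_zero f).2 fun z hz => ?_
    have h1 : B (im z) = 0 := congrArg Subtype.val hz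
    have h2 : im z = 0 := hB (by rw [h1, map_zero])
    have h3 := hker z z.2
    rw [h1, smul_zero, eq_comm, neg_eq_zero] at h3
    have h4 := hB (h3.trans (map_zero B).symm)
    ext i
    refine Complex.ext (congrFun h4 i) (congrFun h2 i)
  have hg : Function.Injective g := by
    refine (injective_iff_map_eq_zero g).2 fun v hv => ?_
    have h1 : -toComplex m (κ (Complex.I • (v : E))) + Complex.I • toComplex m (κ v) = 0 :=
      congrArg Subtype.val hv
    have h2 : κ (v : E) = 0 := by
      funext i
      have := congrArg Complex.im (congrFun h1 i)
      simpa using this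
    have h3 := ((hT v).1 v.2).1
    rw [h2, map_zero] at h3
    exact Subtype.ext h3.symm
  have e1 := LinearMap.finrank_le_finrank_of_injective hf
  have e2 := LinearMap.finrank_le_finrank_of_injective hg
  rw [finrank_real_of_complex, finrank_real_of_complex] at e1 e2
  omega

/-- A holomorphic map whose rank is constant at the real points factors through a submersion. -/
theorem exists_factorization_of_finrank_ker [FiniteDimensional ℂ E] {m n : ℕ}
    {Φ : (Fin m → ℂ) → E} (hΦ : AnalyticAt ℂ Φ 0) (hn : ∀ᶠ t in 𝓝 (0 : Fin m → ℝ),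
      Module.finrank ℂ (LinearMap.ker (fderiv ℂ Φ (toComplex m t)).toLinearMap) = n) :
    ∃ (L : Submodule ℂ E) (k : ℕ) (π : E →L[ℂ] L) (κ : (Fin m → ℂ) →L[ℂ] (Fin k → ℂ))
      (σ : L × (Fin k → ℂ) → (Fin m → ℂ)) (G : L → E),
      AnalyticAt ℂ σ (π (Φ 0), 0) ∧
      (∀ᶠ z in 𝓝 (π (Φ 0), 0), π (Φ (σ z)) = z.1 ∧ κ (σ z) = z.2) ∧
      (∀ᶠ t in 𝓝 0, σ (π (Φ t), κ t) = t) ∧ AnalyticAt ℂ G (π (Φ 0)) ∧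
      (∀ᶠ Z in 𝓝 (π (Φ 0)), π (G Z) = Z) ∧ ∀ᶠ t in 𝓝 0, G (π (Φ t)) = Φ t := by
  have : CompleteSpace E := FiniteDimensional.complete ℂ E
  -- L is the image of the differential at 0. The projection of Φ to L, completed by linear
  -- coordinates κ, is a chart Ψ with inverse σ; the claim is that Φ ∘ σ does not depend on the
  -- κ-coordinates.
  let L : Submodule ℂ E := LinearMap.range (fderiv ℂ Φ 0).toLinearMap
  have : CompleteSpace L := FiniteDimensional.complete ℂ L
  obtain ⟨C, hLC⟩ := L.exists_isCompl
  let π : E →L[ℂ] L := LinearMap.toContinuousLinearMap (L.projectionOnto C hLC)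
  have hπL : ∀ v : L, π v = v := fun v => Submodule.projectionOnto_apply_left hLC v
  have hsurj : Function.Surjective (π.comp (fderiv ℂ Φ 0)) := by
    rintro ⟨_, w, rfl⟩
    exact ⟨w, hπL ⟨_, w, rfl⟩⟩
  obtain ⟨k, κ, hbij⟩ := exists_bijective_prod _ hsurj
  let Ψ : (Fin m → ℂ) → L × (Fin k → ℂ) := fun t => (π (Φ t), κ t)
  have hΨa : ∀ t, AnalyticAt ℂ Φ t → AnalyticAt ℂ Ψ t := fun t ht =>
    ((π.analyticAt _).fun_comp ht).prod (κ.analyticAt t)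
  have hΨd : ∀ t, AnalyticAt ℂ Φ t → HasFDerivAt Ψ ((π.comp (fderiv ℂ Φ t)).prod κ) t :=
    fun t ht => (π.hasFDerivAt.comp t ht.differentiableAt.hasFDerivAt).prodMk κ.hasFDerivAt
  obtain ⟨H, h0H, hHΨ, hHa⟩ := exists_openPartialHomeomorph_of_bijective (hΨa 0 hΦ)
    (by rw [(hΨd 0 hΦ).fderiv]; exact hbij)
  have hΨ0 : Ψ 0 = (π (Φ 0), 0) := by simp [Ψ]
  let σ := H.symm
  have hleft : ∀ᶠ t in 𝓝 (0 : Fin m → ℂ), σ (Ψ t) = t := by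
    filter_upwards [H.open_source.mem_nhds h0H] with t ht
    have := H.left_inv ht
    rwa [hHΨ] at this
  have hright : ∀ᶠ z in 𝓝 (Ψ 0), Ψ (σ z) = z := by
    have h0 : Ψ 0 ∈ H.target := by rw [← hHΨ]; exact H.map_source h0H
    filter_upwards [H.open_target.mem_nhds h0] with z hz
    have := H.right_inv hz
    rwa [hHΨ] at this
  have hσ0 : σ (Ψ 0) = 0 := hleft.self_of_nhds
  have hΨc : ContinuousAt Ψ 0 := (hΨa 0 hΦ).continuousAt
  have hσc : Tendsto σ (𝓝 (Ψ 0)) (𝓝 0) := by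
    have := hHa.continuousAt.tendsto
    rwa [show H.symm (Ψ 0) = 0 from hσ0] at this
  -- the derivative of `Φ ∘ σ` in the second variable
  let R : (Fin m → ℂ) → ((Fin k → ℂ) →L[ℂ] E) := fun t =>
    (fderiv ℂ Φ t).comp ((fderiv ℂ σ (Ψ t)).comp (ContinuousLinearMap.inr ℂ L (Fin k → ℂ)))
  have hRa : AnalyticAt ℂ R 0 := by
    have h1 : AnalyticAt ℂ (fun t => fderiv ℂ σ (Ψ t)) 0 :=
      AnalyticAt.fun_comp (g := fderiv ℂ σ) hHa.fderiv (hΨa 0 hΦ)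
    exact analyticAt_clm_comp hΦ.fderiv (analyticAt_clm_comp h1 analyticAt_const)
  have hinv : ∀ᶠ t in 𝓝 (0 : Fin m → ℂ), ∀ v, π (fderiv ℂ Φ t (fderiv ℂ σ (Ψ t) v)) = v.1 := by
    filter_upwards [hΦ.eventually_analyticAt, hleft, hΨc.eventually hright.eventually_nhds,
      hΨc.eventually hHa.eventually_analyticAt] with t ha hl hr hs v
    have h1 : HasFDerivAt (fun z => Ψ (σ z))
        (((π.comp (fderiv ℂ Φ t)).prod κ).comp (fderiv ℂ σ (Ψ t))) (Ψ t) :=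
      HasFDerivAt.comp (Ψ t) (g := Ψ) (by rw [hl]; exact hΨd t ha)
        hs.differentiableAt.hasFDerivAt
    have h2 : HasFDerivAt (fun z => Ψ (σ z)) (ContinuousLinearMap.id ℂ _) (Ψ t) :=
      (hasFDerivAt_id (Ψ t)).congr_of_eventuallyEq hr
    have h3 := congrArg (fun T : (L × (Fin k → ℂ)) →L[ℂ] (L × (Fin k → ℂ)) => (T v).1)
      (h1.unique h2)
    exact h3
  have hR0 : ∀ᶠ t in 𝓝 (0 : Fin m → ℝ), R (toComplex m t) = 0 := by
    have hc : Tendsto (toComplex m) (𝓝 0) (𝓝 0) := by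
      have := (toComplex m).continuous.tendsto 0
      rwa [map_zero] at this
    filter_upwards [hn, hc.eventually hinv] with t ht hit
    let A := fderiv ℂ Φ (toComplex m t)
    have ht' : Module.finrank ℂ (LinearMap.ker A.toLinearMap) = n := ht
    have hle : LinearMap.ker A.toLinearMap ≤ LinearMap.ker (π.comp A).toLinearMap := by
      intro z hz
      have hz' : A z = 0 := hz
      change π (A z) = 0
      rw [hz', map_zero]
    have hs : LinearMap.range (π.comp A).toLinearMap = ⊤ := by
      rw [LinearMap.range_eq_top]
      intro w
      exact ⟨_, hit (w, 0)⟩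
    have d1 := (π.comp A).toLinearMap.finrank_range_add_finrank_ker
    rw [hs, finrank_top] at d1
    have d2 := (fderiv ℂ Φ 0).toLinearMap.finrank_range_add_finrank_ker
    have d3 := hn.self_of_nhds
    rw [map_zero] at d3
    have d4 : Module.finrank ℂ L + Module.finrank ℂ
      (LinearMap.ker (fderiv ℂ Φ 0).toLinearMap) = Module.finrank ℂ (Fin m → ℂ) := d2
    have heq := Submodule.eq_of_le_of_finrank_eq hle (by omega)
    ext1 ξ
    have hmem : fderiv ℂ σ (Ψ (toComplex m t)) (0, ξ) ∈ LinearMap.ker (π.comp A).toLinearMap :=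
      hit (0, ξ)
    rw [← heq] at hmem
    exact hmem
  have hRz : ∀ᶠ t in 𝓝 (0 : Fin m → ℂ), R t = 0 := by
    have := eventually_eq_zero_of_toComplex (a := 0) (by rw [map_zero]; exact hRa) hR0
    rwa [map_zero] at this
  have hgood : ∀ᶠ z in 𝓝 (Ψ 0), AnalyticAt ℂ σ z ∧ AnalyticAt ℂ Φ (σ z) ∧ R (σ z) = 0 ∧
      Ψ (σ z) = z := by
    filter_upwards [hHa.eventually_analyticAt, hσc.eventually hΦ.eventually_analyticAt,
      hσc.eventually hRz, hright] with z h1 h2 h3 h4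
    exact ⟨h1, h2, h3, h4⟩
  obtain ⟨r, hr, hball⟩ := Metric.eventually_nhds_iff_ball.1 hgood
  have hconst : ∀ z ∈ Metric.ball (Ψ 0) r, Φ (σ z) = Φ (σ (z.1, 0)) := by
    rintro ⟨Z, ξ⟩ hz
    rw [hΨ0, ← ball_prod_same] at hz hball
    let g : (Fin k → ℂ) → E := fun ξ => Φ (σ (Z, ξ))
    have hgd : ∀ ξ ∈ Metric.ball (0 : Fin k → ℂ) r, HasFDerivAt g (0 : (Fin k → ℂ) →L[ℂ] E) ξ := by
      intro ξ hξ
      obtain ⟨b1, b2, b3, b4⟩ := hball (Z, ξ) ⟨hz.1, hξ⟩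
      have h1 : HasFDerivAt g ((fderiv ℂ Φ (σ (Z, ξ))).comp ((fderiv ℂ σ (Z, ξ)).comp
          (ContinuousLinearMap.inr ℂ L (Fin k → ℂ)))) ξ :=
        HasFDerivAt.comp ξ (g := Φ) b2.differentiableAt.hasFDerivAt
          (HasFDerivAt.comp ξ (g := σ) b1.differentiableAt.hasFDerivAt
            (hasFDerivAt_prodMk_right Z ξ))
      have h2 : R (σ (Z, ξ)) = (fderiv ℂ Φ (σ (Z, ξ))).comp ((fderiv ℂ σ (Z, ξ)).comp
          (ContinuousLinearMap.inr ℂ L (Fin k → ℂ))) := by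
        simp only [R, b4]
      rwa [← h2, b3] at h1
    exact Metric.isOpen_ball.is_const_of_fderiv_eq_zero (isPreconnected_complex_ball _ _)
      (fun ξ hξ => (hgd ξ hξ).differentiableAt.differentiableWithinAt)
      (fun ξ hξ => (hgd ξ hξ).fderiv) hz.2 (Metric.mem_ball_self hr)
  have hin : AnalyticAt ℂ (fun Z : L => (Z, (0 : Fin k → ℂ))) (π (Φ 0)) :=
    analyticAt_id.prod analyticAt_const
  have hinc : Tendsto (fun Z : L => (Z, (0 : Fin k → ℂ))) (𝓝 (π (Φ 0))) (𝓝 (Ψ 0)) := by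
    rw [hΨ0]; exact hin.continuousAt.tendsto
  refine ⟨L, k, π, κ, σ, fun Z => Φ (σ (Z, 0)), by rw [← hΨ0]; exact hHa, ?_, hleft, ?_, ?_, ?_⟩
  · rw [← hΨ0]
    filter_upwards [hright] with z hz
    exact Prod.ext_iff.1 hz
  · refine AnalyticAt.fun_comp (g := Φ) ?_ (AnalyticAt.fun_comp (g := σ) ?_ hin)
    · rw [← hΨ0, hσ0]; exact hΦ
    · rw [← hΨ0]; exact hHa
  · filter_upwards [hinc.eventually hright] with Z hZ
    exact (Prod.ext_iff.1 hZ).1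
  · filter_upwards [hleft, hΨc.eventually (Metric.ball_mem_nhds _ hr)] with t h1 h2
    have := hconst _ h2
    rw [h1] at this
    exact this.symm

end Factorization

end CRGeom

namespace CRGeom

/-! ### From tangent vector fields on M to holomorphic one-forms. -/

section TangentValues

/-- The values at `p` of the germs at `p` of holomorphic vector fields tangent to `M`. -/
def tangentValues {E : Type*} [NormedAddCommGroup E] [NormedSpace ℂ E] (M : Set E) (p : E) :
    Submodule ℂ E where
  carrier := {v | ∃ X : E → E, AnalyticAt ℂ X p ∧
    (∀ᶠ q in 𝓝[M] p, X q ∈ complexTangentSpace M q) ∧ X p = v}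
  zero_mem' := ⟨0, analyticAt_const, by simp, rfl⟩
  add_mem' := by
    rintro v w ⟨Y, hY, hY0, rfl⟩ ⟨X, hX, hX0, rfl⟩
    refine ⟨Y + X, hY.add hX, ?_, rfl⟩
    filter_upwards [hY0, hX0] with q h1 h2
    exact add_mem h1 h2
  smul_mem' := by
    rintro c v ⟨Y, hY, hY0, rfl⟩
    refine ⟨c • Y, hY.const_smul, ?_, rfl⟩
    filter_upwards [hY0] with q h1
    exact Submodule.smul_mem _ c h1

variable {E : Type} [NormedAddCommGroup E] [NormedSpace ℂ E] [FiniteDimensional ℂ E]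

/-- Complex-linear equations of the complex tangent spaces, real-analytic in the base point. -/
theorem IsLocalParametrization.exists_tangent_equations {M : Set E} {p : E} {m : ℕ}
    {φ : (Fin m → ℝ) → E} {κ : E →L[ℝ] (Fin m → ℝ)} (h : IsLocalParametrization M p φ κ) :
    ∃ (k : ℕ) (Θ : (Fin m → ℝ) → (Fin k → (E →L[ℂ] ℂ))), AnalyticAt ℝ Θ 0 ∧
      ∀ᶠ t in 𝓝 0, ∀ v, v ∈ complexTangentSpace M (φ t) ↔ ∀ j, Θ t j v = 0 := by
  have : CompleteSpace E := FiniteDimensional.complete ℂ E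
  let b : E ≃L[ℝ] (Fin (Module.finrank ℝ E) → ℝ) := (Module.finBasis ℝ E).equivFunL
  -- The complex-linear extension of a real functional vanishes at v exactly when the functional
  -- vanishes at v and at iv, which matches the definition of the complex tangent space.
  let ext : (E →L[ℝ] ℝ) →L[ℝ] (E →L[ℂ] ℂ) := LinearMap.toContinuousLinearMap
    (StrongDual.extendRCLikeₗ (𝕜 := ℂ) (F := E)).toLinearMap
  let ℓ : Fin (Module.finrank ℝ E) → (E →L[ℝ] ℝ) := fun j =>
    (ContinuousLinearMap.proj j).comp (b : E →L[ℝ] (Fin (Module.finrank ℝ E) → ℝ))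
  have hℓ : ∀ v, (∀ j, ℓ j v = 0) → v = 0 := fun v hv => by
    have : b v = 0 := funext hv
    simpa using this
  let D : (Fin m → ℝ) → (E →L[ℝ] E) := fun t =>
    (fderiv ℝ φ t).comp κ - ContinuousLinearMap.id ℝ E
  have hD : AnalyticAt ℝ D 0 :=
    (analyticAt_clm_comp h.analyticAt.fderiv analyticAt_const).sub analyticAt_const
  refine ⟨_, fun t j => ext ((ℓ j).comp (D t)), ?_, ?_⟩
  · refine AnalyticAt.pi fun j => ?_
    exact (ext.analyticAt _).fun_comp (analyticAt_clm_comp analyticAt_const hD)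
  · filter_upwards [h.eventually_mem_realTangentSpace_iff] with t ht v
    have hval : ∀ j, ext ((ℓ j).comp (D t)) v =
        (ℓ j (D t v) : ℂ) - Complex.I * (ℓ j (D t (Complex.I • v)) : ℂ) := fun j => rfl
    have hz : ∀ j, ext ((ℓ j).comp (D t)) v = 0 ↔
        ℓ j (D t v) = 0 ∧ ℓ j (D t (Complex.I • v)) = 0 := fun j => by
      rw [hval, Complex.ext_iff]
      simp
    have hDz : ∀ w, D t w = 0 ↔ w ∈ realTangentSpace M (φ t) := fun w => by
      rw [ht, ← sub_eq_zero (b := w)]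
      rfl
    simp only [hz]
    change (v ∈ realTangentSpace M (φ t) ∧ Complex.I • v ∈ realTangentSpace M (φ t)) ↔ _
    rw [← hDz, ← hDz]
    constructor
    · rintro ⟨h1, h2⟩ j
      exact ⟨by rw [h1, (ℓ j).map_zero], by rw [h2, (ℓ j).map_zero]⟩
    · intro hj
      exact ⟨hℓ _ fun j => (hj j).1, hℓ _ fun j => (hj j).2⟩

/-- Near a point of a CR submanifold, the germs of tangent holomorphic vector fields correspond to
the solutions of a system of holomorphic linear equations on a projection to a complex space. -/
theorem exists_kernelValues_chart {d : ℕ} {M : Set E} (hM : IsRealAnalyticCRSubmanifold d M)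
    {p : E} (hp : p ∈ M) :
    ∃ (L : Submodule ℂ E) (π : E →L[ℂ] L) (ι : Type) (θ : ι → L → (L →L[ℂ] ℂ)) (W : Set L),
      IsOpen W ∧ IsPreconnected W ∧ π p ∈ W ∧ (∀ a, AnalyticOnNhd ℂ (θ a) W) ∧
      (∀ᶠ q in 𝓝[M] p, Module.finrank ℂ (tangentValues M q) =
        Module.finrank ℂ (kernelValues θ (π q))) ∧
      ∀ᶠ q in 𝓝[M] p, ∀ f : L → ℂ, AnalyticAt ℂ f (π q) → (∀ᶠ q' in 𝓝[M] q, f (π q') = 0) →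
        ∀ᶠ Z in 𝓝 (π q), f Z = 0 := by
  have : CompleteSpace E := FiniteDimensional.complete ℂ E
  obtain ⟨m, φ, κ, h⟩ := exists_isLocalParametrization hM.1 hp
  obtain ⟨n, hn⟩ := hM.2
  obtain ⟨Φ, hΦa, hΦφ⟩ := exists_complexification h.analyticAt
  obtain ⟨k', Θ, hΘa, hΘ⟩ := h.exists_tangent_equations
  obtain ⟨Θc, hΘca, hΘc⟩ := exists_complexification hΘa
  have hc : Tendsto (toComplex m) (𝓝 0) (𝓝 0) := by
    have := (toComplex m).continuous.tendsto 0
    rwa [map_zero] at this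
  -- This is where constancy of the CR dimension enters: it makes the rank of the complexified
  -- parametrization constant at real points.
  have hker : ∀ᶠ t in 𝓝 (0 : Fin m → ℝ),
      Module.finrank ℂ (LinearMap.ker (fderiv ℂ Φ (toComplex m t)).toLinearMap) = n := by
    filter_upwards [h.eventually_mem_realTangentSpace_iff, h.eventually_comp_fderiv, h.mem,
      hΦφ.eventually_nhds, hc.eventually hΦa.eventually_analyticAt] with t h1 h2 h3 h4 h5
    rw [finrank_ker_complexification (fderiv_toComplex h5 h4) h2
      (T := complexTangentSpace M (φ t)), hn _ h3]
    intro v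
    change (v ∈ realTangentSpace M (φ t) ∧ Complex.I • v ∈ realTangentSpace M (φ t)) ↔ _
    rw [h1, h1]
  obtain ⟨L, k, π, κ₂, σ, G, hσa, hσr, hσl, hGa, hGr, hGl⟩ :=
    exists_factorization_of_finrank_ker hΦa hker
  have : CompleteSpace L := FiniteDimensional.complete ℂ L
  have hΦ0 : Φ 0 = p := by
    have := hΦφ.self_of_nhds
    rwa [map_zero, h.map_zero] at this
  rw [hΦ0] at hσa hσr hGa hGr
  have hσ0 : σ (π p, 0) = 0 := by
    have := hσl.self_of_nhds
    rwa [hΦ0, map_zero] at this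
  have hgood : ∀ᶠ z in 𝓝 (π p, (0 : Fin k → ℂ)), AnalyticAt ℂ σ z ∧ AnalyticAt ℂ Θc (σ z) ∧
      π (Φ (σ z)) = z.1 ∧ AnalyticAt ℂ G z.1 ∧ ∀ᶠ Z in 𝓝 z.1, π (G Z) = Z := by
    have hσt : Tendsto σ (𝓝 (π p, 0)) (𝓝 0) := by
      have := hσa.continuousAt.tendsto
      rwa [hσ0] at this
    filter_upwards [hσa.eventually_analyticAt, hσt.eventually hΘca.eventually_analyticAt, hσr,
      continuousAt_fst.eventually hGa.eventually_analyticAt,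
      continuousAt_fst.eventually hGr.eventually_nhds] with z h1 h2 h3 h4 h5
    exact ⟨h1, h2, h3.1, h4, h5⟩
  obtain ⟨r, hr, hball⟩ := Metric.eventually_nhds_iff_ball.1 hgood
  rw [← ball_prod_same] at hball
  -- In the coordinates (Z, ξ) the complexified tangency equations depend on both variables, while a
  -- tangent field is described by Z alone. Each fixed ξ therefore contributes its own holomorphic
  -- one-forms in Z, pulled back by the graph map G.
  let θ : (Metric.ball (0 : Fin k → ℂ) r × Fin k') → L → (L →L[ℂ] ℂ) := fun a Z =>
    (Θc (σ (Z, a.1)) a.2).comp (fderiv ℂ G Z)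
  have hGW : ∀ Z ∈ Metric.ball (π p) r, AnalyticAt ℂ G Z := fun Z hZ =>
    (hball (Z, 0) ⟨hZ, Metric.mem_ball_self hr⟩).2.2.2.1
  have hπG : ∀ Z ∈ Metric.ball (π p) r, ∀ w, π (fderiv ℂ G Z w) = w := by
    intro Z hZ w
    have h1 : HasFDerivAt (fun Z => π (G Z)) (π.comp (fderiv ℂ G Z)) Z :=
      π.hasFDerivAt.comp Z (hGW Z hZ).differentiableAt.hasFDerivAt
    have h2 : HasFDerivAt (fun Z => π (G Z)) (ContinuousLinearMap.id ℂ L) Z :=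
      (hasFDerivAt_id Z).congr_of_eventuallyEq
        (hball (Z, 0) ⟨hZ, Metric.mem_ball_self hr⟩).2.2.2.2
    exact congrArg (fun T : L →L[ℂ] L => T w) (h1.unique h2)
  have hΘσ : ∀ Z ∈ Metric.ball (π p) r, ∀ ξ ∈ Metric.ball (0 : Fin k → ℂ) r, ∀ j,
      AnalyticAt ℂ (fun z => Θc (σ z) j) (Z, ξ) := by
    intro Z hZ ξ hξ j
    obtain ⟨h1, h2, -⟩ := hball (Z, ξ) ⟨hZ, hξ⟩
    have h3 : AnalyticAt ℂ (fun z => Θc (σ z)) (Z, ξ) := h2.fun_comp h1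
    exact analyticAt_pi_iff.1 h3 j
  -- facts at the points near `p`
  have hψ : Tendsto (fun s => (π (Φ s), κ₂ s)) (𝓝 0) (𝓝 (π p, 0)) := by
    have h1 : ContinuousAt (fun s => (π (Φ s), κ₂ s)) 0 :=
      (π.continuous.continuousAt.comp hΦa.continuousAt).prodMk κ₂.continuous.continuousAt
    have h2 := h1.tendsto
    rwa [hΦ0, map_zero] at h2
  have key : ∀ᶠ t in 𝓝 (0 : Fin m → ℝ), 𝓝[M] (φ t) = map φ (𝓝 t) ∧
      (∀ᶠ s in 𝓝 t, Φ (toComplex m s) = φ s) ∧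
      (∀ᶠ s in 𝓝 t, ∀ v, v ∈ complexTangentSpace M (φ s) ↔ ∀ j, Θc (toComplex m s) j v = 0) ∧
      (∀ᶠ s in 𝓝 t, ∀ v ∈ complexTangentSpace M (φ s), fderiv ℂ G (π (φ s)) (π v) = v) ∧
      (∀ᶠ s in 𝓝 (toComplex m t), G (π (Φ s)) = Φ s) ∧
      (∀ᶠ s in 𝓝 (toComplex m t), σ (π (Φ s), κ₂ s) = s) ∧
      AnalyticAt ℂ Φ (toComplex m t) ∧ AnalyticAt ℂ Θc (toComplex m t) ∧
      (π (φ t), κ₂ (toComplex m t)) ∈ Metric.ball (π p) r ×ˢ Metric.ball (0 : Fin k → ℂ) r := by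
    have hiff : ∀ᶠ s in 𝓝 (0 : Fin m → ℝ), ∀ v, v ∈ complexTangentSpace M (φ s) ↔
        ∀ j, Θc (toComplex m s) j v = 0 := by
      filter_upwards [hΘ, hΘc] with s h1 h2 v
      rw [h1, h2]
    have hGdΦ : ∀ᶠ s in 𝓝 (0 : Fin m → ℝ), ∀ v ∈ complexTangentSpace M (φ s),
        fderiv ℂ G (π (φ s)) (π v) = v := by
      filter_upwards [h.eventually_mem_realTangentSpace_iff, hΦφ.eventually_nhds,
        hc.eventually hΦa.eventually_analyticAt, hc.eventually hGl.eventually_nhds,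
        hc.eventually (hψ.eventually (Metric.ball_mem_nhds _ hr))] with s h1 h2 h3 h4 h5 v hv
      have hv' := (h1 v).1 hv.1
      rw [← fderiv_toComplex h3 h2] at hv'
      rw [← Metric.mem_ball, ← ball_prod_same] at h5
      have hGs : AnalyticAt ℂ G (π (Φ (toComplex m s))) := hGW _ h5.1
      have e1 : HasFDerivAt (fun s => G (π (Φ s))) ((fderiv ℂ G (π (Φ (toComplex m s)))).comp
          (π.comp (fderiv ℂ Φ (toComplex m s)))) (toComplex m s) :=
        HasFDerivAt.comp (toComplex m s) (g := G) hGs.differentiableAt.hasFDerivAt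
          (π.hasFDerivAt.comp _ h3.differentiableAt.hasFDerivAt)
      have e2 := h3.differentiableAt.hasFDerivAt.congr_of_eventuallyEq h4
      have e3 := congrArg (fun T : (Fin m → ℂ) →L[ℂ] E => T (toComplex m (κ v))) (e1.unique e2)
      have e4 : fderiv ℂ G (π (Φ (toComplex m s)))
        (π (fderiv ℂ Φ (toComplex m s) (toComplex m (κ v)))) =
          fderiv ℂ Φ (toComplex m s) (toComplex m (κ v)) := e3
      rwa [hv', h2.self_of_nhds] at e4
    filter_upwards [h.eventually_nhdsWithin_eq_map, hΦφ.eventually_nhds, hiff.eventually_nhds,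
      hGdΦ.eventually_nhds, hc.eventually hGl.eventually_nhds, hc.eventually hσl.eventually_nhds,
      hc.eventually hΦa.eventually_analyticAt, hc.eventually hΘca.eventually_analyticAt,
      hc.eventually (hψ.eventually (Metric.ball_mem_nhds _ hr))] with t h1 h2 h3 h4 h5 h6 h7 h8 h9
    rw [← Metric.mem_ball, ← ball_prod_same, h2.self_of_nhds] at h9
    exact ⟨h1, h2, h3, h4, h5, h6, h7, h8, h9⟩
  refine ⟨L, π, _, θ, Metric.ball (π p) r, Metric.isOpen_ball, isPreconnected_complex_ball _ _,
    Metric.mem_ball_self hr, ?_, ?_, ?_⟩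
  · rintro ⟨ξ, j⟩ Z hZ
    refine analyticAt_clm_comp ?_ (hGW Z hZ).fderiv
    exact AnalyticAt.fun_comp (g := fun z => Θc (σ z) j) (hΘσ Z hZ ξ ξ.2 j)
      (analyticAt_id.prod analyticAt_const)
  · rw [h.nhdsWithin_eq_map, eventually_map]
    filter_upwards [key] with t ⟨hnhds, hΦt, hTt, hGt, hGΦ, hσΦ, hΦta, hΘta, hZξ⟩
    set Z₀ := π (φ t) with hZ₀
    set ξ₀ := κ₂ (toComplex m t) with hξ₀
    have hΦφt : Φ (toComplex m t) = φ t := hΦt.self_of_nhds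
    have hGZ₀ : G Z₀ = φ t := by
      have := hGΦ.self_of_nhds
      rwa [hΦφt] at this
    have hσt : σ (Z₀, ξ₀) = toComplex m t := by
      have := hσΦ.self_of_nhds
      rwa [hΦφt] at this
    obtain ⟨hσat, -, -, hGat, -⟩ := hball _ hZξ
    have hπΦa : AnalyticAt ℂ (fun s => π (Φ s)) (toComplex m t) := (π.analyticAt _).fun_comp hΦta
    have htc : ContinuousAt (toComplex m) t := (toComplex m).continuous.continuousAt
    -- A tangent field X descends to π ∘ X ∘ G, and an annihilated field Y lifts to dG(Y) ∘ π. The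
    -- differential dG is injective because π ∘ G is the identity, so dimensions agree.
    have hmap : tangentValues M (φ t) =
        (kernelValues θ Z₀).map (fderiv ℂ G Z₀).toLinearMap := by
      ext v
      constructor
      · rintro ⟨X, hXa, hXT, rfl⟩
        let Y : L → L := fun Z => π (X (G Z))
        have hYa : AnalyticAt ℂ Y Z₀ := (π.analyticAt _).fun_comp
          (AnalyticAt.fun_comp (g := X) (by rw [hGZ₀]; exact hXa) hGat)
        rw [hnhds, eventually_map] at hXT
        have hXY : ∀ᶠ s in 𝓝 t, fderiv ℂ G (π (φ s)) (Y (π (φ s))) = X (φ s) ∧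
            X (φ s) ∈ complexTangentSpace M (φ s) := by
          filter_upwards [hXT, hGt, hΦt, htc.eventually hGΦ] with s h1 h2 h3 h4
          rw [h3] at h4
          refine ⟨?_, h1⟩
          simp only [Y, h4]
          exact h2 _ h1
        refine ⟨Y Z₀, ⟨Y, hYa, ?_, rfl⟩, hXY.self_of_nhds.1⟩
        have hZfst : AnalyticAt ℂ (fun s => fderiv ℂ G (π (Φ s)) (Y (π (Φ s)))) (toComplex m t) :=
          AnalyticAt.fun_comp (g := fun Z => fderiv ℂ G Z (Y Z))
            (by rw [hΦφt]; exact analyticAt_clm_apply hGat.fderiv hYa) hπΦa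
        have hvan : ∀ j, ∀ᶠ Z in 𝓝 Z₀, ∀ ξ ∈ Metric.ball (0 : Fin k → ℂ) r,
            Θc (σ (Z, ξ)) j (fderiv ℂ G Z (Y Z)) = 0 := by
          intro j
          have hua : AnalyticAt ℂ (fun s => Θc s j (fderiv ℂ G (π (Φ s)) (Y (π (Φ s)))))
              (toComplex m t) := analyticAt_clm_apply (analyticAt_pi_iff.1 hΘta j) hZfst
          have hu0 : ∀ᶠ s in 𝓝 t, Θc (toComplex m s) j (fderiv ℂ G (π (Φ (toComplex m s)))
              (Y (π (Φ (toComplex m s))))) = 0 := by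
            filter_upwards [hXY, hTt, hΦt] with s h1 h2 h3
            rw [h3, h1.1]
            exact (h2 _).1 h1.2 j
          have hu := eventually_eq_zero_of_toComplex hua hu0
          have hσtend : Tendsto σ (𝓝 (Z₀, ξ₀)) (𝓝 (toComplex m t)) := by
            have := hσat.continuousAt.tendsto
            rwa [hσt] at this
          have hprod : ∀ᶠ z in 𝓝 (Z₀, ξ₀), Θc (σ z) j (fderiv ℂ G z.1 (Y z.1)) = 0 := by
            filter_upwards [hσtend.eventually hu, (Metric.isOpen_ball.prod
              Metric.isOpen_ball).mem_nhds hZξ] with z h1 h2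
            rwa [(hball z h2).2.2.1] at h1
          -- The identity theorem from real points gives the equation only for ξ near ξ₀; for fixed
          -- Z it extends in ξ to the whole connected ball, as the index set of θ requires.
          filter_upwards [hprod.curry_nhds, Metric.isOpen_ball.mem_nhds hZξ.1] with Z h1 h2 ξ hξ
          have hana : AnalyticOnNhd ℂ (fun ξ => Θc (σ (Z, ξ)) j (fderiv ℂ G Z (Y Z)))
              (Metric.ball (0 : Fin k → ℂ) r) := fun ξ hξ =>
            analyticAt_clm_apply (AnalyticAt.fun_comp (g := fun z => Θc (σ z) j)
              (hΘσ Z h2 ξ hξ j) (analyticAt_const.prod analyticAt_id)) analyticAt_const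
          exact hana.eqOn_zero_of_preconnected_of_eventuallyEq_zero
            (isPreconnected_complex_ball _ _) hZξ.2 h1 hξ
        filter_upwards [eventually_all.2 hvan] with Z hZ
        rintro ⟨ξ, j⟩
        exact hZ j ξ ξ.2
      · rintro ⟨w, ⟨Y, hYa, hY0, rfl⟩, rfl⟩
        refine ⟨fun x => fderiv ℂ G (π x) (Y (π x)), ?_, ?_, rfl⟩
        · exact AnalyticAt.fun_comp (g := fun Z => fderiv ℂ G Z (Y Z))
            (analyticAt_clm_apply hGat.fderiv hYa) (π.analyticAt _)
        · rw [hnhds, eventually_map]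
          have hφc : ContinuousAt φ t := by
            have h1 : ContinuousAt (fun s => Φ (toComplex m s)) t :=
              ContinuousAt.comp (g := Φ) hΦta.continuousAt htc
            exact h1.congr hΦt
          have hπφc : ContinuousAt (fun s => π (φ s)) t := π.continuous.continuousAt.comp hφc
          have hκc : ContinuousAt (fun s => κ₂ (toComplex m s)) t :=
            κ₂.continuous.continuousAt.comp htc
          filter_upwards [hTt, hπφc.eventually hY0, hΦt, htc.eventually hσΦ,
            hκc.eventually (Metric.isOpen_ball.mem_nhds hZξ.2)] with s h1 h2 h3 h4 h5
          rw [h1]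
          intro j
          have h6 := h2 (⟨_, h5⟩, j)
          rw [h3] at h4
          simp only [θ, h4] at h6
          exact h6
    have hinj : Function.Injective (fderiv ℂ G Z₀).toLinearMap :=
      Function.LeftInverse.injective (g := π) (hπG Z₀ hZξ.1)
    rw [hmap]
    exact (Submodule.equivMapOfInjective _ hinj _).finrank_eq.symm
  -- If f ∘ π vanishes on M near q, then f ∘ π ∘ Φ vanishes at real points, hence identically; since
  -- π ∘ Φ has the local right inverse Z ↦ σ (Z, ξ), f vanishes as a germ.
  · rw [h.nhdsWithin_eq_map, eventually_map]
    filter_upwards [key] with t ⟨hnhds, hΦt, hTt, hGt, hGΦ, hσΦ, hΦta, hΘta, hZξ⟩ f hf hf0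
    rw [hnhds, eventually_map] at hf0
    have hΦφt : Φ (toComplex m t) = φ t := hΦt.self_of_nhds
    obtain ⟨hσat, -⟩ := hball _ hZξ
    have hσt : σ (π (φ t), κ₂ (toComplex m t)) = toComplex m t := by
      have := hσΦ.self_of_nhds
      rwa [hΦφt] at this
    have hfa : AnalyticAt ℂ (fun s => f (π (Φ s))) (toComplex m t) :=
      AnalyticAt.fun_comp (g := f) (by rw [hΦφt]; exact hf) ((π.analyticAt _).fun_comp hΦta)
    have hz := eventually_eq_zero_of_toComplex hfa (by
      filter_upwards [hf0, hΦt] with s h1 h2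
      rwa [h2])
    have hσtend : Tendsto σ (𝓝 (π (φ t), κ₂ (toComplex m t))) (𝓝 (toComplex m t)) := by
      have := hσat.continuousAt.tendsto
      rwa [hσt] at this
    have hprod : ∀ᶠ z in 𝓝 (π (φ t), κ₂ (toComplex m t)), f z.1 = 0 := by
      filter_upwards [hσtend.eventually hz, (Metric.isOpen_ball.prod
        Metric.isOpen_ball).mem_nhds hZξ] with z h1 h2
      rwa [(hball z h2).2.2.1] at h1
    exact hprod.curry_nhds.mono fun Z hZ => hZ.self_of_nhds

/-- The dimension of the space of values of tangent holomorphic vector fields is constant outside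
of a proper complex-analytic set, where it drops. -/
theorem exists_equations_finrank_tangentValues {d : ℕ} {M : Set E}
    (hM : IsRealAnalyticCRSubmanifold d M) {p : E} (hp : p ∈ M) :
    ∃ (l k : ℕ) (U : Set E) (f : E → (Fin k → ℂ)), IsOpen U ∧ p ∈ U ∧ AnalyticOnNhd ℂ f U ∧
      ∀ q ∈ M ∩ U, Module.finrank ℂ (tangentValues M q) ≤ l ∧
        (Module.finrank ℂ (tangentValues M q) = l ↔ f q ≠ 0) ∧ ∃ᶠ q' in 𝓝[M] q, f q' ≠ 0 := by
  obtain ⟨L, π, ι, θ, W, hWo, hWc, hpW, hθ, hfin, hdens⟩ := exists_kernelValues_chart hM hp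
  obtain ⟨l, k, U', Q, hU'o, hpU', hU'W, hQ, hQf, hUk⟩ :=
    exists_equations_finrank_kernelValues hWo hWc hθ hpW
  obtain ⟨V, hVo, hpV, hV⟩ := mem_nhdsWithin.1 (hfin.and hdens)
  have hne : ∀ q, (fun i => Q i (π q)) ≠ 0 ↔ ∃ i, Q i (π q) ≠ 0 := fun q =>
    Function.ne_iff
  refine ⟨l, k, V ∩ π ⁻¹' U', fun x i => Q i (π x), hVo.inter (hU'o.preimage π.continuous),
    ⟨hpV, hpU'⟩, ?_, ?_⟩
  · intro x hx
    exact AnalyticAt.pi fun i => AnalyticAt.fun_comp (g := Q i) (hQ i _ hx.2) (π.analyticAt x)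
  · rintro q ⟨hqM, hqV, hqU'⟩
    obtain ⟨h1, h2⟩ := hV ⟨hqV, hqM⟩
    obtain ⟨h3, h4⟩ := hUk (π q) hqU'
    rw [h1]
    refine ⟨h3, by rw [h4, hne], ?_⟩
    -- Were all Q i ∘ π zero on M near q, the uniqueness property of π(M) would make every Q i
    -- vanish near π q, although nonvanishing points accumulate there.
    by_contra hcon
    rw [not_frequently] at hcon
    have hz : ∀ᶠ Z in 𝓝 (π q), ∀ i, Q i Z = 0 := by
      refine eventually_all.2 fun i => h2 (Q i) (hQ i _ hqU') ?_
      filter_upwards [hcon] with q' hq'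
      exact congrFun (not_not.1 hq') i
    obtain ⟨Z, ⟨i, hi⟩, hZ⟩ := ((hQf _ hqU').and_eventually hz).exists
    exact hi (hZ i)

end TangentValues

end CRGeom

namespace CRGeom

/-! ### Holomorphic flows in complex time. -/

section Flow

/-- A holomorphic function on a disc is the derivative of its integral along segments from the
centre. -/
theorem hasDerivAt_smul_integral {F : Type*} [NormedAddCommGroup F] [NormedSpace ℂ F]
    [CompleteSpace F] {τ : ℝ} {g : ℂ → F} (hg : AnalyticOnNhd ℂ g (Metric.ball 0 τ)) {t : ℂ}
    (ht : t ∈ Metric.ball (0 : ℂ) τ) :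
    HasDerivAt (fun t : ℂ => t • ∫ s in (0 : ℝ)..1, g (s * t)) (g t) t := by
  obtain ⟨G, hG⟩ := (show DifferentiableOn ℂ g (Metric.ball 0 τ) from
    fun z hz => (hg z hz).differentiableAt.differentiableWithinAt).isExactOn_ball
  have hmem : ∀ t ∈ Metric.ball (0 : ℂ) τ, ∀ s ∈ Icc (0 : ℝ) 1,
      (s : ℂ) * t ∈ Metric.ball (0 : ℂ) τ := by
    intro t ht s hs
    rw [mem_ball_zero_iff] at ht ⊢
    rw [norm_mul, Complex.norm_real, Real.norm_of_nonneg hs.1]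
    exact (mul_le_of_le_one_left (norm_nonneg t) hs.2).trans_lt ht
  have hFTC : ∀ t ∈ Metric.ball (0 : ℂ) τ, t • ∫ s in (0 : ℝ)..1, g (s * t) = G t - G 0 := by
    intro t ht
    have hd : ∀ s ∈ uIcc (0 : ℝ) 1, HasDerivAt (fun s : ℝ => G (s * t)) (t • g (s * t)) s := by
      intro s hs
      rw [uIcc_of_le zero_le_one] at hs
      have h1 : HasDerivAt (fun s : ℝ => (s : ℂ) * t) t s := by
        simpa using (Complex.ofRealCLM.hasDerivAt (x := s)).mul_const t
      exact (hG _ (hmem t ht s hs)).scomp s h1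
    have hcont : ContinuousOn (fun s : ℝ => t • g (s * t)) (uIcc 0 1) := by
      rw [uIcc_of_le zero_le_one]
      refine ContinuousOn.const_smul (hg.continuousOn.comp (by fun_prop)
        (fun s hs => hmem t ht s hs)) t
    have := intervalIntegral.integral_eq_sub_of_hasDerivAt hd hcont.intervalIntegrable
    rw [intervalIntegral.integral_smul] at this
    simpa using this
  refine ((hG t ht).sub_const (G 0)).congr_of_eventuallyEq ?_
  filter_upwards [Metric.isOpen_ball.mem_nhds ht] with z hz
  exact hFTC z hz

variable {F : Type} [NormedAddCommGroup F] [NormedSpace ℂ F]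

/-- Picard iterates for the flow of a vector field. -/
noncomputable def picardIterate (V : F → F) : ℕ → ℂ × F → F
  | 0 => Prod.snd
  -- The integral from 0 to t along the segment is rescaled to a fixed interval, so that holomorphic
  -- dependence on t is a parameter integral.
  | n + 1 => fun z => z.2 + z.1 • ∫ s in (0 : ℝ)..1, V (picardIterate V n (s * z.1, z.2))

variable [FiniteDimensional ℂ F]

/-- Picard iteration in complex time: the iterates are jointly holomorphic and converge uniformly,
so the limit is holomorphic in time and initial value together. -/
theorem exists_local_flow {V : F → F} {x₀ : F} (hV : AnalyticAt ℂ V x₀) :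
    ∃ r > 0, ∃ y : ℂ × F → F, AnalyticOnNhd ℂ y (Metric.ball (0, x₀) r) ∧
      (∀ x ∈ Metric.ball x₀ r, y (0, x) = x) ∧ ∀ t ∈ Metric.ball (0 : ℂ) r,
        ∀ x ∈ Metric.ball x₀ r, HasDerivAt (fun s => y (s, x)) (V (y (t, x))) t := by
  have : CompleteSpace F := FiniteDimensional.complete ℂ F
  obtain ⟨K, S, hS, hK⟩ := hV.hasStrictFDerivAt.exists_lipschitzOnWith
  obtain ⟨R, hR, hRS⟩ := Metric.mem_nhds_iff.1 (inter_mem hS hV.eventually_analyticAt)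
  have hVa : AnalyticOnNhd ℂ V (Metric.ball x₀ R) := fun x hx => (hRS hx).2
  have hVl : ∀ x ∈ Metric.ball x₀ R, ∀ x' ∈ Metric.ball x₀ R, ‖V x - V x'‖ ≤ K * ‖x - x'‖ := by
    intro x hx x' hx'
    have := hK.dist_le_mul x (hRS hx).1 x' (hRS hx').1
    rwa [dist_eq_norm, dist_eq_norm] at this
  let B : ℝ := ‖V x₀‖ + K * R
  have hB0 : 0 ≤ B := by positivity
  have hVB : ∀ x ∈ Metric.ball x₀ R, ‖V x‖ ≤ B := by
    intro x hx
    have h1 := hVl x hx x₀ (Metric.mem_ball_self hR)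
    have h2 : ‖x - x₀‖ ≤ R := (mem_ball_iff_norm.1 hx).le
    have h3 : ‖V x‖ ≤ ‖V x₀‖ + ‖V x - V x₀‖ := by
      simpa using norm_add_le (V x₀) (V x - V x₀)
    have h4 : (K : ℝ) * ‖x - x₀‖ ≤ K * R := by gcongr
    simp only [B]
    linarith
  -- The first bound gives τ B ≤ R/2, which keeps the iterates in the ball of radius R; the second
  -- gives τ K ≤ 1/2, so consecutive differences halve. The added ones avoid division by zero.
  let τ : ℝ := min (R / (2 * (B + 1))) (1 / (2 * (K + 1)))
  have hτ : 0 < τ := by simp only [τ]; positivity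
  have hτB : τ * B ≤ R / 2 := by
    calc τ * B ≤ R / (2 * (B + 1)) * B := by gcongr; exact min_le_left _ _
      _ = R / 2 * (B / (B + 1)) := by field_simp
      _ ≤ R / 2 * 1 := by gcongr; exact div_le_one_of_le₀ (by linarith) (by linarith)
      _ = R / 2 := mul_one _
  have hτK : τ * K ≤ 1 / 2 := by
    calc τ * K ≤ 1 / (2 * (K + 1)) * K := by gcongr; exact min_le_right _ _
      _ = 1 / 2 * (K / (K + 1)) := by field_simp
      _ ≤ 1 / 2 * 1 := by gcongr; exact div_le_one_of_le₀ (by linarith) (by positivity)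
      _ = 1 / 2 := mul_one _
  let D : Set (ℂ × F) := Metric.ball 0 τ ×ˢ Metric.ball x₀ (R / 2)
  have hDo : IsOpen D := Metric.isOpen_ball.prod Metric.isOpen_ball
  have hseg : ∀ z ∈ D, ∀ s ∈ Icc (0 : ℝ) 1, ((s : ℂ) * z.1, z.2) ∈ D := by
    intro z hz s hs
    refine ⟨?_, hz.2⟩
    have h1 : ‖z.1‖ < τ := by simpa using hz.1
    rw [mem_ball_zero_iff, norm_mul, Complex.norm_real, Real.norm_of_nonneg hs.1]
    exact (mul_le_of_le_one_left (norm_nonneg _) hs.2).trans_lt h1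
  let y := picardIterate V
  have hmem : ∀ n, AnalyticOnNhd ℂ (y n) D ∧ ∀ z ∈ D, ‖y n z - x₀‖ ≤ ‖z.2 - x₀‖ + R / 2 := by
    intro n
    induction n with
    | zero => exact ⟨fun z _ => analyticAt_snd, fun z _ => by
        change ‖z.2 - x₀‖ ≤ _; linarith⟩
    | succ n ih =>
      obtain ⟨iha, ihb⟩ := ih
      have hb : ∀ z ∈ D, y n z ∈ Metric.ball x₀ R := fun z hz => by
        rw [mem_ball_iff_norm]
        have h1 := ihb z hz
        have h2 : ‖z.2 - x₀‖ < R / 2 := mem_ball_iff_norm.1 hz.2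
        linarith
      constructor
      · have hint : AnalyticOnNhd ℂ (fun z : ℂ × F => ∫ s in (0 : ℝ)..1, V (y n (s * z.1, z.2)))
            D := by
          refine analyticOnNhd_intervalIntegral hDo zero_le_one
            (fun z s => V (y n ((s : ℂ) * z.1, z.2))) ?_ ?_
          · refine hVa.continuousOn.comp (iha.continuousOn.comp
              (t := D) (f := fun w : (ℂ × F) × ℝ => ((w.2 : ℂ) * w.1.1, w.1.2)) ?_ ?_) ?_
            · fun_prop
            · exact fun w hw => hseg w.1 hw.1 w.2 hw.2
            · exact fun w hw => hb _ (hseg w.1 hw.1 w.2 hw.2)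
          · intro s hs z hz
            refine AnalyticAt.fun_comp (g := V) (hVa _ (hb _ (hseg z hz s hs))) ?_
            refine AnalyticAt.fun_comp (g := y n) (iha _ (hseg z hz s hs)) ?_
            exact (analyticAt_const.mul analyticAt_fst).prod analyticAt_snd
        exact fun z hz => analyticAt_snd.add (analyticAt_fst.smul (hint z hz))
      · intro z hz
        have h1 : ‖∫ s in (0 : ℝ)..1, V (y n (s * z.1, z.2))‖ ≤ B * |1 - 0| := by
          refine intervalIntegral.norm_integral_le_of_norm_le_const fun s hs => ?_
          rw [uIoc_of_le zero_le_one] at hs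
          exact hVB _ (hb _ (hseg z hz s ⟨hs.1.le, hs.2⟩))
        have h2 : ‖z.1‖ < τ := by simpa using hz.1
        have h3 : y (n + 1) z - x₀ =
            (z.2 - x₀) + z.1 • ∫ s in (0 : ℝ)..1, V (y n (s * z.1, z.2)) := by
          change z.2 + z.1 • (∫ s in (0 : ℝ)..1, V (y n (s * z.1, z.2))) - x₀ = _
          abel
        rw [h3]
        refine (norm_add_le _ _).trans ?_
        rw [norm_smul]
        have h4 : ‖z.1‖ * ‖∫ s in (0 : ℝ)..1, V (y n (s * z.1, z.2))‖ ≤ τ * B := by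
          refine mul_le_mul h2.le (by simpa using h1) (norm_nonneg _) hτ.le
        linarith
  have hb : ∀ n, ∀ z ∈ D, y n z ∈ Metric.ball x₀ R := fun n z hz => by
    rw [mem_ball_iff_norm]
    have h1 := (hmem n).2 z hz
    have h2 : ‖z.2 - x₀‖ < R / 2 := mem_ball_iff_norm.1 hz.2
    linarith
  have hdist : ∀ n, ∀ z ∈ D, dist (y n z) (y (n + 1) z) ≤ (2 * R) / 2 / 2 ^ n := by
    intro n
    induction n with
    | zero =>
      intro z hz
      have h1 : ‖∫ s in (0 : ℝ)..1, V (y 0 (s * z.1, z.2))‖ ≤ B * |1 - 0| := by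
        refine intervalIntegral.norm_integral_le_of_norm_le_const fun s hs => ?_
        rw [uIoc_of_le zero_le_one] at hs
        exact hVB _ (hb 0 _ (hseg z hz s ⟨hs.1.le, hs.2⟩))
      have h2 : ‖z.1‖ < τ := by simpa using hz.1
      have h3 : dist (y 0 z) (y 1 z) = ‖z.1‖ * ‖∫ s in (0 : ℝ)..1, V (y 0 (s * z.1, z.2))‖ := by
        change dist z.2 (z.2 + z.1 • ∫ s in (0 : ℝ)..1, V (y 0 (s * z.1, z.2))) = _
        rw [dist_self_add_right, norm_smul]
      rw [h3]
      have h4 : ‖z.1‖ * ‖∫ s in (0 : ℝ)..1, V (y 0 (s * z.1, z.2))‖ ≤ τ * B :=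
        mul_le_mul h2.le (by simpa using h1) (norm_nonneg _) hτ.le
      simp only [pow_zero, div_one]
      linarith
    | succ n ih =>
      intro z hz
      have hcont : ∀ k, IntervalIntegrable (fun s : ℝ => V (y k (s * z.1, z.2)))
          MeasureTheory.volume 0 1 := by
        intro k
        refine ContinuousOn.intervalIntegrable ?_
        rw [uIcc_of_le zero_le_one]
        refine hVa.continuousOn.comp ((hmem k).1.continuousOn.comp
              (t := D) (f := fun s : ℝ => ((s : ℂ) * z.1, z.2)) ?_ ?_) ?_
        · fun_prop
        · exact fun s hs => hseg z hz s hs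
        · exact fun s hs => hb k _ (hseg z hz s hs)
      have h1 : ‖(∫ s in (0 : ℝ)..1, V (y n (s * z.1, z.2))) -
          ∫ s in (0 : ℝ)..1, V (y (n + 1) (s * z.1, z.2))‖ ≤
            (K * ((2 * R) / 2 / 2 ^ n)) * |1 - 0| := by
        rw [← intervalIntegral.integral_sub (hcont n) (hcont (n + 1))]
        refine intervalIntegral.norm_integral_le_of_norm_le_const fun s hs => ?_
        rw [uIoc_of_le zero_le_one] at hs
        have hs' := hseg z hz s ⟨hs.1.le, hs.2⟩
        refine (hVl _ (hb n _ hs') _ (hb (n + 1) _ hs')).trans ?_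
        have := ih _ hs'
        rw [dist_eq_norm] at this
        gcongr
      have h2 : ‖z.1‖ < τ := by simpa using hz.1
      have h3 : dist (y (n + 1) z) (y (n + 2) z) = ‖z.1‖ *
          ‖(∫ s in (0 : ℝ)..1, V (y n (s * z.1, z.2))) -
            ∫ s in (0 : ℝ)..1, V (y (n + 1) (s * z.1, z.2))‖ := by
        change dist (z.2 + z.1 • ∫ s in (0 : ℝ)..1, V (y n (s * z.1, z.2)))
          (z.2 + z.1 • ∫ s in (0 : ℝ)..1, V (y (n + 1) (s * z.1, z.2))) = _
        rw [dist_add_left, dist_eq_norm, ← smul_sub, norm_smul]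
      rw [h3]
      have h4 : ‖z.1‖ * ‖(∫ s in (0 : ℝ)..1, V (y n (s * z.1, z.2))) -
            ∫ s in (0 : ℝ)..1, V (y (n + 1) (s * z.1, z.2))‖ ≤ τ * (K * ((2 * R) / 2 / 2 ^ n)) :=
        mul_le_mul h2.le (by simpa using h1) (norm_nonneg _) hτ.le
      refine h4.trans ?_
      calc τ * (K * ((2 * R) / 2 / 2 ^ n)) = (τ * K) * ((2 * R) / 2 / 2 ^ n) := by ring
        _ ≤ 1 / 2 * ((2 * R) / 2 / 2 ^ n) := by gcongr
        _ = (2 * R) / 2 / 2 ^ (n + 1) := by rw [pow_succ]; field_simp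
  have hlim : ∀ z ∈ D, ∃ w, Tendsto (fun n => y n z) atTop (𝓝 w) := fun z hz =>
    cauchySeq_tendsto_of_complete (cauchySeq_of_le_geometric_two fun n => hdist n z hz)
  classical
  let Y : ℂ × F → F := fun z => if hz : z ∈ D then (hlim z hz).choose else 0
  have hY : ∀ z ∈ D, Tendsto (fun n => y n z) atTop (𝓝 (Y z)) := fun z hz => by
    simp only [Y, dif_pos hz]
    exact (hlim z hz).choose_spec
  have hYd : ∀ n, ∀ z ∈ D, dist (y n z) (Y z) ≤ 2 * R / 2 ^ n := fun n z hz =>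
    dist_le_of_le_geometric_two_of_tendsto (fun n => hdist n z hz) (hY z hz) n
  have hpow : Tendsto (fun n : ℕ => 2 * R / 2 ^ n) atTop (𝓝 0) := by
    have := (tendsto_pow_atTop_nhds_zero_of_lt_one (r := (1 / 2 : ℝ)) (by norm_num)
      (by norm_num)).const_mul (2 * R)
    simpa [div_eq_mul_inv] using this
  have hunif : TendstoUniformlyOn y Y atTop D := by
    rw [Metric.tendstoUniformlyOn_iff]
    intro ε hε
    filter_upwards [hpow.eventually (gt_mem_nhds hε)] with n hn z hz
    rw [dist_comm]
    exact (hYd n z hz).trans_lt hn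
  have hYR : ∀ z ∈ D, Y z ∈ Metric.ball x₀ R := by
    intro z hz
    rw [mem_ball_iff_norm]
    have h1 : ‖Y z - x₀‖ ≤ ‖z.2 - x₀‖ + R / 2 :=
      le_of_tendsto' ((hY z hz).sub_const x₀).norm fun n => (hmem n).2 z hz
    have h2 : ‖z.2 - x₀‖ < R / 2 := mem_ball_iff_norm.1 hz.2
    linarith
  have hrτ : Metric.ball (0 : ℂ) (min τ (R / 2)) ⊆ Metric.ball 0 τ :=
    Metric.ball_subset_ball (min_le_left _ _)
  have hrR : Metric.ball x₀ (min τ (R / 2)) ⊆ Metric.ball x₀ (R / 2) :=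
    Metric.ball_subset_ball (min_le_right _ _)
  refine ⟨min τ (R / 2), lt_min hτ (by positivity), Y, ?_, ?_, ?_⟩
  · rw [← ball_prod_same]
    exact (analyticOnNhd_of_tendstoUniformlyOn hDo (fun n => (hmem n).1) hunif).mono
      (prod_mono hrτ hrR)
  · intro x hx
    have hz : ((0 : ℂ), x) ∈ D := ⟨Metric.mem_ball_self hτ, hrR hx⟩
    refine tendsto_nhds_unique (hY _ hz) (tendsto_const_nhds.congr fun n => ?_)
    cases n with
    | zero => rfl
    | succ n =>
      change x = x + (0 : ℂ) • _
      rw [zero_smul, add_zero]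
  · intro t ht x hx
    have hD : ∀ s ∈ Metric.ball (0 : ℂ) τ, (s, x) ∈ D := fun s hs => ⟨hs, hrR hx⟩
    -- The (n+1)-st iterate has time derivative V of the n-th, and these derivatives converge
    -- uniformly to V of the limit.
    refine hasDerivAt_of_tendstoUniformlyOn (l := atTop) (f := fun n s => y (n + 1) (s, x))
      (f' := fun n s => V (y n (s, x))) (g' := fun s => V (Y (s, x)))
      (s := Metric.ball (0 : ℂ) τ) Metric.isOpen_ball ?_ ?_ ?_ (hrτ ht)
    · rw [Metric.tendstoUniformlyOn_iff]
      intro ε hε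
      have hpow' : Tendsto (fun n : ℕ => K * (2 * R / 2 ^ n)) atTop (𝓝 0) := by
        simpa using hpow.const_mul (K : ℝ)
      filter_upwards [hpow'.eventually (gt_mem_nhds hε)] with n hn s hs
      refine lt_of_le_of_lt ?_ hn
      rw [dist_comm, dist_eq_norm]
      refine (hVl _ (hb n _ (hD s hs)) _ (hYR _ (hD s hs))).trans ?_
      have := hYd n _ (hD s hs)
      rw [dist_eq_norm] at this
      gcongr
    · refine Eventually.of_forall fun n s hs => ?_
      have hga : AnalyticOnNhd ℂ (fun s => V (y n (s, x))) (Metric.ball 0 τ) := fun s hs =>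
        AnalyticAt.fun_comp (g := V) (hVa _ (hb n _ (hD s hs)))
          (AnalyticAt.fun_comp (g := y n) ((hmem n).1 _ (hD s hs))
            (analyticAt_id.prod analyticAt_const))
      exact (hasDerivAt_smul_integral hga hs).const_add x
    · exact fun s hs => (hY _ (hD s hs)).comp (tendsto_add_atTop_nat 1)

end Flow

end CRGeom

namespace CRGeom

/-! ### Biholomorphic invariance. -/

section Functoriality

theorem tendsto_nhdsWithin_of_eventually_mem {α β : Type*} [TopologicalSpace α]
    [TopologicalSpace β] {M : Set α} {M' : Set β} {g : α → β} {p : α} (hg : ContinuousAt g p)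
    (hmap : ∀ᶠ x in 𝓝[M] p, g x ∈ M') : Tendsto g (𝓝[M] p) (𝓝[M'] (g p)) :=
  tendsto_nhdsWithin_iff.2 ⟨hg.tendsto.mono_left nhdsWithin_le_nhds, hmap⟩

variable {E F : Type*} [NormedAddCommGroup E] [NormedSpace ℂ E] [NormedAddCommGroup F]
  [NormedSpace ℂ F] {M : Set E} {M' : Set F} {g : E → F} {p : E}

/-- Functions vanishing on M' pull back to functions vanishing on M; with tangent spaces defined by
vanishing functions no parametrization is needed. -/
theorem fderiv_mem_realTangentSpace (hg : AnalyticAt ℝ g p) (hmap : ∀ᶠ x in 𝓝[M] p, g x ∈ M')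
    {v : E} (hv : v ∈ realTangentSpace M p) : fderiv ℝ g p v ∈ realTangentSpace M' (g p) := by
  intro f hf hf0
  have h1 := hv (fun x => f (g x)) (hf.fun_comp hg)
    ((tendsto_nhdsWithin_of_eventually_mem hg.continuousAt hmap).eventually hf0)
  have h2 : HasFDerivAt (fun x => f (g x)) ((fderiv ℝ f (g p)).comp (fderiv ℝ g p)) p :=
    hf.differentiableAt.hasFDerivAt.comp p hg.differentiableAt.hasFDerivAt
  rwa [h2.fderiv] at h1

theorem fderiv_mem_complexTangentSpace (hg : AnalyticAt ℂ g p)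
    (hmap : ∀ᶠ x in 𝓝[M] p, g x ∈ M') {v : E} (hv : v ∈ complexTangentSpace M p) :
    fderiv ℂ g p v ∈ complexTangentSpace M' (g p) := by
  have hd : fderiv ℝ g p = (fderiv ℂ g p).restrictScalars ℝ :=
    (hg.differentiableAt.hasFDerivAt.restrictScalars ℝ).fderiv
  have h1 := fderiv_mem_realTangentSpace (hg.restrictScalars (𝕜 := ℝ)) hmap hv.1
  have h2 := fderiv_mem_realTangentSpace (hg.restrictScalars (𝕜 := ℝ)) hmap hv.2
  rw [hd] at h1 h2
  refine ⟨h1, ?_⟩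
  rw [← map_smul]
  exact h2

theorem mem_complexTangentSpace_univ (v : E) : v ∈ complexTangentSpace univ p := by
  have key : ∀ v : E, v ∈ realTangentSpace univ p := by
    intro v f _ hf0
    rw [nhdsWithin_univ] at hf0
    have : HasFDerivAt f (0 : E →L[ℝ] ℝ) p :=
      (hasFDerivAt_const (0 : ℝ) p).congr_of_eventuallyEq hf0
    rw [this.fderiv]
    rfl
  exact ⟨key v, key _⟩

theorem mem_complexTangentSpace_univ_prod {z : E} {w : F} (hw : w ∈ M') (v : E × F) :
    v ∈ complexTangentSpace ((univ : Set E) ×ˢ M') (z, w) ↔ v.2 ∈ complexTangentSpace M' w := by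
  constructor
  · intro hv
    have := fderiv_mem_complexTangentSpace (g := Prod.snd) (M' := M') analyticAt_snd
      (by filter_upwards [self_mem_nhdsWithin] with x hx using hx.2) hv
    rwa [fderiv_snd] at this
  · intro hv
    have h1 := fderiv_mem_complexTangentSpace (M := univ) (M' := (univ : Set E) ×ˢ M')
      (g := fun z : E => (z, w)) (p := z) (analyticAt_id.prod analyticAt_const)
      (Eventually.of_forall fun x => ⟨mem_univ _, hw⟩) (mem_complexTangentSpace_univ v.1)
    have h2 := fderiv_mem_complexTangentSpace (M := M') (M' := (univ : Set E) ×ˢ M')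
      (g := fun w : F => (z, w)) (p := w) (analyticAt_const.prod analyticAt_id)
      (by filter_upwards [self_mem_nhdsWithin] with x hx using ⟨mem_univ _, hx⟩) hv
    rw [(hasFDerivAt_prodMk_left z w).fderiv] at h1
    rw [(hasFDerivAt_prodMk_right z w).fderiv] at h2
    have := add_mem h1 h2
    simpa using this

/-- `g` and `g'` are mutually inverse local biholomorphisms between the germs `(M, p)` and
`(M', p')`. -/
structure IsLocalBiholomorphism (M : Set E) (p : E) (M' : Set F) (p' : F) (g : E → F)
    (g' : F → E) : Prop where
  analyticAt : AnalyticAt ℂ g p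
  analyticAt' : AnalyticAt ℂ g' p'
  map_eq : g p = p'
  map_eq' : g' p' = p
  left_inv : ∀ᶠ x in 𝓝 p, g' (g x) = x
  right_inv : ∀ᶠ y in 𝓝 p', g (g' y) = y
  mapsTo : ∀ᶠ x in 𝓝[M] p, g x ∈ M'
  mapsTo' : ∀ᶠ y in 𝓝[M'] p', g' y ∈ M

namespace IsLocalBiholomorphism

variable {p' : F} {g' : F → E}

theorem symm (h : IsLocalBiholomorphism M p M' p' g g') :
    IsLocalBiholomorphism M' p' M p g' g :=
  ⟨h.analyticAt', h.analyticAt, h.map_eq', h.map_eq, h.right_inv, h.left_inv, h.mapsTo', h.mapsTo⟩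

theorem tendsto (h : IsLocalBiholomorphism M p M' p' g g') : Tendsto g (𝓝[M] p) (𝓝[M'] p') := by
  have := tendsto_nhdsWithin_of_eventually_mem h.analyticAt.continuousAt h.mapsTo
  rwa [h.map_eq] at this

theorem eventually [CompleteSpace E] [CompleteSpace F]
    (h : IsLocalBiholomorphism M p M' p' g g') :
    ∀ᶠ q in 𝓝[M] p, IsLocalBiholomorphism M q M' (g q) g g' := by
  have hg : Tendsto g (𝓝 p) (𝓝 p') := by
    have := h.analyticAt.continuousAt.tendsto
    rwa [h.map_eq] at this
  filter_upwards [nhdsWithin_le_nhds h.analyticAt.eventually_analyticAt,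
    nhdsWithin_le_nhds (hg.eventually h.analyticAt'.eventually_analyticAt),
    nhdsWithin_le_nhds h.left_inv.eventually_nhds,
    nhdsWithin_le_nhds (hg.eventually h.right_inv.eventually_nhds),
    eventually_eventually_nhdsWithin.2 h.mapsTo,
    h.tendsto.eventually (eventually_eventually_nhdsWithin.2 h.mapsTo')]
    with q h1 h2 h3 h4 h5 h6
  exact ⟨h1, h2, rfl, h3.self_of_nhds, h3, h4, h5, h6⟩

theorem fderiv_left_inv (h : IsLocalBiholomorphism M p M' p' g g') (v : E) :
    fderiv ℂ g' p' (fderiv ℂ g p v) = v := by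
  have h1 : HasFDerivAt (fun x => g' (g x)) ((fderiv ℂ g' p').comp (fderiv ℂ g p)) p :=
    HasFDerivAt.comp p (g := g')
      (by rw [h.map_eq]; exact h.analyticAt'.differentiableAt.hasFDerivAt)
      h.analyticAt.differentiableAt.hasFDerivAt
  have h2 : HasFDerivAt (fun x => g' (g x)) (ContinuousLinearMap.id ℂ E) p :=
    (hasFDerivAt_id p).congr_of_eventuallyEq h.left_inv
  exact congrArg (fun T : E →L[ℂ] E => T v) (h1.unique h2)

theorem fderiv_mem (h : IsLocalBiholomorphism M p M' p' g g') {v : E}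
    (hv : v ∈ complexTangentSpace M p) : fderiv ℂ g p v ∈ complexTangentSpace M' p' := by
  have := fderiv_mem_complexTangentSpace h.analyticAt h.mapsTo hv
  rwa [h.map_eq] at this

theorem finrank_complexTangentSpace_le [FiniteDimensional ℂ F]
    (h : IsLocalBiholomorphism M p M' p' g g') :
    Module.finrank ℂ (complexTangentSpace M p) ≤ Module.finrank ℂ (complexTangentSpace M' p') :=
  LinearMap.finrank_le_finrank_of_injective
    (f := (fderiv ℂ g p).toLinearMap.restrict fun _ hv => h.fderiv_mem hv)
    (fun _ _ hvw => Subtype.ext <| (Function.LeftInverse.injective h.fderiv_left_inv)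
      (congrArg Subtype.val hvw))

theorem finrank_complexTangentSpace_eq [FiniteDimensional ℂ E] [FiniteDimensional ℂ F]
    (h : IsLocalBiholomorphism M p M' p' g g') :
    Module.finrank ℂ (complexTangentSpace M p) = Module.finrank ℂ (complexTangentSpace M' p') :=
  le_antisymm h.finrank_complexTangentSpace_le h.symm.finrank_complexTangentSpace_le

/-- Holomorphic tangent fields are pushed forward by g; tangency is needed at all points near p',
hence the use of `eventually`. -/
theorem fderiv_mem_tangentValues [CompleteSpace E] [CompleteSpace F]
    (h : IsLocalBiholomorphism M p M' p' g g') {v : E} (hv : v ∈ tangentValues M p) :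
    fderiv ℂ g p v ∈ tangentValues M' p' := by
  obtain ⟨X, hX, hXT, rfl⟩ := hv
  refine ⟨fun y => fderiv ℂ g (g' y) (X (g' y)), ?_, ?_, by simp only [h.map_eq']⟩
  · refine AnalyticAt.fun_comp (g := fun x => fderiv ℂ g x (X x)) ?_ h.analyticAt'
    rw [h.map_eq']
    exact analyticAt_clm_apply h.analyticAt.fderiv hX
  · filter_upwards [h.symm.eventually, h.symm.tendsto.eventually hXT] with y h1 h2
    exact h1.symm.fderiv_mem h2

theorem finrank_tangentValues_eq [FiniteDimensional ℂ E] [FiniteDimensional ℂ F]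
    (h : IsLocalBiholomorphism M p M' p' g g') :
    Module.finrank ℂ (tangentValues M p) = Module.finrank ℂ (tangentValues M' p') := by
  have : CompleteSpace E := FiniteDimensional.complete ℂ E
  have : CompleteSpace F := FiniteDimensional.complete ℂ F
  refine le_antisymm ?_ ?_
  · exact LinearMap.finrank_le_finrank_of_injective
      (f := (fderiv ℂ g p).toLinearMap.restrict fun _ hv => h.fderiv_mem_tangentValues hv)
      (fun _ _ hvw => Subtype.ext <| (Function.LeftInverse.injective h.fderiv_left_inv)
        (congrArg Subtype.val hvw))
  · exact LinearMap.finrank_le_finrank_of_injective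
      (f := (fderiv ℂ g' p').toLinearMap.restrict
        fun _ hv => h.symm.fderiv_mem_tangentValues hv)
      (fun _ _ hvw => Subtype.ext <| (Function.LeftInverse.injective h.symm.fderiv_left_inv)
        (congrArg Subtype.val hvw))

end IsLocalBiholomorphism

end Functoriality

/-! ### Straight points have value space of dimension l. -/

section StraightPoints

theorem BiholomorphicGerms.exists_isLocalBiholomorphism {E F : Type} [NormedAddCommGroup E]
    [NormedSpace ℂ E] [FiniteDimensional ℂ E] [NormedAddCommGroup F] [NormedSpace ℂ F]
    [FiniteDimensional ℂ F] {M : Set E} {p : E} {M' : Set F} {p' : F}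
    (h : BiholomorphicGerms M p M' p') :
    ∃ g g', IsLocalBiholomorphism M p M' p' g g' := by
  have : CompleteSpace E := FiniteDimensional.complete ℂ E
  have : CompleteSpace F := FiniteDimensional.complete ℂ F
  obtain ⟨H, hp, rfl, hd, hd', hMM'⟩ := h
  have ht : H p ∈ H.target := H.map_source hp
  refine ⟨H, H.symm, analyticOnNhd_of_differentiableOn hd H.open_source p hp,
    analyticOnNhd_of_differentiableOn hd' H.open_target _ ht, rfl, H.left_inv hp, ?_, ?_, ?_, ?_⟩
  · filter_upwards [H.open_source.mem_nhds hp] with x hx using H.left_inv hx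
  · filter_upwards [H.open_target.mem_nhds ht] with x hx using H.right_inv hx
  · filter_upwards [self_mem_nhdsWithin, nhdsWithin_le_nhds (H.open_source.mem_nhds hp)]
      with x h1 h2
    have : H x ∈ H '' (M ∩ H.source) := ⟨x, ⟨h1, h2⟩, rfl⟩
    rw [hMM'] at this
    exact this.1
  · filter_upwards [self_mem_nhdsWithin, nhdsWithin_le_nhds (H.open_target.mem_nhds ht)]
      with y h1 h2
    have : y ∈ H '' (M ∩ H.source) := by rw [hMM']; exact ⟨h1, h2⟩
    obtain ⟨x, hx, rfl⟩ := this
    rw [H.left_inv hx.2]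
    exact hx.1

/-- Restricting the second component of a tangent field to {z} × M' gives a field tangent to M',
which vanishes by nondegeneracy. The first component is arbitrary, as constant fields show. -/
theorem finrank_tangentValues_univ_prod {E F : Type*} [NormedAddCommGroup E] [NormedSpace ℂ E]
    [NormedAddCommGroup F] [NormedSpace ℂ F] {M' : Set F} {z : E} {w : F}
    (hw : w ∈ M') (hnd : IsHolomorphicallyNondegenerateAt M' w) :
    Module.finrank ℂ (tangentValues ((univ : Set E) ×ˢ M') (z, w)) = Module.finrank ℂ E := by
  have heq : tangentValues ((univ : Set E) ×ˢ M') (z, w) =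
      LinearMap.range (LinearMap.inl ℂ E F) := by
    ext v
    constructor
    · rintro ⟨X, hX, hXT, rfl⟩
      have hin : AnalyticAt ℂ (fun w' : F => (z, w')) w := analyticAt_const.prod analyticAt_id
      have h1 : AnalyticAt ℂ (fun w' => (X (z, w')).2) w :=
        AnalyticAt.fun_comp (g := Prod.snd) analyticAt_snd
          (AnalyticAt.fun_comp (g := X) hX hin)
      have h2 : Tendsto (fun w' : F => (z, w')) (𝓝[M'] w) (𝓝[(univ : Set E) ×ˢ M'] (z, w)) :=
        tendsto_nhdsWithin_of_eventually_mem hin.continuousAt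
          (by filter_upwards [self_mem_nhdsWithin] with w' hw' using ⟨mem_univ _, hw'⟩)
      have h3 : ∀ᶠ w' in 𝓝[M'] w, (X (z, w')).2 ∈ complexTangentSpace M' w' := by
        filter_upwards [h2.eventually hXT, self_mem_nhdsWithin] with w' h h'
        exact (mem_complexTangentSpace_univ_prod h' _).1 h
      have h4 := (hnd _ h1 h3).self_of_nhdsWithin hw
      exact ⟨(X (z, w)).1, Prod.ext rfl h4.symm⟩
    · rintro ⟨u, rfl⟩
      refine ⟨fun _ => (u, 0), analyticAt_const, ?_, rfl⟩
      filter_upwards [self_mem_nhdsWithin] with x hx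
      exact (mem_complexTangentSpace_univ_prod (z := x.1) hx.2 _).2 (zero_mem _)
  rw [heq, LinearMap.finrank_range_of_inj LinearMap.inl_injective]

/-- Thus l is an invariant of the germ; this yields both one inclusion of the description of M \ Υ
and the uniqueness of l. -/
theorem finrank_tangentValues_of_mem_straightPoints {N l : ℕ} {M : Set (Fin N → ℂ)}
    {p : Fin N → ℂ} (hp : p ∈ straightPoints N l M) :
    Module.finrank ℂ (tangentValues M p) = l := by
  obtain ⟨-, d', M', -, h0, hnd, hbih⟩ := hp
  obtain ⟨g, g', h⟩ := hbih.exists_isLocalBiholomorphism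
  rw [h.finrank_tangentValues_eq]
  have := finrank_tangentValues_univ_prod (z := (0 : Fin l → ℂ)) h0 hnd
  rwa [Module.finrank_fin_fun] at this

end StraightPoints

end CRGeom

namespace CRGeom

/-! ### Integral curves of tangent fields stay in M. -/

section Invariance

variable {E : Type*} [NormedAddCommGroup E] [NormedSpace ℂ E]

theorem hasDerivAt_comp_ofReal {u : ℂ → E} {u' : E} {t : ℝ} (h : HasDerivAt u u' (t : ℂ)) :
    HasDerivAt (fun s : ℝ => u s) u' t := by
  have := h.scomp t (Complex.ofRealCLM.hasDerivAt (x := t))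
  simp only [Complex.ofRealCLM_apply, Complex.ofReal_one, one_smul] at this
  exact this

/-- An integral curve of a real-analytic vector field tangent to `M` that meets `M` stays in the
zero sets of the real-analytic functions vanishing on `M`. -/
theorem eq_zero_along_integralCurve {M U : Set E} (hU : IsOpen U) {X : E → E}
    (hX : AnalyticOnNhd ℝ X U) (hT : ∀ q ∈ M ∩ U, X q ∈ realTangentSpace M q) {J : Set ℝ}
    (hJo : IsOpen J) (hJc : IsPreconnected J) {u : ℝ → E} (hu : AnalyticOnNhd ℝ u J)
    (hud : ∀ t ∈ J, HasDerivAt u (X (u t)) t) (huU : ∀ t ∈ J, u t ∈ U) {t₀ : ℝ} (ht₀ : t₀ ∈ J)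
    (h₀ : u t₀ ∈ M) {f : E → ℝ} (hf : AnalyticOnNhd ℝ f U) (hf0 : ∀ q ∈ M ∩ U, f q = 0) :
    ∀ t ∈ J, f (u t) = 0 := by
  -- The derivative of f along the curve is X f, which again vanishes on M because X is tangent.
  -- Inductively all derivatives at t₀ vanish, and analyticity does the rest.
  have key : ∀ n : ℕ, ∀ f : E → ℝ, AnalyticOnNhd ℝ f U → (∀ q ∈ M ∩ U, f q = 0) →
      iteratedDeriv n (fun t => f (u t)) t₀ = 0 := by
    intro n
    induction n with
    | zero =>
      intro f _ hf0
      rw [iteratedDeriv_zero]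
      exact hf0 _ ⟨h₀, huU _ ht₀⟩
    | succ n ih =>
      intro f hf hf0
      rw [iteratedDeriv_succ']
      have hev : deriv (fun t => f (u t)) =ᶠ[𝓝 t₀] fun t => fderiv ℝ f (u t) (X (u t)) := by
        filter_upwards [hJo.mem_nhds ht₀] with t ht
        exact ((hf _ (huU t ht)).differentiableAt.hasFDerivAt.comp_hasDerivAt t (hud t ht)).deriv
      rw [hev.iteratedDeriv_eq]
      refine ih (fun x => fderiv ℝ f x (X x))
        (fun x hx => analyticAt_clm_apply (hf x hx).fderiv (hX x hx)) fun q hq => ?_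
      refine hT q hq f (hf q hq.2) ?_
      filter_upwards [self_mem_nhdsWithin, nhdsWithin_le_nhds (hU.mem_nhds hq.2)] with x h1 h2
      exact hf0 x ⟨h1, h2⟩
  have hfu : AnalyticOnNhd ℝ (fun t => f (u t)) J := fun t ht =>
    (hf _ (huU t ht)).fun_comp (hu t ht)
  have htop : analyticOrderAt (fun t => f (u t)) t₀ = ⊤ := by
    rw [ENat.eq_top_iff_forall_ge]
    intro n
    rw [natCast_le_analyticOrderAt_iff_iteratedDeriv_eq_zero (hfu t₀ ht₀)]
    exact fun i _ => key i f hf hf0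
  exact hfu.eqOn_zero_of_preconnected_of_eventuallyEq_zero hJc ht₀ (analyticOrderAt_eq_top.1 htop)

end Invariance

/-! ### A family of maps preserving M, built from flows. -/

section Straightening

variable {E : Type} [NormedAddCommGroup E] [NormedSpace ℂ E] [FiniteDimensional ℂ E]

/-- Flowing along holomorphic vector fields, with complex parameters. -/
theorem exists_flow_parameters {l : ℕ} {X : Fin l → E → E} {p : E}
    (hX : ∀ i, AnalyticAt ℂ (X i) p) {U : Set E} (hU : U ∈ 𝓝 p) :
    ∃ r > 0, ∃ y : ℂ × ((Fin l → ℂ) × E) → E,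
      AnalyticOnNhd ℂ y (Metric.ball (0, (0, p)) r) ∧
      (∀ v ∈ Metric.ball (0, (0, p)) r, y v ∈ U) ∧
      (∀ z ∈ Metric.ball 0 r, ∀ x ∈ Metric.ball p r, y (0, (z, x)) = x) ∧
      ∀ t ∈ Metric.ball (0 : ℂ) r, ∀ z ∈ Metric.ball 0 r, ∀ x ∈ Metric.ball p r,
        HasDerivAt (fun s => y (s, (z, x))) (∑ i, z i • X i (y (t, (z, x)))) t := by
  have : CompleteSpace E := FiniteDimensional.complete ℂ E
  -- The coefficients z i are added as state variables with zero velocity, so one flow theorem gives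
  -- holomorphic dependence on them.
  let V : (Fin l → ℂ) × E → (Fin l → ℂ) × E := fun v => (0, ∑ i, v.1 i • X i v.2)
  have hV : AnalyticAt ℂ V (0, p) := by
    refine analyticAt_const.prod (Finset.analyticAt_fun_sum _ fun i _ => ?_)
    refine AnalyticAt.smul ?_ (AnalyticAt.fun_comp (g := X i) (hX i) analyticAt_snd)
    exact ((ContinuousLinearMap.proj (R := ℂ) (φ := fun _ : Fin l => ℂ) i).comp
      (ContinuousLinearMap.fst ℂ (Fin l → ℂ) E)).analyticAt _
  obtain ⟨r, hr, y, hya, hy0, hyd⟩ := exists_local_flow hV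
  have hp0 : ((0 : Fin l → ℂ), p) ∈ Metric.ball ((0 : Fin l → ℂ), p) r := Metric.mem_ball_self hr
  have hyc : Tendsto y (𝓝 (0, (0, p))) (𝓝 (0, p)) := by
    have := (hya (0, (0, p)) (Metric.mem_ball_self hr)).continuousAt.tendsto
    rwa [hy0 _ hp0] at this
  have hUev : ∀ᶠ v in 𝓝 ((0 : ℂ), ((0 : Fin l → ℂ), p)), (y v).2 ∈ U :=
    hyc.eventually (continuousAt_snd.eventually hU)
  obtain ⟨r', hr', hr'U⟩ := Metric.eventually_nhds_iff_ball.1 hUev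
  have hle : ∀ {α : Type} [PseudoMetricSpace α] (a : α),
      Metric.ball a (min r r') ⊆ Metric.ball a r := fun a =>
    Metric.ball_subset_ball (min_le_left _ _)
  have hmem : ∀ z ∈ Metric.ball (0 : Fin l → ℂ) (min r r'), ∀ x ∈ Metric.ball p (min r r'),
      (z, x) ∈ Metric.ball ((0 : Fin l → ℂ), p) r := by
    intro z hz x hx
    rw [← ball_prod_same]
    exact ⟨hle _ hz, hle _ hx⟩
  have hfst : ∀ t ∈ Metric.ball (0 : ℂ) r, ∀ w ∈ Metric.ball ((0 : Fin l → ℂ), p) r,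
      (y (t, w)).1 = w.1 := by
    intro t ht w hw
    have hd : ∀ s ∈ Metric.ball (0 : ℂ) r, HasDerivAt (fun s => (y (s, w)).1) 0 s := fun s hs =>
      (ContinuousLinearMap.fst ℂ (Fin l → ℂ) E).hasFDerivAt.comp_hasDerivAt s (hyd s hs w hw)
    have h1 := Metric.isOpen_ball.is_const_of_deriv_eq_zero
      (isPreconnected_complex_ball (0 : ℂ) r)
      (fun s hs => (hd s hs).differentiableAt.differentiableWithinAt)
      (fun s hs => (hd s hs).deriv) ht (Metric.mem_ball_self hr)
    rw [h1, hy0 w hw]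
  refine ⟨min r r', lt_min hr hr', fun v => (y v).2, ?_, ?_, ?_, ?_⟩
  · exact fun v hv => AnalyticAt.fun_comp (g := Prod.snd) analyticAt_snd (hya v (hle _ hv))
  · exact fun v hv => hr'U v (Metric.ball_subset_ball (min_le_right _ _) hv)
  · intro z hz x hx
    simp only [hy0 _ (hmem z hz x hx)]
  · intro t ht z hz x hx
    have h1 := (ContinuousLinearMap.snd ℂ (Fin l → ℂ) E).hasFDerivAt.comp_hasDerivAt t
      (hyd t (hle _ ht) _ (hmem z hz x hx))
    have h2 := hfst t (hle _ ht) _ (hmem z hz x hx)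
    convert! h1 using 1
    simp only [V, h2]
    rfl

/-- Holomorphic vector fields tangent to `M` generate a holomorphic family of maps preserving
`M`. -/
theorem exists_straightening_map {d : ℕ} {M : Set E} (hM : IsRealAnalyticSubmanifold d M) {p : E}
    (hp : p ∈ M) {l : ℕ} {X : Fin l → E → E} (hX : ∀ i, AnalyticAt ℂ (X i) p)
    (hXT : ∀ i, ∀ᶠ q in 𝓝[M] p, X i q ∈ complexTangentSpace M q) :
    ∃ Φ : (Fin l → ℂ) × E → E, AnalyticAt ℂ Φ (0, p) ∧ (∀ᶠ x in 𝓝 p, Φ (0, x) = x) ∧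
      (∀ v, fderiv ℂ Φ (0, p) v = ∑ i, v.1 i • X i p + v.2) ∧
      ∀ᶠ v in 𝓝 (0, p), (Φ v ∈ M ↔ v.2 ∈ M) := by
  have : CompleteSpace E := FiniteDimensional.complete ℂ E
  obtain ⟨U₀, hU₀o, hpU₀, ρ, hρ, -, hMU₀⟩ := hM p hp
  obtain ⟨U₁, hU₁o, hpU₁, hU₁⟩ := mem_nhdsWithin.1 (eventually_all.2 hXT)
  obtain ⟨U₂, hU₂, hU₂o, hpU₂⟩ := mem_nhds_iff.1 (eventually_all.2 fun i =>
    (hX i).eventually_analyticAt)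
  let U := U₀ ∩ (U₁ ∩ U₂)
  have hUo : IsOpen U := hU₀o.inter (hU₁o.inter hU₂o)
  have hpU : p ∈ U := ⟨hpU₀, hpU₁, hpU₂⟩
  have hMU : ∀ x ∈ U, (x ∈ M ↔ ρ x = 0) := fun x hx => by
    have : x ∈ M ∩ U₀ ↔ x ∈ {x | x ∈ U₀ ∧ ρ x = 0} := by rw [hMU₀]
    simpa [hx.1] using this
  obtain ⟨r, hr, y, hya, hyU, hy0, hyd⟩ := exists_flow_parameters hX (hUo.mem_nhds hpU)
  have hball : ∀ t ∈ Metric.ball (0 : ℂ) r, ∀ z ∈ Metric.ball (0 : Fin l → ℂ) r,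
      ∀ x ∈ Metric.ball p r, (t, (z, x)) ∈ Metric.ball ((0 : ℂ), ((0 : Fin l → ℂ), p)) r := by
    intro t ht z hz x hx
    rw [← ball_prod_same, ← ball_prod_same]
    exact ⟨ht, hz, hx⟩
  have hreal : ∀ t ∈ Ioo (-r) r, (t : ℂ) ∈ Metric.ball (0 : ℂ) r := fun t ht => by
    rw [mem_ball_zero_iff, Complex.norm_real, Real.norm_eq_abs, abs_lt]
    exact ht
  -- invariance of `M`
  have hinv : ∀ z ∈ Metric.ball (0 : Fin l → ℂ) r, ∀ x ∈ Metric.ball p r,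
      ∀ t₀ ∈ Ioo (-r) r, ∀ t ∈ Ioo (-r) r, y ((t₀ : ℂ), (z, x)) ∈ M → y ((t : ℂ), (z, x)) ∈ M := by
    intro z hz x hx t₀ ht₀ t ht h₀
    have huU : ∀ s ∈ Ioo (-r) r, y ((s : ℂ), (z, x)) ∈ U := fun s hs =>
      hyU _ (hball _ (hreal s hs) z hz x hx)
    rw [hMU _ (huU t ht)]
    funext j
    refine eq_zero_along_integralCurve (M := M) (U := U) (X := fun q => ∑ i, z i • X i q)
      (J := Ioo (-r) r) (u := fun s : ℝ => y ((s : ℂ), (z, x))) (t₀ := t₀)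
      (f := fun q => ρ q j) hUo ?_ ?_ isOpen_Ioo isPreconnected_Ioo ?_ ?_ huU ht₀ h₀ ?_ ?_ t ht
    · intro q hq
      exact Finset.analyticAt_fun_sum _ fun i _ =>
        ((analyticAt_const.smul (hU₂ hq.2.2 i)).restrictScalars (𝕜 := ℝ))
    · intro q hq
      have : ∑ i, z i • X i q ∈ complexTangentSpace M q := Submodule.sum_mem _ fun i _ =>
        Submodule.smul_mem _ _ (hU₁ ⟨hq.2.2.1, hq.1⟩ i)
      exact this.1
    · intro s hs
      refine AnalyticAt.fun_comp (g := y)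
        ((hya _ (hball _ (hreal s hs) z hz x hx)).restrictScalars (𝕜 := ℝ)) ?_
      exact (Complex.ofRealCLM.analyticAt s).prod analyticAt_const
    · intro s hs
      exact hasDerivAt_comp_ofReal (hyd _ (hreal s hs) z hz x hx)
    · intro q hq
      exact analyticAt_pi_iff.1 (hρ q hq.1) j
    · intro q hq
      exact congrFun ((hMU q hq.2).1 hq.1) j
  -- the flow at a fixed positive time
  let δ : ℝ := r / 2
  have hδ : 0 < δ := by positivity
  have hδr : δ ∈ Ioo (-r) r := ⟨by simp only [δ]; linarith, by simp only [δ]; linarith⟩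
  have hδ' : (δ : ℂ) ≠ 0 := by exact_mod_cast hδ.ne'
  have hy00 : ∀ t ∈ Metric.ball (0 : ℂ) r, ∀ x ∈ Metric.ball p r, y (t, (0, x)) = x := by
    intro t ht x hx
    have hd : ∀ s ∈ Metric.ball (0 : ℂ) r, HasDerivAt (fun s => y (s, (0, x))) 0 s := fun s hs => by
      have := hyd s hs 0 (Metric.mem_ball_self hr) x hx
      simpa using this
    have h1 := Metric.isOpen_ball.is_const_of_deriv_eq_zero
      (isPreconnected_complex_ball (0 : ℂ) r)
      (fun s hs => (hd s hs).differentiableAt.differentiableWithinAt)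
      (fun s hs => (hd s hs).deriv) ht (Metric.mem_ball_self hr)
    rw [h1, hy0 0 (Metric.mem_ball_self hr) x hx]
  -- The time-δ flow of ∑ (z i / δ) X i stands for the time-one flow of ∑ z i X i. The time stays
  -- real, so M is preserved, while the parameters z are complex; no commutation of the fields is
  -- needed.
  let S : (Fin l → ℂ) × E → ℂ × ((Fin l → ℂ) × E) := fun v => ((δ : ℂ), ((δ : ℂ)⁻¹ • v.1, v.2))
  have hSa : ∀ v, AnalyticAt ℂ S v := fun v => analyticAt_const.prod
    (analyticAt_fst.fun_const_smul.prod analyticAt_snd)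
  have hS0 : S (0, p) = ((δ : ℂ), (0, p)) := by simp [S]
  have hSball : ∀ᶠ v in 𝓝 ((0 : Fin l → ℂ), p), (δ : ℂ)⁻¹ • v.1 ∈ Metric.ball (0 : Fin l → ℂ) r ∧
      v.2 ∈ Metric.ball p r := by
    have h1 : ContinuousAt (fun v : (Fin l → ℂ) × E => (δ : ℂ)⁻¹ • v.1) (0, p) := by fun_prop
    refine (h1.eventually (Metric.isOpen_ball.mem_nhds ?_)).and
      (continuousAt_snd.eventually (Metric.ball_mem_nhds p hr))
    simpa using hr
  have hΦa : AnalyticAt ℂ (fun v => y (S v)) (0, p) := by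
    refine AnalyticAt.fun_comp (g := y) ?_ (hSa _)
    rw [hS0]
    exact hya _ (hball _ (hreal δ hδr) _ (Metric.mem_ball_self hr) _ (Metric.mem_ball_self hr))
  have hΦ0 : ∀ᶠ x in 𝓝 p, y (S (0, x)) = x := by
    filter_upwards [Metric.ball_mem_nhds p hr] with x hx
    simp only [S, smul_zero]
    exact hy00 _ (hreal δ hδr) x hx
  -- the derivative in the parameters
  have hpar : HasFDerivAt (fun z : Fin l → ℂ => y ((δ : ℂ), (z, p)))
      (∑ i, ((ContinuousLinearMap.proj (R := ℂ) (φ := fun _ : Fin l => ℂ) i).smulRight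
        ((δ : ℂ) • X i p))) 0 := by
    rw [hasFDerivAt_iff_isLittleO_nhds_zero, Asymptotics.isLittleO_iff]
    intro c hc
    obtain ⟨ε, hε, hεc⟩ : ∃ ε > 0, (l * ε) * δ ≤ c := by
      -- The l fields each contribute an error ε over time δ; l + 1 also covers l = 0.
      refine ⟨c / ((l + 1) * δ), by positivity, ?_⟩
      have : (l : ℝ) * (c / ((l + 1) * δ)) * δ = c * (l / (l + 1)) := by field_simp
      rw [this]
      exact mul_le_of_le_one_right hc.le (div_le_one_of_le₀ (by linarith) (by positivity))
    have htube : ∀ᶠ z in 𝓝 (0 : Fin l → ℂ), ∀ s ∈ Icc (0 : ℝ) δ, ∀ i,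
        ‖X i (y ((s : ℂ), (z, p))) - X i p‖ < ε := by
      refine isCompact_Icc.eventually_forall_of_forall_eventually fun s hs => ?_
      refine eventually_all.2 fun i => ?_
      have hs' : (s : ℂ) ∈ Metric.ball (0 : ℂ) r :=
        hreal s ⟨by linarith [hs.1], hs.2.trans_lt hδr.2⟩
      have h1 : ContinuousAt (fun w : (Fin l → ℂ) × ℝ => y ((w.2 : ℂ), (w.1, p))) (0, s) :=
        ContinuousAt.comp (g := y) (f := fun w : (Fin l → ℂ) × ℝ => ((w.2 : ℂ), (w.1, p)))
          (hya _ (hball _ hs' _ (Metric.mem_ball_self hr) _ (Metric.mem_ball_self hr))).continuousAt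
          (by fun_prop)
      have h2 : ContinuousAt (fun w : (Fin l → ℂ) × ℝ => X i (y ((w.2 : ℂ), (w.1, p)))) (0, s) := by
        refine ContinuousAt.comp (g := X i) ?_ h1
        change ContinuousAt (X i) (y ((s : ℂ), (0, p)))
        rw [hy00 _ hs' p (Metric.mem_ball_self hr)]
        exact (hX i).continuousAt
      have h3 := h2.eventually (Metric.ball_mem_nhds _ hε)
      filter_upwards [h3] with w hw
      rw [dist_eq_norm] at hw
      simpa [hy00 _ hs' p (Metric.mem_ball_self hr)] using hw
    filter_upwards [htube, Metric.ball_mem_nhds (0 : Fin l → ℂ) hr] with z hz hzr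
    have hMV := norm_image_sub_le_of_norm_deriv_le_segment'
      (f := fun s : ℝ => y ((s : ℂ), (z, p)) - (s : ℂ) • ∑ i, z i • X i p)
      (f' := fun s : ℝ => ∑ i, z i • X i (y ((s : ℂ), (z, p))) - ∑ i, z i • X i p)
      (a := 0) (b := δ) (C := l * ε * ‖z‖) ?_ ?_ δ ⟨hδ.le, le_rfl⟩
    · have e1 : (∑ i, ((ContinuousLinearMap.proj (R := ℂ) (φ := fun _ : Fin l => ℂ) i).smulRight
          ((δ : ℂ) • X i p))) z = (δ : ℂ) • ∑ i, z i • X i p := by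
        rw [sum_apply, Finset.smul_sum]
        exact Finset.sum_congr rfl fun i _ => smul_comm _ _ _
      rw [zero_add, e1, hy00 _ (hreal δ hδr) p (Metric.mem_ball_self hr)]
      simp only [Complex.ofReal_zero, zero_smul, sub_zero,
        hy0 z hzr p (Metric.mem_ball_self hr)] at hMV
      rw [sub_right_comm]
      refine hMV.trans ?_
      calc l * ε * ‖z‖ * δ = (l * ε * δ) * ‖z‖ := by ring
        _ ≤ c * ‖z‖ := by gcongr
    · intro s hs
      have hs' : (s : ℂ) ∈ Metric.ball (0 : ℂ) r :=
        hreal s ⟨by linarith [hs.1], hs.2.trans_lt hδr.2⟩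
      have h1 := hasDerivAt_comp_ofReal (hyd _ hs' z hzr p (Metric.mem_ball_self hr))
      have h2 : HasDerivAt (fun s : ℝ => (s : ℂ) • ∑ i, z i • X i p) (∑ i, z i • X i p) s := by
        simpa using (Complex.ofRealCLM.hasDerivAt (x := s)).smul_const (∑ i, z i • X i p)
      exact (h1.sub h2).hasDerivWithinAt
    · intro s hs
      rw [← Finset.sum_sub_distrib]
      refine (norm_sum_le _ _).trans ?_
      have : ∀ i ∈ (Finset.univ : Finset (Fin l)),
          ‖z i • X i (y ((s : ℂ), (z, p))) - z i • X i p‖ ≤ ‖z‖ * ε := by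
        intro i _
        rw [← smul_sub, norm_smul]
        exact mul_le_mul (norm_le_pi_norm z i) (hz s ⟨hs.1, hs.2.le⟩ i).le (norm_nonneg _)
          (norm_nonneg _)
      refine (Finset.sum_le_sum this).trans (le_of_eq ?_)
      simp
      ring
  refine ⟨fun v => y (S v), hΦa, hΦ0, ?_, ?_⟩
  · intro v
    have hd := hΦa.differentiableAt.hasFDerivAt
    have hz : HasFDerivAt (fun z : Fin l → ℂ => y (S (z, p)))
        ((fderiv ℂ (fun v => y (S v)) (0, p)).comp (ContinuousLinearMap.inl ℂ _ E)) 0 :=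
      HasFDerivAt.comp (0 : Fin l → ℂ) (g := fun v => y (S v)) hd (hasFDerivAt_prodMk_left 0 p)
    have hx : HasFDerivAt (fun x : E => y (S (0, x)))
        ((fderiv ℂ (fun v => y (S v)) (0, p)).comp (ContinuousLinearMap.inr ℂ (Fin l → ℂ) E)) p :=
      HasFDerivAt.comp p (g := fun v => y (S v)) hd (hasFDerivAt_prodMk_right 0 p)
    have hx' := hx.unique ((hasFDerivAt_id p).congr_of_eventuallyEq hΦ0)
    have hsc : HasFDerivAt (fun z : Fin l → ℂ => (δ : ℂ)⁻¹ • z)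
        ((δ : ℂ)⁻¹ • ContinuousLinearMap.id ℂ (Fin l → ℂ)) 0 :=
      ((δ : ℂ)⁻¹ • ContinuousLinearMap.id ℂ (Fin l → ℂ)).hasFDerivAt
    have hz2 := HasFDerivAt.comp (0 : Fin l → ℂ) (g := fun z : Fin l → ℂ => y ((δ : ℂ), (z, p)))
      (by rw [smul_zero]; exact hpar) hsc
    have hz' := hz.unique hz2
    have hv : v = (v.1, 0) + (0, v.2) := by simp
    have e1 := congrArg (fun T : (Fin l → ℂ) →L[ℂ] E => T v.1) hz'
    have e2 := congrArg (fun T : E →L[ℂ] E => T v.2) hx'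
    have e1' : fderiv ℂ (fun v => y (S v)) (0, p) (v.1, 0) = ∑ i, v.1 i • X i p := by
      refine e1.trans ?_
      change (∑ i, ((ContinuousLinearMap.proj (R := ℂ) (φ := fun _ : Fin l => ℂ) i).smulRight
        ((δ : ℂ) • X i p))) ((δ : ℂ)⁻¹ • v.1) = _
      rw [map_smul, sum_apply, Finset.smul_sum]
      refine Finset.sum_congr rfl fun i _ => ?_
      change (δ : ℂ)⁻¹ • v.1 i • (δ : ℂ) • X i p = _
      rw [smul_comm (v.1 i) (δ : ℂ), inv_smul_smul₀ hδ']
    have e2' : fderiv ℂ (fun v => y (S v)) (0, p) (0, v.2) = v.2 := e2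
    conv_lhs => rw [hv]
    rw [map_add, e1', e2']
  · filter_upwards [hSball] with v hv
    have h0 : (0 : ℝ) ∈ Ioo (-r) r := ⟨by linarith, hr⟩
    have e0 : y (((0 : ℝ) : ℂ), ((δ : ℂ)⁻¹ • v.1, v.2)) = v.2 := by
      rw [Complex.ofReal_zero]
      exact hy0 _ hv.1 _ hv.2
    constructor
    · intro h
      have := hinv _ hv.1 _ hv.2 δ hδr 0 h0 h
      rwa [e0] at this
    · intro h
      exact hinv _ hv.1 _ hv.2 0 h0 δ hδr (by rwa [e0])

end Straightening

end CRGeom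

namespace CRGeom

/-! ### Straightening at points of locally maximal dimension. -/

section Straight

/-- A right inverse B of the map at a makes A x ∘ B close to the identity, hence invertible, for x
near a. -/
theorem eventually_surjective {𝕜 : Type*} [RCLike 𝕜] {α V F : Type*} [TopologicalSpace α]
    [NormedAddCommGroup V] [NormedSpace 𝕜 V] [NormedAddCommGroup F] [NormedSpace 𝕜 F]
    [FiniteDimensional 𝕜 F] {A : α → (V →L[𝕜] F)} {a : α} (hA : ContinuousAt A a)
    (hs : Function.Surjective (A a)) : ∀ᶠ x in 𝓝 a, Function.Surjective (A x) := by
  have : CompleteSpace F := FiniteDimensional.complete 𝕜 F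
  obtain ⟨B, hB⟩ := (A a).toLinearMap.exists_rightInverse_of_surjective
    (LinearMap.range_eq_top.2 hs)
  let B' : F →L[𝕜] V := LinearMap.toContinuousLinearMap B
  have h1 : (A a).comp B' = 1 := by
    ext v
    exact congrArg (fun T : F →ₗ[𝕜] F => T v) hB
  have hc : ContinuousAt (fun x => (A x).comp B') a := hA.clm_comp continuousAt_const
  have hu : ∀ᶠ x in 𝓝 a, IsUnit ((A x).comp B') := by
    refine hc.eventually (Units.isOpen.mem_nhds ?_)
    change IsUnit ((A a).comp B')
    rw [h1]
    exact isUnit_one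
  filter_upwards [hu] with x hx y
  obtain ⟨u, hu⟩ := hx
  refine ⟨B' ((↑u⁻¹ : F →L[𝕜] F) y), ?_⟩
  have := congrArg (fun T : F →L[𝕜] F => T y) u.mul_inv
  rw [hu] at this
  exact this

theorem finrank_complexTangentSpace_univ_prod {E F : Type*} [NormedAddCommGroup E]
    [NormedSpace ℂ E] [FiniteDimensional ℂ E] [NormedAddCommGroup F] [NormedSpace ℂ F]
    [FiniteDimensional ℂ F] {M' : Set F} {z : E} {w : F} (hw : w ∈ M') :
    Module.finrank ℂ (complexTangentSpace ((univ : Set E) ×ˢ M') (z, w)) =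
      Module.finrank ℂ E + Module.finrank ℂ (complexTangentSpace M' w) := by
  let e : (E × complexTangentSpace M' w) ≃ₗ[ℂ] complexTangentSpace ((univ : Set E) ×ˢ M') (z, w) :=
    { toFun := fun v => ⟨(v.1, v.2), (mem_complexTangentSpace_univ_prod hw _).2 v.2.2⟩
      invFun := fun v => (v.1.1, ⟨v.1.2, (mem_complexTangentSpace_univ_prod hw _).1 v.2⟩)
      map_add' := fun _ _ => rfl
      map_smul' := fun _ _ => rfl
      left_inv := fun _ => rfl
      right_inv := fun _ => rfl }
  rw [← e.finrank_eq, Module.finrank_prod]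

/-- A germ is holomorphically nondegenerate if the dimension of the space of values of tangent
fields on its product with a complex space does not exceed the dimension of that space. -/
theorem isHolomorphicallyNondegenerateAt_of_finrank_le {E F : Type*} [NormedAddCommGroup E]
    [NormedSpace ℂ E] [FiniteDimensional ℂ E] [NormedAddCommGroup F] [NormedSpace ℂ F]
    [FiniteDimensional ℂ F] {M' : Set F} {z : E} {w₀ : F}
    (hle : ∀ᶠ w in 𝓝[M'] w₀, Module.finrank ℂ (tangentValues ((univ : Set E) ×ˢ M') (z, w)) ≤
      Module.finrank ℂ E) : IsHolomorphicallyNondegenerateAt M' w₀ := by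
  have : CompleteSpace F := FiniteDimensional.complete ℂ F
  intro X hX hXT
  by_contra hcon
  obtain ⟨w, hw0, hwle, hwM, hwa, hwT⟩ := ((not_eventually.1 hcon).and_eventually
    (hle.and (eventually_mem_nhdsWithin.and ((hX.eventually_analyticAt.filter_mono nhdsWithin_le_nhds).and
      (eventually_eventually_nhdsWithin.2 hXT))))).exists
  have h1 : ∀ u : E, (u, (0 : F)) ∈ tangentValues ((univ : Set E) ×ˢ M') (z, w) := by
    intro u
    refine ⟨fun _ => (u, 0), analyticAt_const, ?_, rfl⟩
    filter_upwards [self_mem_nhdsWithin] with x hx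
    exact (mem_complexTangentSpace_univ_prod (z := x.1) hx.2 _).2 (zero_mem _)
  have h2 : ((0 : E), X w) ∈ tangentValues ((univ : Set E) ×ˢ M') (z, w) := by
    refine ⟨fun v => (0, X v.2), analyticAt_const.prod
      (AnalyticAt.fun_comp (g := X) hwa analyticAt_snd), ?_, rfl⟩
    have ht : Tendsto (Prod.snd : E × F → F) (𝓝[(univ : Set E) ×ˢ M'] (z, w)) (𝓝[M'] w) :=
      tendsto_nhdsWithin_of_eventually_mem (g := Prod.snd) continuousAt_snd
        (by filter_upwards [self_mem_nhdsWithin] with x hx using hx.2)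
    filter_upwards [self_mem_nhdsWithin, ht.eventually hwT] with x hx hxT
    exact (mem_complexTangentSpace_univ_prod (z := x.1) hx.2 _).2 hxT
  -- At a point w with X w ≠ 0 the constant fields along E together with (0, X) already produce dim
  -- E + 1 independent values.
  let f : (E × ℂ) →ₗ[ℂ] tangentValues ((univ : Set E) ×ˢ M') (z, w) :=
    { toFun := fun v => ⟨(v.1, v.2 • X w), by
        have := add_mem (h1 v.1) (Submodule.smul_mem _ v.2 h2)
        simpa using this⟩
      map_add' := fun a b => Subtype.ext (Prod.ext rfl (add_smul _ _ _))
      map_smul' := fun c a => Subtype.ext (Prod.ext rfl (mul_smul _ _ _)) }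
  have hf : Function.Injective f := by
    refine (injective_iff_map_eq_zero f).2 fun v hv => ?_
    have h3 : (v.1, v.2 • X w) = 0 := congrArg Subtype.val hv
    refine Prod.ext (Prod.ext_iff.1 h3).1 ?_
    exact (smul_eq_zero.1 (Prod.ext_iff.1 h3).2).resolve_right hw0
  have := LinearMap.finrank_le_finrank_of_injective hf
  rw [Module.finrank_prod, Module.finrank_self] at this
  omega

/-- Where the space of values of tangent holomorphic vector fields has locally maximal dimension,
the fields can be straightened. -/
theorem mem_straightPoints_of_finrank {N d l : ℕ} {M : Set (Fin N → ℂ)}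
    (hM : IsRealAnalyticCRSubmanifold d M) {p : Fin N → ℂ} (hp : p ∈ M)
    (hl : Module.finrank ℂ (tangentValues M p) = l)
    (hle : ∀ᶠ q in 𝓝[M] p, Module.finrank ℂ (tangentValues M q) ≤ l) :
    p ∈ straightPoints N l M := by
  let K := tangentValues M p
  have hK : Module.finrank ℂ K = l := hl
  let B := Module.finBasisOfFinrankEq ℂ K hK
  have hB : ∀ i, ∃ X : (Fin N → ℂ) → (Fin N → ℂ), AnalyticAt ℂ X p ∧
      (∀ᶠ q in 𝓝[M] p, X q ∈ complexTangentSpace M q) ∧ X p = B i := fun i => (B i).2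
  choose X hX hXT hXB using hB
  obtain ⟨C, hKC⟩ := K.exists_isCompl
  have hCK := Submodule.finrank_add_eq_of_isCompl hKC
  rw [Module.finrank_fin_fun, hK] at hCK
  have hC : Module.finrank ℂ C = N - l := by omega
  let c := Module.finBasisOfFinrankEq ℂ C hC
  let ι : (Fin (N - l) → ℂ) →L[ℂ] (Fin N → ℂ) :=
    LinearMap.toContinuousLinearMap (C.subtype.comp c.equivFun.symm.toLinearMap)
  have hιC : ∀ w, ι w ∈ C := fun w => (c.equivFun.symm w).2
  have hι : ∀ x ∈ C, ∃ w, ι w = x := fun x hx =>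
    ⟨c.equivFun ⟨x, hx⟩, congrArg Subtype.val (c.equivFun.symm_apply_apply ⟨x, hx⟩)⟩
  have hιinj : Function.Injective ι :=
    Subtype.val_injective.comp c.equivFun.symm.injective
  have hsum : ∀ z : Fin l → ℂ, ∑ i, z i • X i p = (B.equivFun.symm z : K) := fun z => by
    simp only [hXB]
    rw [Module.Basis.equivFun_symm_apply, Submodule.coe_sum]
    rfl
  obtain ⟨Φ, hΦa, hΦ0, hΦd, hΦM⟩ := exists_straightening_map hM.1 hp hX hXT
  have hΦp : Φ (0, p) = p := hΦ0.self_of_nhds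
  let S : (Fin l → ℂ) × (Fin (N - l) → ℂ) → (Fin l → ℂ) × (Fin N → ℂ) := fun v => (v.1, p + ι v.2)
  have hSa : AnalyticAt ℂ S 0 := analyticAt_fst.prod
    (analyticAt_const.add ((ι.analyticAt _).fun_comp analyticAt_snd))
  have hS0 : S 0 = (0, p) := by simp [S]
  have hSt : Tendsto S (𝓝 0) (𝓝 (0, p)) := by
    rw [← hS0]; exact hSa.continuousAt.tendsto
  -- The slice p + C, transversal to the space K of values, is moved by the flows. The differential
  -- at 0 is the sum of the isomorphisms onto K and C, so Ψ is a local biholomorphism.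
  let Ψ : (Fin l → ℂ) × (Fin (N - l) → ℂ) → (Fin N → ℂ) := fun v => Φ (S v)
  have hΨa : AnalyticAt ℂ Ψ 0 := AnalyticAt.fun_comp (g := Φ) (by rw [hS0]; exact hΦa) hSa
  have hΨ0 : Ψ 0 = p := by simp only [Ψ, hS0, hΦp]
  have hΨd : ∀ v, fderiv ℂ Ψ 0 v = ∑ i, v.1 i • X i p + ι v.2 := by
    intro v
    have h1 : HasFDerivAt S ((ContinuousLinearMap.fst ℂ _ _).prod
        (ι.comp (ContinuousLinearMap.snd ℂ _ _))) 0 :=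
      hasFDerivAt_fst.prodMk ((ι.hasFDerivAt.comp _ hasFDerivAt_snd).const_add p)
    have h2 : HasFDerivAt Ψ ((fderiv ℂ Φ (0, p)).comp ((ContinuousLinearMap.fst ℂ _ _).prod
        (ι.comp (ContinuousLinearMap.snd ℂ _ _)))) 0 :=
      HasFDerivAt.comp (0 : (Fin l → ℂ) × (Fin (N - l) → ℂ)) (g := Φ)
        (by rw [hS0]; exact hΦa.differentiableAt.hasFDerivAt) h1
    rw [h2.fderiv]
    exact hΦd _
  have hinj : Function.Injective (fderiv ℂ Ψ 0) := by
    refine (injective_iff_map_eq_zero _).2 fun v hv => ?_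
    rw [hΨd, hsum] at hv
    have h1 : ι v.2 = ((-(B.equivFun.symm v.1) : K) : Fin N → ℂ) := by
      rw [Submodule.coe_neg]; exact eq_neg_of_add_eq_zero_right hv
    have h2 : ι v.2 ∈ K ⊓ C := ⟨by rw [h1]; exact Subtype.property _, hιC _⟩
    rw [hKC.inf_eq_bot, Submodule.mem_bot] at h2
    rw [h2, add_zero] at hv
    have h3 : B.equivFun.symm v.1 = 0 := Subtype.ext hv
    refine Prod.ext ?_ (hιinj (h2.trans (map_zero ι).symm))
    exact B.equivFun.symm.map_eq_zero_iff.1 h3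
  have hbij : Function.Bijective (fderiv ℂ Ψ 0) := by
    refine ⟨hinj, ?_⟩
    refine (LinearMap.injective_iff_surjective_of_finrank_eq_finrank
      (f := (fderiv ℂ Ψ 0).toLinearMap) ?_).1 hinj
    rw [Module.finrank_prod, Module.finrank_fin_fun, Module.finrank_fin_fun,
      Module.finrank_fin_fun]
    omega
  obtain ⟨H, h0H, hHΨ, hHa⟩ := exists_openPartialHomeomorph_of_bijective hΨa hbij
  obtain ⟨U₀, hU₀o, hpU₀, ρ, hρ, hρs, hMU₀⟩ := hM.1 p hp
  -- the slice
  let j : (Fin (N - l) → ℂ) → (Fin N → ℂ) := fun w => p + ι w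
  have hjd : ∀ w, HasFDerivAt j (ι.restrictScalars ℝ) w := fun w =>
    (ι.restrictScalars ℝ).hasFDerivAt.const_add p
  have hja : ∀ w, AnalyticAt ℝ j w := fun w =>
    analyticAt_const.add ((ι.restrictScalars ℝ).analyticAt w)
  have hj0 : j 0 = p := by simp [j]
  have hjU : ∀ᶠ w in 𝓝 0, j w ∈ U₀ :=
    (hja 0).continuousAt.eventually (hU₀o.mem_nhds (by rw [hj0]; exact hpU₀))
  -- Values of tangent fields are killed by dρ, so dρ maps C onto everything: the slice meets M
  -- transversally and M' has the same codimension d.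
  have hsurj0 : Function.Surjective ((fderiv ℝ ρ (j 0)).comp (ι.restrictScalars ℝ)) := by
    rw [hj0]
    intro y
    obtain ⟨x, rfl⟩ := hρs p hpU₀ y
    obtain ⟨a, b, hab, -⟩ := Submodule.existsUnique_add_of_isCompl hKC x
    obtain ⟨w, hw⟩ := hι b b.2
    refine ⟨w, ?_⟩
    have ha : fderiv ℝ ρ p a = 0 := by
      obtain ⟨Y, hY, hYT, hYa⟩ := a.2
      have hT : (a : Fin N → ℂ) ∈ realTangentSpace M p := by
        have := hYT.self_of_nhdsWithin hp
        rw [hYa] at this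
        exact this.1
      funext i
      have h1 := hT (fun x => ρ x i) (analyticAt_pi_iff.1 (hρ p hpU₀) i) (by
        filter_upwards [self_mem_nhdsWithin, nhdsWithin_le_nhds (hU₀o.mem_nhds hpU₀)] with q h1 h2
        have : q ∈ M ∩ U₀ := ⟨h1, h2⟩
        rw [hMU₀] at this
        exact congrFun this.2 i)
      have h2 : HasFDerivAt (fun x => ρ x i) ((ContinuousLinearMap.proj i).comp (fderiv ℝ ρ p)) p :=
        (hasFDerivAt_pi'.1 (hρ p hpU₀).differentiableAt.hasFDerivAt) i
      rw [h2.fderiv] at h1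
      exact h1
    change fderiv ℝ ρ p (ι w) = fderiv ℝ ρ p x
    rw [← hab, map_add, ha, zero_add, hw]
  have hsurj : ∀ᶠ w in 𝓝 0, Function.Surjective ((fderiv ℝ ρ (j w)).comp (ι.restrictScalars ℝ)) := by
    refine eventually_surjective ?_ hsurj0
    refine ContinuousAt.clm_comp ?_ continuousAt_const
    refine ContinuousAt.comp (g := fderiv ℝ ρ) ?_ (hja 0).continuousAt
    rw [hj0]
    exact (hρ p hpU₀).fderiv.continuousAt
  have hgood : ∀ᶠ v in 𝓝 (0 : (Fin l → ℂ) × (Fin (N - l) → ℂ)), v ∈ H.source ∧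
      AnalyticAt ℂ Ψ v ∧ AnalyticAt ℂ H.symm (Ψ v) ∧ (Ψ v ∈ M ↔ j v.2 ∈ M) ∧ j v.2 ∈ U₀ ∧
      Function.Surjective ((fderiv ℝ ρ (j v.2)).comp (ι.restrictScalars ℝ)) := by
    have hsnd : Tendsto (Prod.snd : (Fin l → ℂ) × (Fin (N - l) → ℂ) → _) (𝓝 0) (𝓝 0) :=
      continuousAt_snd
    filter_upwards [H.open_source.mem_nhds h0H, hΨa.eventually_analyticAt,
      hΨa.continuousAt.eventually hHa.eventually_analyticAt, hSt.eventually hΦM,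
      hsnd.eventually hjU, hsnd.eventually hsurj] with v h1 h2 h3 h4 h5 h6
    exact ⟨h1, h2, h3, h4, h5, h6⟩
  obtain ⟨r, hr, hball⟩ := Metric.eventually_nhds_iff_ball.1 hgood
  let M' : Set (Fin (N - l) → ℂ) := {w | w ∈ Metric.ball 0 r ∧ j w ∈ M}
  have h0M' : (0 : Fin (N - l) → ℂ) ∈ M' := ⟨Metric.mem_ball_self hr, by rw [hj0]; exact hp⟩
  let D : Set ((Fin l → ℂ) × (Fin (N - l) → ℂ)) := Metric.ball 0 r
  have hmemD : ∀ z w, (z, w) ∈ D ↔ z ∈ Metric.ball 0 r ∧ w ∈ Metric.ball 0 r := fun z w => by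
    have : D = Metric.ball (0 : Fin l → ℂ) r ×ˢ Metric.ball (0 : Fin (N - l) → ℂ) r := by
      rw [ball_prod_same]; rfl
    rw [this, mem_prod]
  have hDM : ∀ v ∈ D, (Ψ v ∈ M ↔ v ∈ (univ : Set (Fin l → ℂ)) ×ˢ M') := fun v hv => by
    rw [(hball v hv).2.2.2.1]
    exact ⟨fun h => ⟨mem_univ _, ((hmemD v.1 v.2).1 hv).2, h⟩, fun h => h.2.2⟩
  have hleft : ∀ v ∈ D, H.symm (Ψ v) = v := fun v hv => by
    rw [← hHΨ]; exact H.left_inv (hball v hv).1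
  have htgt : ∀ v ∈ D, Ψ v ∈ H.target := fun v hv => by
    rw [← hHΨ]; exact H.map_source (hball v hv).1
  have hright : ∀ y ∈ H.target, Ψ (H.symm y) = y := fun y hy => by
    rw [← hHΨ]; exact H.right_inv hy
  have hbih : ∀ v ∈ D, IsLocalBiholomorphism ((univ : Set (Fin l → ℂ)) ×ˢ M') v M (Ψ v) Ψ H.symm := by
    intro v hv
    obtain ⟨b1, b2, b3, -⟩ := hball v hv
    refine ⟨b2, b3, rfl, hleft v hv, ?_, ?_, ?_, ?_⟩
    · filter_upwards [Metric.isOpen_ball.mem_nhds hv] with x hx using hleft x hx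
    · filter_upwards [H.open_target.mem_nhds (htgt v hv)] with y hy using hright y hy
    · filter_upwards [self_mem_nhdsWithin, nhdsWithin_le_nhds (Metric.isOpen_ball.mem_nhds hv)]
        with x h1 h2
      exact (hDM x h2).2 h1
    · have hc : Tendsto H.symm (𝓝 (Ψ v)) (𝓝 v) := by
        have := b3.continuousAt.tendsto
        rwa [hleft v hv] at this
      filter_upwards [self_mem_nhdsWithin,
        nhdsWithin_le_nhds (hc.eventually (Metric.isOpen_ball.mem_nhds hv)),
        nhdsWithin_le_nhds (H.open_target.mem_nhds (htgt v hv))] with y h1 h2 h3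
      refine (hDM _ h2).1 ?_
      rwa [hright y h3]
  have hDw : ∀ w ∈ Metric.ball (0 : Fin (N - l) → ℂ) r, ((0 : Fin l → ℂ), w) ∈ D := fun w hw =>
    (hmemD 0 w).2 ⟨Metric.mem_ball_self hr, hw⟩
  refine ⟨hp, d, M', ⟨?_, ?_⟩, h0M', ?_, ?_⟩
  · intro w₀ hw₀
    refine ⟨Metric.ball 0 r, Metric.isOpen_ball, hw₀.1, fun w => ρ (j w), ?_, ?_, ?_⟩
    · intro w hw
      exact AnalyticAt.fun_comp (g := ρ) (hρ _ (hball _ (hDw w hw)).2.2.2.2.1) (hja w)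
    · intro w hw
      obtain ⟨-, -, -, -, b5, b6⟩ := hball _ (hDw w hw)
      have : HasFDerivAt (fun w => ρ (j w)) ((fderiv ℝ ρ (j w)).comp (ι.restrictScalars ℝ)) w :=
        HasFDerivAt.comp w (g := ρ) (hρ _ b5).differentiableAt.hasFDerivAt (hjd w)
      rw [this.fderiv]
      exact b6
    · ext w
      constructor
      · rintro ⟨⟨h1, h2⟩, -⟩
        have : j w ∈ M ∩ U₀ := ⟨h2, (hball _ (hDw w h1)).2.2.2.2.1⟩
        rw [hMU₀] at this
        exact ⟨h1, this.2⟩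
      · rintro ⟨h1, h2⟩
        have : j w ∈ M ∩ U₀ := by
          rw [hMU₀]
          exact ⟨(hball _ (hDw w h1)).2.2.2.2.1, h2⟩
        exact ⟨⟨h1, this.1⟩, h1⟩
  · obtain ⟨n, hn⟩ := hM.2
    refine ⟨n - l, fun w hw => ?_⟩
    have h1 := (hbih (0, w) (hDw w hw.1)).finrank_complexTangentSpace_eq
    rw [finrank_complexTangentSpace_univ_prod hw, Module.finrank_fin_fun,
      hn _ ((hDM _ (hDw w hw.1)).2 ⟨mem_univ _, hw⟩)] at h1
    omega
  -- Local maximality of the dimension is used only here, transported by Ψ to the product ℂ^l × M'.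
  · refine isHolomorphicallyNondegenerateAt_of_finrank_le (E := Fin l → ℂ) (z := 0) ?_
    have hin : Tendsto (fun w : Fin (N - l) → ℂ => ((0 : Fin l → ℂ), w)) (𝓝[M'] 0)
        (𝓝[(univ : Set (Fin l → ℂ)) ×ˢ M'] 0) :=
      tendsto_nhdsWithin_of_eventually_mem (g := fun w : Fin (N - l) → ℂ => ((0 : Fin l → ℂ), w))
        (by fun_prop) (by filter_upwards [self_mem_nhdsWithin] with w hw using ⟨mem_univ _, hw⟩)
    have hΨt := (hbih 0 (Metric.mem_ball_self hr)).tendsto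
    rw [hΨ0] at hΨt
    filter_upwards [hin.eventually (hΨt.eventually hle), self_mem_nhdsWithin] with w h1 h2
    rwa [(hbih (0, w) (hDw w h2.1)).finrank_tangentValues_eq, Module.finrank_fin_fun]
  · let H' := H.restrOpen D Metric.isOpen_ball
    have hs : H'.source = D := by
      change H.source ∩ D = D
      exact inter_eq_right.2 fun v hv => (hball v hv).1
    have hD0 : (0 : (Fin l → ℂ) × (Fin (N - l) → ℂ)) ∈ D := Metric.mem_ball_self hr
    have hcoe : ⇑H' = Ψ := hHΨ
    have htarget : ∀ y ∈ H'.target, H.symm y ∈ D ∧ Ψ (H.symm y) = y := by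
      intro y hy
      have h1 := H'.map_target hy
      rw [hs] at h1
      have h2 := H'.right_inv hy
      rw [hcoe] at h2
      exact ⟨h1, h2⟩
    have hmapD : ∀ v ∈ D, Ψ v ∈ H'.target := fun v hv => by
      rw [← hcoe]; exact H'.map_source (by rwa [hs])
    refine ⟨H'.symm, ?_, ?_, ?_, ?_, ?_⟩
    · have := hmapD 0 hD0
      rwa [hΨ0] at this
    · have := hleft 0 hD0
      rwa [hΨ0] at this
    · intro y hy
      obtain ⟨h1, h2⟩ := htarget y hy
      have := (hball _ h1).2.2.1
      rw [h2] at this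
      exact this.differentiableAt.differentiableWithinAt
    · intro v hv
      have hv' : v ∈ D := by rw [← hs]; exact hv
      change DifferentiableWithinAt ℂ H' _ v
      rw [hcoe]
      exact (hball v hv').2.1.differentiableAt.differentiableWithinAt
    · ext v
      constructor
      · rintro ⟨y, ⟨hyM, hyt⟩, rfl⟩
        obtain ⟨h1, h2⟩ := htarget y hyt
        refine ⟨(hDM _ h1).1 (by rwa [h2]), ?_⟩
        exact H'.map_target hyt
      · rintro ⟨hvM, hvt⟩
        have hv' : v ∈ D := by rw [← hs]; exact hvt
        exact ⟨Ψ v, ⟨(hDM v hv').2 hvM, hmapD v hv'⟩, hleft v hv'⟩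

end Straight

end CRGeom

namespace CRGeom

/-! ### Globalization over the connected manifold M. -/

section Global

/-- Real and imaginary parts serve as real equations. Since local equations are given around every
point of M, the closure of Υ adds no point of M. -/
theorem isClosedRealAnalyticSubvariety_of_isLocallyComplexAnalyticIn {E : Type*}
    [NormedAddCommGroup E] [NormedSpace ℂ E] {M Υ : Set E} (hΥ : Υ ⊆ M)
    (h : IsLocallyComplexAnalyticIn M Υ) : IsClosedRealAnalyticSubvariety M Υ := by
  refine ⟨hΥ, ⟨closure Υ, isClosed_closure, ?_⟩, ?_⟩
  · refine Subset.antisymm (fun x hx => ⟨hΥ hx, subset_closure hx⟩) ?_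
    rintro q ⟨hqM, hq⟩
    obtain ⟨U, hUo, hqU, k, f, hf, hΥU⟩ := h q hqM
    have hfreq : ∃ᶠ x in 𝓝 q, f x = 0 := by
      refine ((mem_closure_iff_frequently.1 hq).and_eventually (hUo.mem_nhds hqU)).mono
        fun x hx => ?_
      have : x ∈ Υ ∩ U := hx
      rw [hΥU] at this
      exact this.2.2
    have hfq : f q = 0 := by
      by_contra hne
      exact hfreq ((hf q hqU).continuousAt.eventually_ne hne)
    have : q ∈ Υ ∩ U := by rw [hΥU]; exact ⟨hqM, hqU, hfq⟩
    exact this.1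
  · intro p hp
    obtain ⟨U, hUo, hpU, k, f, hf, hΥU⟩ := h p hp
    refine ⟨U, hUo, hpU, k + k, fun x => Fin.append (fun i => (f x i).re) (fun i => (f x i).im),
      ?_, ?_⟩
    · intro x hx
      have hfi : ∀ i, AnalyticAt ℝ (fun x => f x i) x := fun i =>
        (analyticAt_pi_iff.1 (hf x hx) i).restrictScalars (𝕜 := ℝ)
      refine AnalyticAt.pi fun i => ?_
      refine Fin.addCases (fun i => ?_) (fun i => ?_) i
      · simp only [Fin.append_left]
        exact (Complex.reCLM.analyticAt _).fun_comp (hfi i)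
      · simp only [Fin.append_right]
        exact (Complex.imCLM.analyticAt _).fun_comp (hfi i)
    · rw [hΥU]
      ext x
      have hiff : f x = 0 ↔
          Fin.append (fun i => (f x i).re) (fun i => (f x i).im) = 0 := by
        constructor
        · intro h0
          funext i
          refine Fin.addCases (fun i => ?_) (fun i => ?_) i
          · rw [Fin.append_left, h0]; rfl
          · rw [Fin.append_right, h0]; rfl
        · intro h0
          funext i
          refine Complex.ext ?_ ?_
          · have := congrFun h0 (Fin.castAdd k i)
            rwa [Fin.append_left] at this
          · have := congrFun h0 (Fin.natAdd k i)
            rwa [Fin.append_right] at this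
      simp only [mem_inter_iff, mem_ofPred_eq, hiff, and_assoc]

theorem tangentValues_le_complexTangentSpace {E : Type*} [NormedAddCommGroup E] [NormedSpace ℂ E]
    {M : Set E} {p : E} (hp : p ∈ M) : tangentValues M p ≤ complexTangentSpace M p := by
  rintro v ⟨X, -, hXT, rfl⟩
  exact hXT.self_of_nhdsWithin hp

/-- Positive codimension provides a vector not killed by dρ; this is what forces l < N. -/
theorem complexTangentSpace_ne_top {E : Type*} [NormedAddCommGroup E] [NormedSpace ℂ E] {d : ℕ}
    (hd : 1 ≤ d) {M : Set E} (hM : IsRealAnalyticSubmanifold d M) {p : E} (hp : p ∈ M) :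
    complexTangentSpace M p ≠ ⊤ := by
  intro htop
  obtain ⟨U, hUo, hpU, ρ, hρ, hρs, hMU⟩ := hM p hp
  obtain ⟨v, hv⟩ := hρs p hpU (fun _ => 1)
  have hvT : v ∈ complexTangentSpace M p := by rw [htop]; trivial
  let i : Fin d := ⟨0, hd⟩
  have h1 := hvT.1 (fun x => ρ x i) (analyticAt_pi_iff.1 (hρ p hpU) i) (by
    filter_upwards [self_mem_nhdsWithin, nhdsWithin_le_nhds (hUo.mem_nhds hpU)] with q h1 h2
    have : q ∈ M ∩ U := ⟨h1, h2⟩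
    rw [hMU] at this
    exact congrFun this.2 i)
  have h2 : HasFDerivAt (fun x => ρ x i) ((ContinuousLinearMap.proj i).comp (fderiv ℝ ρ p)) p :=
    (hasFDerivAt_pi'.1 (hρ p hpU).differentiableAt.hasFDerivAt) i
  rw [h2.fderiv] at h1
  have h3 : fderiv ℝ ρ p v i = 0 := h1
  rw [hv] at h3
  exact one_ne_zero h3

/-- On a connected CR submanifold, the generic dimension of the space of values of tangent
holomorphic vector fields is globally defined. -/
theorem exists_generic_finrank_tangentValues {E : Type} [NormedAddCommGroup E] [NormedSpace ℂ E]
    [FiniteDimensional ℂ E] {d : ℕ} {M : Set E} (hM : IsRealAnalyticCRSubmanifold d M)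
    (hconn : IsPreconnected M) :
    ∃ l : ℕ, ∀ p ∈ M, ∃ (k : ℕ) (U : Set E) (f : E → (Fin k → ℂ)), IsOpen U ∧ p ∈ U ∧
      AnalyticOnNhd ℂ f U ∧ ∀ q ∈ M ∩ U, Module.finrank ℂ (tangentValues M q) ≤ l ∧
        (Module.finrank ℂ (tangentValues M q) = l ↔ f q ≠ 0) ∧ ∃ᶠ q' in 𝓝[M] q, f q' ≠ 0 := by
  classical
  have hloc := fun (p : E) (hp : p ∈ M) => exists_equations_finrank_tangentValues hM hp
  choose! L hL using hloc
  have hcongr : ∀ p ∈ M, ∀ᶠ q in 𝓝[M] p, L q = L p := by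
    intro p hp
    obtain ⟨k, U, f, hUo, hpU, hf, hfU⟩ := hL p hp
    filter_upwards [self_mem_nhdsWithin, nhdsWithin_le_nhds (hUo.mem_nhds hpU)] with q hqM hqU
    obtain ⟨k', U', f', hUo', hqU', hf', hfU'⟩ := hL q hqM
    have hev : ∀ᶠ q' in 𝓝[M] q, q' ∈ M ∧ q' ∈ U ∧ q' ∈ U' := by
      filter_upwards [self_mem_nhdsWithin, nhdsWithin_le_nhds (hUo.mem_nhds hqU),
        nhdsWithin_le_nhds (hUo'.mem_nhds hqU')] with q' h1 h2 h3 using ⟨h1, h2, h3⟩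
    -- Each of the two local generic dimensions is attained at points of M arbitrarily near q, where
    -- the other one is an upper bound.
    refine le_antisymm ?_ ?_
    · obtain ⟨q', hq', h1, h2, h3⟩ := ((hfU' q ⟨hqM, hqU'⟩).2.2.and_eventually hev).exists
      have e1 := (hfU' q' ⟨h1, h3⟩).2.1.2 hq'
      have e2 := (hfU q' ⟨h1, h2⟩).1
      omega
    · obtain ⟨q', hq', h1, h2, h3⟩ := ((hfU q ⟨hqM, hqU⟩).2.2.and_eventually hev).exists
      have e1 := (hfU q' ⟨h1, h2⟩).2.1.2 hq'
      have e2 := (hfU' q' ⟨h1, h3⟩).1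
      omega
  have hcont : ContinuousOn L M := fun p hp =>
    continuousWithinAt_const.congr_of_eventuallyEq (hcongr p hp) rfl
  rcases M.eq_empty_or_nonempty with rfl | ⟨p₀, hp₀⟩
  · exact ⟨0, fun p hp => absurd hp (notMem_empty p)⟩
  · refine ⟨L p₀, fun p hp => ?_⟩
    rw [← hconn.constant hcont hp hp₀]
    exact hL p hp

end Global

end CRGeom

theorem proposition5p4 (N : ℕ) (hN : 2 ≤ N) (d : ℕ) (hd : 1 ≤ d) (M : Set (Fin N → ℂ))
    (hM : CRGeom.IsRealAnalyticCRSubmanifold d M) (hconn : IsConnected M) :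
    ∃! l : ℕ, l < N ∧ ∃ Υ : Set (Fin N → ℂ),
      CRGeom.IsClosedRealAnalyticSubvariety M Υ ∧ Υ ≠ M ∧
      M \ Υ = CRGeom.straightPoints N l M ∧
      CRGeom.IsLocallyComplexAnalyticIn M Υ := by
  obtain ⟨l, hl⟩ := CRGeom.exists_generic_finrank_tangentValues hM hconn.isPreconnected
  have hfreq : ∀ p ∈ M, ∃ᶠ q in 𝓝[M] p,
      Module.finrank ℂ (CRGeom.tangentValues M q) = l := by
    intro p hp
    obtain ⟨k, U, f, hUo, hpU, hf, hfU⟩ := hl p hp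
    have hev : ∀ᶠ q in 𝓝[M] p, q ∈ M ∩ U :=
      inter_mem self_mem_nhdsWithin (nhdsWithin_le_nhds (hUo.mem_nhds hpU))
    exact ((hfU p ⟨hp, hpU⟩).2.2.and_eventually hev).mono fun q hq => (hfU q hq.2).2.1.2 hq.1
  have hle : ∀ p ∈ M, Module.finrank ℂ (CRGeom.tangentValues M p) ≤ l := by
    intro p hp
    obtain ⟨k, U, f, hUo, hpU, hf, hfU⟩ := hl p hp
    exact (hfU p ⟨hp, hpU⟩).1
  obtain ⟨p₀, hp₀⟩ := hconn.nonempty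
  obtain ⟨q₀, hq₀, hq₀M⟩ := ((hfreq p₀ hp₀).and_eventually self_mem_nhdsWithin).exists
  -- The exceptional set is the locus where the dimension of the value space is below its generic
  -- value l.
  refine ⟨l, ⟨?_, {q | q ∈ M ∧ Module.finrank ℂ (CRGeom.tangentValues M q) < l}, ?_⟩, ?_⟩
  · have h1 := Submodule.finrank_lt (CRGeom.complexTangentSpace_ne_top hd hM.1 hq₀M)
    have h2 := Submodule.finrank_mono (CRGeom.tangentValues_le_complexTangentSpace hq₀M)
    rw [Module.finrank_fin_fun] at h1
    omega
  · have hloc : CRGeom.IsLocallyComplexAnalyticIn M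
        {q | q ∈ M ∧ Module.finrank ℂ (CRGeom.tangentValues M q) < l} := by
      intro p hp
      obtain ⟨k, U, f, hUo, hpU, hf, hfU⟩ := hl p hp
      refine ⟨U, hUo, hpU, k, f, hf, ?_⟩
      ext q
      constructor
      · rintro ⟨⟨hqM, hq⟩, hqU⟩
        refine ⟨hqM, hqU, ?_⟩
        by_contra hne
        exact hq.ne ((hfU q ⟨hqM, hqU⟩).2.1.2 hne)
      · rintro ⟨hqM, hqU, hq⟩
        refine ⟨⟨hqM, lt_of_le_of_ne (hle q hqM) fun heq => ?_⟩, hqU⟩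
        exact (hfU q ⟨hqM, hqU⟩).2.1.1 heq hq
    refine ⟨CRGeom.isClosedRealAnalyticSubvariety_of_isLocallyComplexAnalyticIn
      (fun q hq => hq.1) hloc, ?_, ?_, hloc⟩
    · intro heq
      have : q₀ ∈ {q | q ∈ M ∧ Module.finrank ℂ (CRGeom.tangentValues M q) < l} := by
        rw [heq]; exact hq₀M
      exact this.2.ne hq₀
    · ext q
      constructor
      · rintro ⟨hqM, hq⟩
        have heq : Module.finrank ℂ (CRGeom.tangentValues M q) = l :=
          le_antisymm (hle q hqM) (not_lt.1 fun hlt => hq ⟨hqM, hlt⟩)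
        refine CRGeom.mem_straightPoints_of_finrank hM hqM heq ?_
        filter_upwards [self_mem_nhdsWithin] with q' hq' using hle q' hq'
      · intro hq
        have heq := CRGeom.finrank_tangentValues_of_mem_straightPoints hq
        exact ⟨hq.1, fun hlt => hlt.2.ne heq⟩
  -- The complement of any admissible Υ is nonempty and open in M, so it contains a point where the
  -- dimension has its generic value l; being straight for l', that point also has dimension l'.
  · rintro l' ⟨-, Υ, ⟨hΥM, ⟨C, hC, hΥC⟩, -⟩, hne, hstr, -⟩
    obtain ⟨q, hqM, hqΥ⟩ : ∃ q ∈ M, q ∉ Υ := by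
      by_contra hcon
      push Not at hcon
      exact hne (Subset.antisymm hΥM hcon)
    have hqC : q ∈ Cᶜ := fun hq => hqΥ (by rw [hΥC]; exact ⟨hqM, hq⟩)
    have hev : ∀ᶠ q' in 𝓝[M] q, q' ∈ M \ Υ := by
      filter_upwards [self_mem_nhdsWithin, nhdsWithin_le_nhds (hC.isOpen_compl.mem_nhds hqC)]
        with q' h1 h2
      exact ⟨h1, fun h => h2 (by rw [hΥC] at h; exact h.2)⟩
    obtain ⟨q', h1, h2⟩ := ((hfreq q hqM).and_eventually hev).exists
    rw [hstr] at h2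
    rw [← h1, CRGeom.finrank_tangentValues_of_mem_straightPoints h2]
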